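/- **Setting.** Let $L>0$, $I=(0,L)$, $a_0>0$, $a_1\in\mathbb R$, $k\in\{0,1,2\}$, let $\|\cdot\|$ be the norm of $L^2(I)$, and put $H_0=L^2(I)$, $H_1=H^1_0(I)$, $H_2=H^2_0(I)$. Let $f:[0,\infty)\to\mathbb R$ satisfy, for some $c_0>0$, $$f\in C^2([0,\infty)),\quad f'<0,\quad 0\le f''\le -c_0f',\quad f(0)>0,\quad \lim_{s\to\infty}f(s)=0,$$ and put $g=-f'$. Let $\xi\in C^1([0,\infty);[0,\infty))$ satisfy $\xi'\le0$, $\int_0^\infty\xi(s)\,ds=\infty$ and $g'\le-\xi g$. Let $L_g$ be the space of (strongly measurable) $v:[0,\infty)\to H_k$ with $\|v\|_{L_g}^2=\int_0^\infty g(s)\|\partial_x^kv(s)\|^2ds<\infty$, and $\mathcal H=L^2(I)\times L_g$ with $\|(v,\eta)\|_{\mathcal H}^2=\|v\|^2+\|\eta\|_{L_g}^2$. Let $M_P$ be the smallest positive constant with $\|v\|^2\le M_P\|\partial_xv\|^2$ for all $v\in H^1_0(I)$, and let $M_S>0$ be a constant with $\|v\|_{L^\infty(I)}^2\le M_S(\|v\|^2+\|\partial_xv\|^2)$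 for all $v\in H^1(I)$. Consider the Kawahara equation with infinite memory $$\partial_tu+\partial_x^3u-a_0\partial_x^5u+u\partial_xu+a_1\partial_xu+(-1)^k\int_0^\infty g(s)\,\partial_x^{2k}\eta^t(\cdot,s)\,ds=0\quad\text{in } I\times(0,\infty),$$ $$u(0,t)=u(L,t)=\partial_xu(0,t)=\partial_xu(L,t)=\partial_x^2u(L,t)=0,$$ where $\eta^t(\cdot,s)=\int_{t-s}^tu(\cdot,\tau)\,d\tau$ for $s\le t$ and $\eta^t(\cdot,s)=\eta^0(\cdot,s-t)+\int_0^tu(\cdot,\tau)\,d\tau$ for $s>t$, with initial datum $U_0=(u(\cdot,0),\eta^0)\in\mathcal H$. If the past $u(x,-\tau)=u_0(x,\tau)$, $\tau\ge0$, is given, then $\eta^0(\cdot,s)=\int_0^su_0(\cdot,\tau)\,d\tau$, and $\int_0^\infty g(s)\partial_x^{2k}\eta^t(\cdot,s)\,ds=\int_0^\infty f(s)\partial_x^{2k}u(\cdot,t-s)\,ds$. A solution is a global weak (equivalently, mild) solution with $U=(u,\eta^t)\in C([0,\infty);\mathcal H)$ and $u\in L^2(0,T;H^2_0(I))$ for every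 $T>0$. Its energy is $$E(t)=\tfrac12\Bigl(\|u(t)\|^2+\int_0^\infty g(s)\|\partial_x^k\eta^t(\cdot,s)\|^2ds\Bigr).$$ **Theorem 1.1.** If $U_0\in\mathcal H$ satisfies $$a_1M_P^2+\tfrac23M_P(M_P+1)\sqrt L\,M_S\|U_0\|_{\mathcal H}<5a_0,$$ then there are constants $c,\tilde c>0$ (which may depend on $U_0$) such that the solution with initial datum $U_0$ satisfies: (i) if $\xi$ is constant, then $E(t)\le\tilde c\,e^{-ct}$ for all $t\ge0$; (ii) if $\xi$ is not constant, then for all $t\ge0$ $$E(t)\le\tilde c\,e^{-c\int_0^t\xi(\tau)d\tau}\Bigl(1+\int_0^te^{c\int_0^\sigma\xi(\tau)d\tau}\,\xi(\sigma)\int_\sigma^\infty g(s)h(\sigma,s)\,ds\,d\sigma\Bigr),$$ where, for $0\le t\le s$, $h(t,s)=t^2+t+\|\partial_x^k\eta^0(\cdot,s-t)\|^2$; that is, if the history $\eta^0$ is given by a locally integrable past $u_0:[0,\infty)\to H_k$, $$h(t,s)=t^2+t+\Bigl\|\int_0^{s-t}\partial_x^ku_0(\cdot,\tau)\,d\tau\Bigr\|^2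 .$$ -/

import Mathlib

open MeasureTheory Set Filter Topology

namespace Kawahara

noncomputable section

/-- Lebesgue measure on the interval `I = (0, L)`. -/
abbrev intervalMeasure (L : ℝ) : Measure ℝ := volume.restrict (Ioo 0 L)

/-- The real Hilbert space `L²(I)`, `I = (0, L)`. -/
abbrev L2 (L : ℝ) : Type := Lp ℝ 2 (intervalMeasure L)

/-- `φ ∈ C_c^∞(I)`, `I = (0, L)`. -/
structure IsTest (L : ℝ) (φ : ℝ → ℝ) : Prop where
  smooth : ContDiff ℝ ((⊤ : ℕ∞) : WithTop ℕ∞) φ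
  compact : HasCompactSupport φ
  support : tsupport φ ⊆ Ioo 0 L

/-- `w ∈ L²(I)` is the weak derivative `∂_x^m v` of `v ∈ L²(I)`. -/
def HasWeakDeriv (L : ℝ) (m : ℕ) (v w : L2 L) : Prop :=
  ∀ φ : ℝ → ℝ, IsTest L φ →
    ∫ x in Ioo 0 L, v x * iteratedDeriv m φ x = (-1) ^ m * ∫ x in Ioo 0 L, w x * φ x

/-- Weak derivatives are unique. -/
theorem HasWeakDeriv.unique {L : ℝ} {m : ℕ} {v w w' : L2 L}
    (h : HasWeakDeriv L m v w) (h' : HasWeakDeriv L m v w') : w = w' := by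
  have hint : ∀ z : L2 L, IntegrableOn (fun x => z x) (Ioo 0 L) := fun z =>
    (Lp.memLp z).integrable (by norm_num)
  have key : ∀ᵐ x : ℝ, x ∈ Ioo 0 L → w x - w' x = 0 := by
    refine isOpen_Ioo.ae_eq_zero_of_integral_contDiff_smul_eq_zero
      ((hint w).sub (hint w')).locallyIntegrableOn ?_
    intro φ hφ hc hs
    have hT : IsTest L φ := ⟨hφ, hc, hs⟩
    obtain ⟨C, hC⟩ := hc.exists_bound_of_continuous hφ.continuous
    have hm : ∀ z : L2 L, Integrable (fun x => z x * φ x) (intervalMeasure L) := fun z =>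
      (hint z).mul_bdd (c := C) hφ.continuous.aestronglyMeasurable (ae_of_all _ hC)
    have e := (h φ hT).symm.trans (h' φ hT)
    have e' : ∫ x in Ioo 0 L, w x * φ x = ∫ x in Ioo 0 L, w' x * φ x :=
      mul_left_cancel₀ (pow_ne_zero m (by norm_num : (-1 : ℝ) ≠ 0)) e
    have hsupp : ∀ x, x ∉ Ioo 0 L → φ x • (w x - w' x) = 0 := by
      intro x hx
      have : φ x = 0 := image_eq_zero_of_notMem_tsupport fun hh => hx (hs hh)
      simp [this]
    have e2 : ∫ x in Ioo 0 L, (w x * φ x - w' x * φ x) = 0 :=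
      (integral_sub (hm w) (hm w')).trans (sub_eq_zero.2 e')
    refine (setIntegral_eq_integral_of_forall_compl_eq_zero (μ := volume) hsupp).symm.trans ?_
    refine Eq.trans ?_ e2
    refine setIntegral_congr_fun measurableSet_Ioo fun x _ => ?_
    simp only [smul_eq_mul]
    ring
  apply Lp.ext
  filter_upwards [(ae_restrict_iff' measurableSet_Ioo).2 key] with x hx
  linarith

open Classical in
/-- The weak derivative `∂_x^m v` of `v ∈ L²(I)`, where it exists in `L²(I)` (and `0` otherwise). -/
def wderiv (L : ℝ) (m : ℕ) (v : L2 L) : L2 L :=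
  if h : ∃ w, HasWeakDeriv L m v w then h.choose else 0

/-- `v` belongs to the Sobolev space `H^m(I)`. -/
def MemH (L : ℝ) (m : ℕ) (v : L2 L) : Prop :=
  ∀ j ≤ m, ∃ w, HasWeakDeriv L j v w

/-- `v` belongs to `H^m_0(I)`, the closure of `C_c^∞(I)` in `H^m(I)`. For `m = 0` this is
`L²(I)`. The space `H_k` of the problem is `H^k_0(I)`, `k = 0, 1, 2`. -/
def MemH0 (L : ℝ) (m : ℕ) (v : L2 L) : Prop :=
  MemH L m v ∧ ∀ ε : ℝ, 0 < ε → ∃ φ : ℝ → ℝ, IsTest L φ ∧ ∀ j ≤ m,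
    eLpNorm (fun x => iteratedDeriv j φ x - wderiv L j v x) 2 (intervalMeasure L)
      ≤ ENNReal.ofReal ε

/-- `M` is the smallest positive constant in Poincaré's inequality
`‖v‖² ≤ M ‖∂_x v‖²`, `v ∈ H^1_0(I)`. -/
def IsPoincareConstant (L M : ℝ) : Prop :=
  IsLeast {m : ℝ | 0 < m ∧ ∀ v : L2 L, MemH0 L 1 v → ‖v‖ ^ 2 ≤ m * ‖wderiv L 1 v‖ ^ 2} M

/-- `M` is a positive constant of the Sobolev embedding `H^1(I) ↪ L^∞(I)`:
`‖v‖²_{L^∞(I)} ≤ M ‖v‖²_{H^1(I)}`, `v ∈ H^1(I)`. -/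
def IsSobolevConstant (L M : ℝ) : Prop :=
  0 < M ∧ ∀ v : L2 L, MemH L 1 v →
    eLpNorm v ⊤ (intervalMeasure L) ^ 2 ≤ ENNReal.ofReal (M * (‖v‖ ^ 2 + ‖wderiv L 1 v‖ ^ 2))

/-- The assumptions on the memory kernel `f : [0, ∞) → ℝ`. -/
structure IsMemoryKernel (f : ℝ → ℝ) : Prop where
  contDiff : ContDiffOn ℝ 2 f (Ici 0)
  deriv_neg : ∀ s, 0 ≤ s → derivWithin f (Ici 0) s < 0
  deriv2 : ∃ c₀ : ℝ, 0 < c₀ ∧ ∀ s, 0 ≤ s →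
    0 ≤ iteratedDerivWithin 2 f (Ici 0) s ∧
      iteratedDerivWithin 2 f (Ici 0) s ≤ -c₀ * derivWithin f (Ici 0) s
  zero_pos : 0 < f 0
  tendsto_zero : Tendsto f atTop (𝓝 0)

/-- `g = -f'` on `[0, ∞)`. -/
def gker (f : ℝ → ℝ) (s : ℝ) : ℝ := -derivWithin f (Ici 0) s

/-- The additional assumptions on `g` and `ξ : [0, ∞) → [0, ∞)`. -/
structure IsRate (g ξ : ℝ → ℝ) : Prop where
  contDiff : ContDiffOn ℝ 1 ξ (Ici 0)
  nonneg : ∀ s, 0 ≤ s → 0 ≤ ξ s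
  deriv_nonpos : ∀ s, 0 ≤ s → derivWithin ξ (Ici 0) s ≤ 0
  integral_eq_top : Tendsto (fun t => ∫ s in (0 : ℝ)..t, ξ s) atTop atTop
  deriv_le : ∀ s, 0 ≤ s → derivWithin g (Ici 0) s ≤ -ξ s * g s

/-- `v ∈ L_g`: a measurable map `v : [0, ∞) → H_k` (up to null sets) with
`∫_0^∞ g(s) ‖∂_x^k v(s)‖² ds < ∞`. -/
structure MemLg (L : ℝ) (k : ℕ) (g : ℝ → ℝ) (v : ℝ → L2 L) : Prop where
  memH0 : ∀ᵐ s ∂(volume.restrict (Ioi 0)), MemH0 L k (v s)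
  measurable : AEStronglyMeasurable (fun s => wderiv L k (v s)) (volume.restrict (Ioi 0))
  integrable : IntegrableOn (fun s => g s * ‖wderiv L k (v s)‖ ^ 2) (Ioi 0)

/-- `‖v‖²_{L_g} = ∫_0^∞ g(s) ‖∂_x^k v(s)‖² ds`. -/
def LgNormSq (L : ℝ) (k : ℕ) (g : ℝ → ℝ) (v : ℝ → L2 L) : ℝ :=
  ∫ s in Ioi 0, g s * ‖wderiv L k (v s)‖ ^ 2

/-- The norm of `(v, η)` in the energy space `𝓗 = L²(I) × L_g`. -/
def energyNorm (L : ℝ) (k : ℕ) (g : ℝ → ℝ) (v : L2 L) (η : ℝ → L2 L) : ℝ :=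
  Real.sqrt (‖v‖ ^ 2 + LgNormSq L k g η)

/-- The history variable `η^t(s) = ∫_{t-s}^t u(τ) dτ`. For `s > t` the part of the integral over
the past `(t - s, 0)` is `η⁰(s - t)`, `η⁰` being the initial history. -/
def history {L : ℝ} (u : ℝ → L2 L) (η₀ : ℝ → L2 L) (t s : ℝ) : L2 L :=
  if s ≤ t then ∫ τ in (t - s)..t, u τ else η₀ (s - t) + ∫ τ in (0 : ℝ)..t, u τ

/-- Test functions for the weak formulation: smooth, with the boundary conditions of the adjoint
problem `φ(0) = φ(L) = φ'(0) = φ'(L) = φ''(0) = 0`. -/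
structure IsAdjointTest (L : ℝ) (φ : ℝ → ℝ) : Prop where
  smooth : ContDiff ℝ ((⊤ : ℕ∞) : WithTop ℕ∞) φ
  left : φ 0 = 0
  right : φ L = 0
  deriv_left : iteratedDeriv 1 φ 0 = 0
  deriv_right : iteratedDeriv 1 φ L = 0
  deriv2_left : iteratedDeriv 2 φ 0 = 0

/-- The weak form, tested with `φ`, of
`-∂_x³u + a₀ ∂_x⁵u - u ∂_x u - a₁ ∂_x u - (-1)^k ∫_0^∞ g(s) ∂_x^{2k} η(s) ds`. The boundary terms
of the integrations by parts vanish by `u = ∂_x u = 0` at both ends and `∂_x²u(L) = 0`. -/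
def weakRHS (L a₀ a₁ : ℝ) (k : ℕ) (g : ℝ → ℝ) (v : L2 L) (η : ℝ → L2 L) (φ : ℝ → ℝ) : ℝ :=
  (∫ x in Ioo 0 L,
      v x * (iteratedDeriv 3 φ x - a₀ * iteratedDeriv 5 φ x + a₁ * iteratedDeriv 1 φ x))
    + 1 / 2 * (∫ x in Ioo 0 L, v x ^ 2 * iteratedDeriv 1 φ x)
    - ∫ s in Ioi 0, g s * ∫ x in Ioo 0 L, wderiv L k (η s) x * iteratedDeriv k φ x

/-- `U(t) = (u(t), η^t)`, `η^t` the history variable of `u`, is a global (weak, equivalently mild)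
solution of `∂_t U = 𝒜 U`, `U(0) = U₀ = (v₀, η₀)`, with `U ∈ C([0, ∞); 𝓗)` and
`u ∈ L²(0, T; H²_0(I))` for all `T > 0`. The condition `∂_x²u(L, t) = 0` is contained in the weak
formulation, since `∂_x²φ(L)` is free. -/
structure IsSolution (L a₀ a₁ : ℝ) (k : ℕ) (g : ℝ → ℝ) (v₀ : L2 L) (η₀ u : ℝ → L2 L) :
    Prop where
  initial : u 0 = v₀
  cont : ContinuousOn u (Ici 0)
  memH0 : ∀ᵐ t ∂(volume.restrict (Ioi 0)), MemH0 L 2 (u t)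
  memL2H2 : ∀ T : ℝ, 0 < T → ∀ j ≤ 2,
    MemLp (fun t => wderiv L j (u t)) 2 (volume.restrict (Ioo 0 T))
  memLg : ∀ t, 0 ≤ t → MemLg L k g (history u η₀ t)
  contLg : ∀ t, 0 ≤ t →
    Tendsto (fun r => LgNormSq L k g (fun s => history u η₀ r s - history u η₀ t s))
      (𝓝[Ici 0] t) (𝓝 0)
  equation : ∀ φ : ℝ → ℝ, IsAdjointTest L φ → ∀ t, 0 ≤ t →
    (∫ x in Ioo 0 L, u t x * φ x) - (∫ x in Ioo 0 L, v₀ x * φ x)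
      = ∫ τ in (0 : ℝ)..t, weakRHS L a₀ a₁ k g (u τ) (history u η₀ τ) φ

/-- The energy `E(t) = ½ (‖u(t)‖² + ∫_0^∞ g(s) ‖∂_x^k η^t(s)‖² ds)`. -/
def energy (L : ℝ) (k : ℕ) (g : ℝ → ℝ) (η₀ u : ℝ → L2 L) (t : ℝ) : ℝ :=
  1 / 2 * (‖u t‖ ^ 2 + LgNormSq L k g (history u η₀ t))

/-- `h(t, s) = t² + t + ‖∂_x^k η⁰(s - t)‖²`, `0 ≤ t ≤ s`, for an initial history `η⁰`. -/
def hHist (L : ℝ) (k : ℕ) (η₀ : ℝ → L2 L) (t s : ℝ) : ℝ :=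
  t ^ 2 + t + ‖wderiv L k (η₀ (s - t))‖ ^ 2

/-- `h(t, s) = t² + t + ‖∫_0^{s-t} ∂_x^k u₀(·, τ) dτ‖²`, `0 ≤ t ≤ s`, for the past values
`u(x, -τ) = u₀(x, τ)`, `τ ≥ 0`. -/
def hPast (L : ℝ) (k : ℕ) (u₀ : ℝ → L2 L) (t s : ℝ) : ℝ :=
  t ^ 2 + t + ‖∫ τ in (0 : ℝ)..(s - t), wderiv L k (u₀ τ)‖ ^ 2

/-- `η₀(s) = ∫_0^s u₀(τ) dτ` for a past `u₀ : [0, ∞) → H_k` that is locally integrable. -/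
structure IsPastOf (L : ℝ) (k : ℕ) (u₀ η₀ : ℝ → L2 L) : Prop where
  memH0 : ∀ᵐ τ ∂(volume.restrict (Ioi 0)), MemH0 L k (u₀ τ)
  integrable : ∀ T : ℝ, 0 < T → ∀ j ≤ k, IntegrableOn (fun τ => wderiv L j (u₀ τ)) (Ioo 0 T)
  eq_integral : ∀ᵐ s ∂(volume.restrict (Ioi 0)), η₀ s = ∫ τ in (0 : ℝ)..s, u₀ τ

/-- `e^{-c ∫_0^t ξ} (1 + ∫_0^t e^{c ∫_0^σ ξ} ξ(σ) ∫_σ^∞ g(s) h(σ, s) ds dσ)`. -/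
def generalRate (g ξ : ℝ → ℝ) (h : ℝ → ℝ → ℝ) (c t : ℝ) : ℝ :=
  Real.exp (-c * ∫ τ in (0 : ℝ)..t, ξ τ) *
    (1 + ∫ σ in (0 : ℝ)..t,
      Real.exp (c * ∫ τ in (0 : ℝ)..σ, ξ τ) * ξ σ * ∫ s in Ioi σ, g s * h σ s)

end

end Kawahara

/-! Let J be integration from 0 and J† its adjoint, and write u = J²y with y = ∂_x²u orthogonal to
the affine functions. Tested with triple primitives φ = J³χ, the equation becomes an identity in
L²(I) (`IsSolution.isResolvent`): up to a combination of L - x and (L - x)², a₀y is a sum of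
primitives of the other terms. Hence a₀y = J†G for some G ∈ L²(I), which contains the boundary
condition y(L) = 0. A weak solution has no time derivative in L²(I), so the identity is derived for
averages over [t, t + δ], and estimates are integrated in time before δ → 0.

Two multipliers are used. With u, the terms of order one and three vanish, the fifth order term has
the good sign of ½a₀y(0)², and the nonlinearity drops out in the limit. The balance of the memory,
obtained by transporting the history along s - t = const, contains the same pairing of u with the
memory; after cancellation `IsSolution.energy_add_le` says that E is nonincreasing and loses at
least ½∫D, where D = ∫γ‖∂_x^kη‖² ds and γ = -g'. With x u, Kato's smoothing effect
(`exists_inner_X_le`, `IsSolution.exists_integrated_smoothing`) controls a₀‖y‖² in the time mean by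
‖u‖² and the sources, with a possibly large constant.

The dissipation sees only the history, so ‖u‖² must be recovered from it. Put β = ∫_0^1 (1 -
s)η^t(s) ds; transport gives β' = ½u - ∫_0^1 η^t(s) ds. Let B have finite rank and range in the test
functions. In the derivative of ⟪u, Bβ⟫ the time derivative of u is harmless, since all space
derivatives fall on test functions, and the main term is ½⟪u, Bu⟫. This is `exists_observability`.
As J is a norm limit of such finite rank operators, B can be chosen with ‖u - Bu‖² as small as
desired relative to ‖y‖², and smoothing absorbs this error. The outcome, `exists_lyapunov`, is a
functional F bounded by the energy, with F' ≤ -‖u‖² + K‖η‖² in integrated form. The nonlinearity is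
treated as a linear term whose coefficient depends on the bound for ‖u‖ given by the energy.

It remains to bound the memory by its dissipation. For s ≤ t, ξ(t)g(s) ≤ ξ(s)g(s) ≤ γ(s). For s > t
the history is η⁰(s - t) + ∫_0^t u, and smoothing with Cauchy-Schwarz in time bounds ‖∫_0^t ∂_x^k
u‖² by a multiple of t² + t; this is the origin of h. If ξ is constant, the first comparison holds
for every s and no source arises. Finally ξ(F + 2KE) + (2K + 3)E is comparable to E and satisfies a
linear integral inequality with rate proportional to ξ, and Grönwall's argument
(`decay_of_lyapunov`) concludes. -/

set_option linter.unusedSectionVars false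

/-! ### Integration from 0 and multiplication by x as operators on L²(I). -/

namespace Kawahara

noncomputable section

open scoped InnerProductSpace

/-- Integration by parts for products of primitives of integrable functions. -/
theorem integral_primitive_mul {a b : ℝ → ℝ} {x : ℝ} (ha : IntervalIntegrable a volume 0 x)
    (hb : IntervalIntegrable b volume 0 x) :
    ∫ r in (0 : ℝ)..x, ((∫ s in (0 : ℝ)..r, a s) * b r + a r * ∫ s in (0 : ℝ)..r, b s)
      = (∫ s in (0 : ℝ)..x, a s) * ∫ s in (0 : ℝ)..x, b s := by
  have h := (ha.absolutelyContinuousOnInterval_intervalIntegral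
    left_mem_uIcc).integral_deriv_mul_eq_sub
    (hb.absolutelyContinuousOnInterval_intervalIntegral left_mem_uIcc)
  simp only [intervalIntegral.integral_same, mul_zero, sub_zero] at h
  rw [← h]
  apply intervalIntegral.integral_congr_ae
  filter_upwards [ha.ae_hasDerivAt_integral, hb.ae_hasDerivAt_integral] with r h1 h2 hr
  have hr' := uIoc_subset_uIcc hr
  rw [(h1 hr' 0 left_mem_uIcc).deriv, (h2 hr' 0 left_mem_uIcc).deriv]
  ring

variable {L : ℝ}

theorem L2.inner_eq (v w : L2 L) : ⟪v, w⟫_ℝ = ∫ x in Ioo 0 L, v x * w x := by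
  rw [MeasureTheory.L2.inner_def]
  refine integral_congr_ae (ae_of_all _ fun x => ?_)
  simp [mul_comm]

theorem L2.norm_sq_eq (v : L2 L) : ‖v‖ ^ 2 = ∫ x in Ioo 0 L, v x ^ 2 := by
  rw [← real_inner_self_eq_norm_sq, L2.inner_eq]
  simp only [sq]

theorem L2.integrable_mul (v w : L2 L) : IntegrableOn (fun x => v x * w x) (Ioo 0 L) :=
  (Lp.memLp v).integrable_mul (Lp.memLp w)

theorem L2.integrableOn (v : L2 L) : IntegrableOn (fun x => v x) (Ioo 0 L) :=
  (Lp.memLp v).integrable (by norm_num)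

theorem intervalIntegrable_of_Ioo {a : ℝ → ℝ} (ha : IntegrableOn a (Ioo 0 L)) {x : ℝ}
    (hx : x ∈ Icc 0 L) : IntervalIntegrable a volume 0 x := by
  rw [intervalIntegrable_iff_integrableOn_Ioo_of_le hx.1]
  exact ha.mono_set (Ioo_subset_Ioo le_rfl hx.2)

theorem setIntegral_Ioo_eq {a : ℝ → ℝ} {x : ℝ} (hx : 0 ≤ x) :
    ∫ r in Ioo 0 x, a r = ∫ r in (0 : ℝ)..x, a r := by
  rw [intervalIntegral.integral_of_le hx, integral_Ioc_eq_integral_Ioo]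

theorem memLp_of_continuousOn {φ : ℝ → ℝ} (hφ : ContinuousOn φ (Icc 0 L)) :
    MemLp φ 2 (intervalMeasure L) := by
  obtain ⟨C, hC⟩ := isCompact_Icc.exists_bound_of_continuousOn hφ
  refine MemLp.of_bound ((hφ.mono Ioo_subset_Icc_self).aestronglyMeasurable measurableSet_Ioo) C ?_
  filter_upwards [ae_restrict_mem measurableSet_Ioo] with x hx
  exact hC x (Ioo_subset_Icc_self hx)

/-- The class in `L²(I)` of a function that is continuous on `[0, L]`. -/
def toL2 (φ : ℝ → ℝ) (hφ : ContinuousOn φ (Icc 0 L)) : L2 L := (memLp_of_continuousOn hφ).toLp φ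

theorem toL2_ae {φ : ℝ → ℝ} (hφ : ContinuousOn φ (Icc 0 L)) :
    ∀ᵐ x ∂(intervalMeasure L), toL2 φ hφ x = φ x :=
  (memLp_of_continuousOn hφ).coeFn_toLp

theorem toL2_congr {φ ψ : ℝ → ℝ} (hφ : ContinuousOn φ (Icc 0 L)) (hψ : ContinuousOn ψ (Icc 0 L))
    (h : ∀ x ∈ Ioo 0 L, φ x = ψ x) : toL2 φ hφ = toL2 ψ hψ := by
  apply Lp.ext
  filter_upwards [toL2_ae hφ, toL2_ae hψ, ae_restrict_mem measurableSet_Ioo] with x h1 h2 hx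
  rw [h1, h2, h x hx]

theorem inner_toL2 (v : L2 L) {φ : ℝ → ℝ} (hφ : ContinuousOn φ (Icc 0 L)) :
    ⟪v, toL2 φ hφ⟫_ℝ = ∫ x in Ioo 0 L, v x * φ x := by
  rw [L2.inner_eq]
  refine integral_congr_ae ?_
  filter_upwards [toL2_ae hφ] with x hx
  rw [hx]

theorem norm_toL2_le (hL : 0 ≤ L) {φ : ℝ → ℝ} (hφ : ContinuousOn φ (Icc 0 L)) {C : ℝ}
    (hC : 0 ≤ C) (h : ∀ x ∈ Ioo 0 L, |φ x| ≤ C) : ‖toL2 φ hφ‖ ≤ Real.sqrt L * C := by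
  have h1 : ‖toL2 φ hφ‖ ^ 2 ≤ (Real.sqrt L * C) ^ 2 := by
    rw [L2.norm_sq_eq, mul_pow, Real.sq_sqrt hL]
    have h2 : ∫ x in Ioo 0 L, toL2 φ hφ x ^ 2 ≤ ∫ x in Ioo 0 L, C ^ 2 := by
      refine integral_mono_ae ?_ (integrable_const _) ?_
      · simp only [sq]
        exact L2.integrable_mul (toL2 φ hφ) (toL2 φ hφ)
      · filter_upwards [toL2_ae hφ, ae_restrict_mem measurableSet_Ioo] with x h1 hx
        rw [h1]
        exact sq_le_sq' (by linarith [neg_abs_le (φ x), h x hx]) (le_trans (le_abs_self _) (h x hx))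
    simpa [hL] using h2
  exact le_of_sq_le_sq h1 (by positivity) |> fun h => h

/-- The constant function `1`. -/
def one : L2 L := toL2 (fun _ => 1) continuousOn_const

theorem norm_one_sq (hL : 0 ≤ L) : ‖(one : L2 L)‖ ^ 2 = L := by
  rw [← real_inner_self_eq_norm_sq, one, inner_toL2]
  simp only [mul_one]
  rw [integral_congr_ae (toL2_ae continuousOn_const)]
  simp [hL]

theorem inner_one (v : L2 L) : ⟪one, v⟫_ℝ = ∫ x in Ioo 0 L, v x := by
  rw [real_inner_comm, one, inner_toL2]
  simp

theorem integral_abs_le (hL : 0 ≤ L) (v : L2 L) :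
    ∫ x in Ioo 0 L, |v x| ≤ Real.sqrt L * ‖v‖ := by
  have h1 : ∫ x in Ioo 0 L, |v x| = ⟪one, |v|⟫_ℝ := by
    rw [inner_one]
    refine integral_congr_ae ?_
    filter_upwards [Lp.coeFn_abs v] with x hx
    rw [hx]
  have h2 : ‖(one : L2 L)‖ = Real.sqrt L := by
    conv_rhs => rw [← norm_one_sq hL, Real.sqrt_sq (norm_nonneg _)]
  rw [h1]
  refine (real_inner_le_norm _ _).trans ?_
  rw [h2, norm_abs_eq_norm]

theorem abs_primitive_le {a : ℝ → ℝ} (ha : IntegrableOn a (Ioo 0 L)) {x : ℝ} (hx : x ∈ Icc 0 L) :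
    |∫ r in (0 : ℝ)..x, a r| ≤ ∫ r in Ioo 0 L, |a r| := by
  rw [← setIntegral_Ioo_eq hx.1]
  refine (abs_integral_le_integral_abs).trans ?_
  exact setIntegral_mono_set ha.abs (ae_of_all _ fun _ => abs_nonneg _)
    (Ioo_subset_Ioo le_rfl hx.2).eventuallyLE

theorem continuousOn_primitive {a : ℝ → ℝ} (ha : IntegrableOn a (Ioo 0 L)) :
    ContinuousOn (fun x => ∫ r in (0 : ℝ)..x, a r) (Icc 0 L) := by
  have h : IntegrableOn a (Icc 0 L) := (integrableOn_Icc_iff_integrableOn_Ioo).2 ha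
  rcases le_or_gt 0 L with hL | hL
  · have := intervalIntegral.continuousOn_primitive_interval (μ := volume) (f := a) (a := 0)
      (b := L) (by rwa [uIcc_of_le hL])
    rwa [uIcc_of_le hL] at this
  · simp [hL]

theorem primitive_congr {a b : ℝ → ℝ} (h : ∀ᵐ x ∂(intervalMeasure L), a x = b x) {x : ℝ}
    (hx : x ∈ Icc 0 L) : ∫ r in (0 : ℝ)..x, a r = ∫ r in (0 : ℝ)..x, b r := by
  rw [← setIntegral_Ioo_eq hx.1, ← setIntegral_Ioo_eq hx.1]
  exact integral_congr_ae (ae_mono (Measure.restrict_mono (Ioo_subset_Ioo le_rfl hx.2) le_rfl) h)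

variable [hL : Fact (0 < L)]

/-- The primitive `x ↦ ∫_0^x v` as an operator on `L²(I)`. -/
def J : L2 L →L[ℝ] L2 L :=
  LinearMap.mkContinuous
    { toFun := fun v => toL2 (fun x => ∫ r in (0 : ℝ)..x, v r) (continuousOn_primitive v.integrableOn)
      map_add' := by
        intro v w
        apply Lp.ext
        filter_upwards [toL2_ae (continuousOn_primitive (v + w).integrableOn),
          toL2_ae (continuousOn_primitive v.integrableOn),
          toL2_ae (continuousOn_primitive w.integrableOn),
          Lp.coeFn_add (toL2 _ (continuousOn_primitive v.integrableOn))
            (toL2 _ (continuousOn_primitive w.integrableOn)),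
          ae_restrict_mem measurableSet_Ioo] with x h1 h2 h3 h4 hx
        have hx' := Ioo_subset_Icc_self hx
        rw [h1, h4, Pi.add_apply, h2, h3, primitive_congr (Lp.coeFn_add v w) hx',
          ← intervalIntegral.integral_add (intervalIntegrable_of_Ioo v.integrableOn hx')
            (intervalIntegrable_of_Ioo w.integrableOn hx')]
        rfl
      map_smul' := by
        intro c v
        apply Lp.ext
        filter_upwards [toL2_ae (continuousOn_primitive (c • v).integrableOn),
          toL2_ae (continuousOn_primitive v.integrableOn),
          Lp.coeFn_smul c (toL2 _ (continuousOn_primitive v.integrableOn)),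
          ae_restrict_mem measurableSet_Ioo] with x h1 h2 h4 hx
        have hx' := Ioo_subset_Icc_self hx
        simp only [RingHom.id_apply]
        rw [h1, h4, Pi.smul_apply, h2, primitive_congr (Lp.coeFn_smul c v) hx']
        simp }
    L (by
      intro v
      have h := norm_toL2_le hL.out.le (continuousOn_primitive v.integrableOn)
        (C := Real.sqrt L * ‖v‖) (by positivity) (fun x hx =>
          (abs_primitive_le v.integrableOn (Ioo_subset_Icc_self hx)).trans
            (integral_abs_le hL.out.le v))
      rwa [← mul_assoc, Real.mul_self_sqrt hL.out.le] at h)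

theorem J_ae (v : L2 L) : ∀ᵐ x ∂(intervalMeasure L), J v x = ∫ r in (0 : ℝ)..x, v r :=
  toL2_ae (continuousOn_primitive v.integrableOn)

theorem J_toL2 {φ : ℝ → ℝ} (hφ : ContinuousOn φ (Icc 0 L)) : J (toL2 φ hφ) =
    toL2 (fun x => ∫ r in (0 : ℝ)..x, φ r) (continuousOn_primitive
      ((hφ.integrableOn_Icc).mono_set Ioo_subset_Icc_self)) :=
  toL2_congr (continuousOn_primitive (toL2 φ hφ).integrableOn) _
    fun _ hx => primitive_congr (toL2_ae hφ) (Ioo_subset_Icc_self hx)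

/-- `⟨Jv, w⟩ + ⟨v, Jw⟩ = ⟨1, v⟩⟨1, w⟩`. -/
theorem inner_J_add (v w : L2 L) : ⟪J v, w⟫_ℝ + ⟪v, J w⟫_ℝ = ⟪one, v⟫_ℝ * ⟪one, w⟫_ℝ := by
  have hLL : L ∈ Icc 0 L := ⟨hL.out.le, le_rfl⟩
  have h := integral_primitive_mul (intervalIntegrable_of_Ioo v.integrableOn hLL)
    (intervalIntegrable_of_Ioo w.integrableOn hLL)
  rw [inner_one, inner_one, setIntegral_Ioo_eq hL.out.le, setIntegral_Ioo_eq hL.out.le, ← h,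
    L2.inner_eq, L2.inner_eq, ← setIntegral_Ioo_eq hL.out.le,
    ← integral_add (L2.integrable_mul _ _) (L2.integrable_mul _ _)]
  refine integral_congr_ae ?_
  filter_upwards [J_ae v, J_ae w] with x h1 h2
  rw [h1, h2]

theorem inner_J_left (v w : L2 L) : ⟪J v, w⟫_ℝ = ⟪one, v⟫_ℝ * ⟪one, w⟫_ℝ - ⟪v, J w⟫_ℝ := by
  linarith [inner_J_add v w]

omit hL in
theorem memLp_mul_id (v : L2 L) : MemLp (fun x => x * v x) 2 (intervalMeasure L) := by
  refine (Lp.memLp v).of_le_mul (c := L)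
    (continuous_id.aestronglyMeasurable.mul (Lp.memLp v).aestronglyMeasurable) ?_
  filter_upwards [ae_restrict_mem measurableSet_Ioo] with x hx
  rw [norm_mul, Real.norm_of_nonneg hx.1.le]
  exact mul_le_mul_of_nonneg_right hx.2.le (norm_nonneg _)

/-- Multiplication by `x` as an operator on `L²(I)`. -/
def X : L2 L →L[ℝ] L2 L :=
  LinearMap.mkContinuous
    { toFun := fun v => (memLp_mul_id v).toLp _
      map_add' := by
        intro v w
        apply Lp.ext
        filter_upwards [(memLp_mul_id (v + w)).coeFn_toLp, (memLp_mul_id v).coeFn_toLp,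
          (memLp_mul_id w).coeFn_toLp, Lp.coeFn_add v w,
          Lp.coeFn_add ((memLp_mul_id v).toLp _) ((memLp_mul_id w).toLp _)] with x h1 h2 h3 h4 h5
        rw [h1, h5, Pi.add_apply, h2, h3, h4, Pi.add_apply, mul_add]
      map_smul' := by
        intro c v
        apply Lp.ext
        filter_upwards [(memLp_mul_id (c • v)).coeFn_toLp, (memLp_mul_id v).coeFn_toLp,
          Lp.coeFn_smul c v, Lp.coeFn_smul c ((memLp_mul_id v).toLp _)] with x h1 h2 h4 h5
        simp only [RingHom.id_apply]
        rw [h1, h5, Pi.smul_apply, h2, h4, Pi.smul_apply, smul_eq_mul, smul_eq_mul]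
        ring }
    L (by
      intro v
      refine Lp.norm_le_mul_norm_of_ae_le_mul ?_
      filter_upwards [(memLp_mul_id v).coeFn_toLp, ae_restrict_mem measurableSet_Ioo] with x h1 hx
      simp only [LinearMap.coe_mk, AddHom.coe_mk]
      rw [h1, norm_mul, Real.norm_of_nonneg hx.1.le]
      exact mul_le_mul_of_nonneg_right hx.2.le (norm_nonneg _))

theorem X_ae (v : L2 L) : ∀ᵐ x ∂(intervalMeasure L), X v x = x * v x :=
  (memLp_mul_id v).coeFn_toLp

theorem norm_X_le (v : L2 L) : ‖X v‖ ≤ L * ‖v‖ :=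
  ContinuousLinearMap.le_of_opNorm_le X (LinearMap.mkContinuous_norm_le _ hL.out.le _) v

theorem inner_X (v w : L2 L) : ⟪X v, w⟫_ℝ = ⟪v, X w⟫_ℝ := by
  rw [L2.inner_eq, L2.inner_eq]
  refine integral_congr_ae ?_
  filter_upwards [X_ae v, X_ae w] with x h1 h2
  rw [h1, h2]
  ring

theorem inner_X_self_nonneg (v : L2 L) : 0 ≤ ⟪v, X v⟫_ℝ := by
  rw [L2.inner_eq]
  refine integral_nonneg_of_ae ?_
  filter_upwards [X_ae v, ae_restrict_mem measurableSet_Ioo] with x h1 hx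
  rw [h1]
  have := mul_nonneg hx.1.le (sq_nonneg (v x))
  simp only [Pi.zero_apply]
  nlinarith

/-- Product rule for x times a primitive: the commutator of X and J is J². It lets the weight x of
the smoothing multiplier pass through primitives. -/
theorem X_J (v : L2 L) : X (J v) = J (J v) + J (X v) := by
  apply Lp.ext
  filter_upwards [X_ae (J v), J_ae v, J_ae (J v), J_ae (X v), Lp.coeFn_add (J (J v)) (J (X v)),
    ae_restrict_mem measurableSet_Ioo] with x h1 h2 h3 h4 h5 hx
  have hx' := Ioo_subset_Icc_self hx
  have hv := intervalIntegrable_of_Ioo v.integrableOn hx'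
  have h := integral_primitive_mul hv (b := fun _ => 1) intervalIntegrable_const
  rw [h1, h2, h5, Pi.add_apply, h3, h4, primitive_congr (J_ae v) hx', primitive_congr (X_ae v) hx',
    ← intervalIntegral.integral_add]
  · simp only [intervalIntegral.integral_const, smul_eq_mul, mul_one, sub_zero] at h
    rw [mul_comm, ← h]
    congr 1
    ext r
    ring
  · refine intervalIntegrable_of_Ioo ?_ hx'
    exact ((continuousOn_primitive v.integrableOn).integrableOn_Icc).mono_set Ioo_subset_Icc_self
  · refine intervalIntegrable_of_Ioo ?_ hx'
    exact (memLp_mul_id v).integrable (by norm_num)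

theorem J_one : J (one : L2 L) = X one := by
  apply Lp.ext
  filter_upwards [X_ae one, J_ae one, toL2_ae (L := L) (φ := fun _ => 1) continuousOn_const,
    ae_restrict_mem measurableSet_Ioo] with x h1 h2 h3 hx
  rw [h1, h2, show (one : L2 L) = toL2 (fun _ => 1) continuousOn_const from rfl,
    primitive_congr (toL2_ae (φ := fun _ => 1) continuousOn_const) (Ioo_subset_Icc_self hx), h3]
  simp

end

end Kawahara

/-! ### The quadratic source, and the stationary equation with the multipliers w and x w. -/

namespace Kawahara

noncomputable section

open scoped InnerProductSpace

variable {L : ℝ}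

theorem integral_abs_mul_le (v w : L2 L) : ∫ x in Ioo 0 L, |v x * w x| ≤ ‖v‖ * ‖w‖ := by
  have h1 : ∫ x in Ioo 0 L, |v x * w x| = ⟪|v|, |w|⟫_ℝ := by
    rw [L2.inner_eq]
    refine integral_congr_ae ?_
    filter_upwards [Lp.coeFn_abs v, Lp.coeFn_abs w] with x hx hx'
    rw [hx, hx', abs_mul]
  rw [h1]
  refine (real_inner_le_norm _ _).trans ?_
  rw [norm_abs_eq_norm, norm_abs_eq_norm]

theorem L2.integrable_sq (u : L2 L) : IntegrableOn (fun x => u x ^ 2) (Ioo 0 L) := by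
  simp only [sq]
  exact L2.integrable_mul u u

/-- The function `x ↦ ∫_x^L u²`, which represents `z ↦ ∫_I u² Jz`. -/
def quadSource (u : L2 L) : L2 L :=
  toL2 (fun x => (∫ r in (0 : ℝ)..L, u r ^ 2) - ∫ r in (0 : ℝ)..x, u r ^ 2)
    (continuousOn_const.sub (continuousOn_primitive u.integrable_sq))

theorem quadSource_ae (u : L2 L) : ∀ᵐ x ∂(intervalMeasure L),
    quadSource u x = (∫ r in (0 : ℝ)..L, u r ^ 2) - ∫ r in (0 : ℝ)..x, u r ^ 2 :=
  toL2_ae (continuousOn_const.sub (continuousOn_primitive u.integrable_sq))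

variable [hL : Fact (0 < L)]

theorem inner_quadSource (u z : L2 L) :
    ⟪quadSource u, z⟫_ℝ = ∫ x in Ioo 0 L, u x ^ 2 * ∫ r in (0 : ℝ)..x, z r := by
  have hLL : L ∈ Icc 0 L := ⟨hL.out.le, le_rfl⟩
  have hA := continuousOn_primitive u.integrable_sq
  have hB := continuousOn_primitive z.integrableOn
  have hz := z.integrableOn
  have i1 : IntegrableOn (fun x => (∫ r in (0 : ℝ)..x, u r ^ 2) * z x) (Ioo 0 L) := by
    have := L2.integrable_mul (toL2 _ hA) z
    refine this.congr ?_
    filter_upwards [toL2_ae hA] with x hx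
    rw [hx]
  have i2 : IntegrableOn (fun x => u x ^ 2 * ∫ r in (0 : ℝ)..x, z r) (Ioo 0 L) := by
    obtain ⟨C, hC⟩ := isCompact_Icc.exists_bound_of_continuousOn hB
    refine Integrable.mul_bdd (c := C) u.integrable_sq
      ((hB.mono Ioo_subset_Icc_self).aestronglyMeasurable measurableSet_Ioo) ?_
    filter_upwards [ae_restrict_mem measurableSet_Ioo] with x hx
    exact hC x (Ioo_subset_Icc_self hx)
  have h := integral_primitive_mul (intervalIntegrable_of_Ioo u.integrable_sq hLL)
    (intervalIntegrable_of_Ioo hz hLL)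
  rw [← setIntegral_Ioo_eq hL.out.le, integral_add i1 i2] at h
  rw [real_inner_comm, quadSource, inner_toL2]
  have h2 : ∫ x in Ioo 0 L, z x * ((∫ r in (0 : ℝ)..L, u r ^ 2) - ∫ r in (0 : ℝ)..x, u r ^ 2)
      = (∫ r in (0 : ℝ)..L, u r ^ 2) * (∫ x in (0 : ℝ)..L, z x)
        - ∫ x in Ioo 0 L, (∫ r in (0 : ℝ)..x, u r ^ 2) * z x := by
    rw [← setIntegral_Ioo_eq (a := fun x => z x) hL.out.le, ← integral_const_mul,
      ← integral_sub (hz.const_mul _) i1]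
    congr 1
    ext x
    ring
  rw [h2, ← h]
  ring

/-- The square of an L² function is only integrable, but its tail integral is bounded by the L¹
norm, and ‖u² - v²‖ in L¹ is at most ‖u - v‖‖u + v‖. After one integration the nonlinearity is thus
locally Lipschitz on L²(I). -/
theorem norm_quadSource_sub_le (u v : L2 L) :
    ‖quadSource u - quadSource v‖ ≤ Real.sqrt L * (‖u - v‖ * ‖u + v‖) := by
  have hd : IntegrableOn (fun x => u x ^ 2 - v x ^ 2) (Ioo 0 L) :=
    u.integrable_sq.sub v.integrable_sq
  have hLL : L ∈ Icc 0 L := ⟨hL.out.le, le_rfl⟩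
  have hc : ContinuousOn (fun x => (∫ r in (0 : ℝ)..L, (u r ^ 2 - v r ^ 2))
      - ∫ r in (0 : ℝ)..x, (u r ^ 2 - v r ^ 2)) (Icc 0 L) :=
    continuousOn_const.sub (continuousOn_primitive hd)
  have e : quadSource u - quadSource v = toL2 _ hc := by
    apply Lp.ext
    filter_upwards [toL2_ae hc, quadSource_ae u, quadSource_ae v,
      Lp.coeFn_sub (quadSource u) (quadSource v), ae_restrict_mem measurableSet_Ioo]
      with x h1 h2 h3 h4 hx
    have hx' := Ioo_subset_Icc_self hx
    rw [h4, Pi.sub_apply, h1, h2, h3,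
      intervalIntegral.integral_sub (intervalIntegrable_of_Ioo u.integrable_sq hx')
        (intervalIntegrable_of_Ioo v.integrable_sq hx'),
      intervalIntegral.integral_sub (intervalIntegrable_of_Ioo u.integrable_sq hLL)
        (intervalIntegrable_of_Ioo v.integrable_sq hLL)]
    ring
  have hb : ∫ x in Ioo 0 L, |u x ^ 2 - v x ^ 2| ≤ ‖u - v‖ * ‖u + v‖ := by
    refine le_trans (le_of_eq ?_) (integral_abs_mul_le (u - v) (u + v))
    refine integral_congr_ae ?_
    filter_upwards [Lp.coeFn_sub u v, Lp.coeFn_add u v] with x h1 h2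
    rw [h1, h2, Pi.sub_apply, Pi.add_apply]
    congr 1
    ring
  rw [e]
  refine norm_toL2_le hL.out.le hc (by positivity) fun x hx => le_trans ?_ hb
  have hx' := Ioo_subset_Icc_self hx
  rw [intervalIntegral.integral_interval_sub_left (intervalIntegrable_of_Ioo hd hLL)
    (intervalIntegrable_of_Ioo hd hx'), intervalIntegral.integral_of_le hx.2.le,
    integral_Ioc_eq_integral_Ioo]
  refine (abs_integral_le_integral_abs).trans ?_
  exact setIntegral_mono_set hd.abs (ae_of_all _ fun _ => abs_nonneg _)
    (Ioo_subset_Ioo hx.1.le le_rfl).eventuallyLE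

theorem quadSource_zero : quadSource (0 : L2 L) = 0 := by
  have h0 : ∀ z : L2 L, ⟪quadSource (0 : L2 L), z⟫_ℝ = 0 := by
    intro z
    rw [inner_quadSource]
    refine integral_eq_zero_of_ae ?_
    filter_upwards [Lp.coeFn_zero ℝ 2 (intervalMeasure L)] with x hx
    have hx' : (0 : L2 L) x = 0 := hx
    rw [hx']
    simp
  exact inner_self_eq_zero.1 (h0 _)

theorem norm_quadSource_le (u : L2 L) : ‖quadSource u‖ ≤ Real.sqrt L * ‖u‖ ^ 2 := by
  have h := norm_quadSource_sub_le u 0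
  simpa [quadSource_zero, sq] using h

theorem continuous_quadSource : Continuous (quadSource : L2 L → L2 L) := by
  rw [continuous_iff_continuousAt]
  intro v
  rw [ContinuousAt, tendsto_iff_norm_sub_tendsto_zero]
  refine squeeze_zero (fun _ => norm_nonneg _) (fun u => norm_quadSource_sub_le u v) ?_
  have : Continuous fun u : L2 L => Real.sqrt L * (‖u - v‖ * ‖u + v‖) := by fun_prop
  simpa using this.tendsto v

/-- `∫ u² u_x = 0` for `u = J v`, `v = J y = u_x`, `u(L) = 0`. -/
theorem inner_quadSource_eq_zero {y : L2 L} (h : ⟪one, J y⟫_ℝ = 0) :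
    ⟪quadSource (J (J y)), y⟫_ℝ = 0 := by
  have hLL : L ∈ Icc 0 L := ⟨hL.out.le, le_rfl⟩
  set v := J y with hv
  have hA := continuousOn_primitive v.integrableOn
  have hvA : IntegrableOn (fun x => 2 * (v x * ∫ r in (0 : ℝ)..x, v r)) (Ioo 0 L) := by
    refine Integrable.const_mul ?_ 2
    refine (L2.integrable_mul v (J v)).congr ?_
    filter_upwards [J_ae v] with x hx
    rw [hx]
  have hsq : ∀ x ∈ Icc 0 L, ∫ r in (0 : ℝ)..x, 2 * (v r * ∫ s in (0 : ℝ)..r, v s)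
      = (∫ r in (0 : ℝ)..x, v r) ^ 2 := by
    intro x hx
    have := integral_primitive_mul (intervalIntegrable_of_Ioo v.integrableOn hx)
      (intervalIntegrable_of_Ioo v.integrableOn hx)
    rw [sq, ← this]
    congr 1
    ext r
    ring
  -- Product rule for u · u², with u² itself the primitive of 2uu'; the right side is u(L)³ = 0.
  have h3 := integral_primitive_mul (intervalIntegrable_of_Ioo v.integrableOn hLL)
    (intervalIntegrable_of_Ioo hvA hLL)
  rw [inner_one, setIntegral_Ioo_eq hL.out.le] at h
  rw [h, zero_mul, ← setIntegral_Ioo_eq hL.out.le] at h3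
  have h4 : ∫ x in Ioo 0 L, 3 * (v x * (∫ r in (0 : ℝ)..x, v r) ^ 2) = 0 := by
    refine Eq.trans ?_ h3
    refine setIntegral_congr_fun measurableSet_Ioo fun x hx => ?_
    rw [hsq x (Ioo_subset_Icc_self hx)]
    ring
  rw [integral_const_mul] at h4
  rw [inner_quadSource]
  have h5 : ∫ x in Ioo 0 L, v x * (∫ r in (0 : ℝ)..x, v r) ^ 2 = 0 := by linarith
  refine Eq.trans (integral_congr_ae ?_) h5
  filter_upwards [J_ae v, J_ae y] with x h1 h2
  rw [h1, ← h2, mul_comm]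

/-- The adjoint of `J`, `J† v (x) = ∫_x^L v`. -/
def Jt : L2 L →L[ℝ] L2 L := ContinuousLinearMap.adjoint J

theorem inner_Jt (v w : L2 L) : ⟪Jt v, w⟫_ℝ = ⟪v, J w⟫_ℝ :=
  ContinuousLinearMap.adjoint_inner_left _ _ _

theorem inner_Jt_right (v w : L2 L) : ⟪v, Jt w⟫_ℝ = ⟪J v, w⟫_ℝ :=
  ContinuousLinearMap.adjoint_inner_right _ _ _

theorem inner_Jt_pow (j : ℕ) (v w : L2 L) : ⟪(Jt ^ j) v, w⟫_ℝ = ⟪v, (J ^ j) w⟫_ℝ := by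
  induction j generalizing v w with
  | zero => simp
  | succ j ih =>
    rw [pow_succ, pow_succ', mul_apply_eq_comp, mul_apply_eq_comp, ih, inner_Jt]

theorem Jt_eq (v : L2 L) : Jt v = ⟪one, v⟫_ℝ • one - J v := by
  refine ext_inner_right ℝ fun w => ?_
  rw [inner_Jt, inner_sub_left, real_inner_smul_left]
  linarith [inner_J_add v w]

/-- `Y ∈ L²(I)` is orthogonal to the affine functions, that is, `J²Y ∈ H²_0(I)`. -/
def IsSecondDeriv (Y : L2 L) : Prop := ⟪one, Y⟫_ℝ = 0 ∧ ⟪one, J Y⟫_ℝ = 0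

/-- The operator `Y ↦ 2JY + xY`, for which `J²(2JY + xY) = x J²Y`. -/
def mulTwo : L2 L →L[ℝ] L2 L := (2 : ℝ) • J + X

theorem mulTwo_apply (Y : L2 L) : mulTwo Y = (2 : ℝ) • J Y + X Y := rfl

theorem J_mulTwo (Y : L2 L) : J (mulTwo Y) = J (J Y) + X (J Y) := by
  rw [mulTwo_apply, X_J, map_add, map_smul, two_smul]
  abel

theorem J_J_mulTwo (Y : L2 L) : J (J (mulTwo Y)) = X (J (J Y)) := by
  rw [J_mulTwo, X_J (J Y), map_add]

/-- If w lies in H²_0(I), so does x w. The moments of X Y are read off from `inner_J_add` because X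
and J agree on the constant 1. -/
theorem IsSecondDeriv.mulTwo {Y : L2 L} (hY : IsSecondDeriv Y) : IsSecondDeriv (mulTwo Y) := by
  obtain ⟨h1, h2⟩ := hY
  have h3 := inner_J_add one Y
  have h4 := inner_J_add one (J Y)
  rw [J_one, inner_X] at h3 h4
  constructor
  · rw [mulTwo_apply, inner_add_right, real_inner_smul_right]
    simp only [h1, h2, mul_zero] at h3 ⊢
    linarith
  · rw [J_mulTwo, inner_add_right]
    simp only [h2, mul_zero] at h4
    linarith

/-- The hypothesis says G = -aY' with Y(L) = 0, so the pairing is the boundary term ½aY(0)². -/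
theorem inner_nonneg_of_smul_eq_Jt {a : ℝ} (ha : 0 < a) {Y G : L2 L} (h : a • Y = Jt G) :
    0 ≤ ⟪G, Y⟫_ℝ := by
  have h1 : a * ⟪G, Y⟫_ℝ = ⟪J G, G⟫_ℝ := by rw [← real_inner_smul_right, h, inner_Jt_right]
  have h2 := inner_J_add G G
  rw [real_inner_comm (J G) G] at h2
  have h3 : 0 ≤ a * ⟪G, Y⟫_ℝ := by
    rw [h1]
    nlinarith [sq_nonneg ⟪one, G⟫_ℝ]
  exact nonneg_of_mul_nonneg_right h3 ha

/-- Algebraic core of the smoothing effect. With G = -aY', Y(L) = 0 and (x w)'' = 2w' + x w'', the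
part 2w' contributes 2a‖Y‖², and x w'' contributes -a∫xYY' = ½a‖Y‖², without boundary terms since x
= 0 on the left and Y = 0 on the right. -/
theorem inner_mulTwo_of_smul_eq_Jt {a : ℝ} (ha : 0 < a) {Y G : L2 L} (h : a • Y = Jt G) :
    ⟪G, mulTwo Y⟫_ℝ = 5 / 2 * a * ‖Y‖ ^ 2 := by
  have h1 : ⟪G, J Y⟫_ℝ = a * ‖Y‖ ^ 2 := by
    rw [← inner_Jt, ← h, real_inner_smul_left, real_inner_self_eq_norm_sq]
  have h2 : a * ⟪G, X Y⟫_ℝ = ⟪G, X (Jt G)⟫_ℝ := by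
    rw [← h, map_smul, real_inner_smul_right]
  have h3 : ⟪Jt G, Jt G⟫_ℝ = a ^ 2 * ‖Y‖ ^ 2 := by
    rw [← h, real_inner_self_eq_norm_sq, norm_smul, mul_pow, Real.norm_eq_abs, sq_abs]
  have h4 : ⟪Jt G, Jt G⟫_ℝ = ⟪one, G⟫_ℝ * ⟪G, X one⟫_ℝ - ⟪G, J (J G)⟫_ℝ := by
    rw [inner_Jt, Jt_eq, map_sub, map_smul, inner_sub_right, real_inner_smul_right, J_one]
  have h5 : ⟪G, X (Jt G)⟫_ℝ = ⟪one, G⟫_ℝ * ⟪G, X one⟫_ℝ - ⟪G, J (J G)⟫_ℝ - ⟪G, J (X G)⟫_ℝ := by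
    rw [Jt_eq, map_sub, map_smul, inner_sub_right, real_inner_smul_right, X_J, inner_add_right]
    ring
  have h6 : ⟪G, J (X G)⟫_ℝ = ⟪G, X (Jt G)⟫_ℝ := by
    rw [← inner_Jt, ← inner_X, real_inner_comm]
  -- By h4, h5 and h6, ⟪G, X J†G⟫ equals ‖J†G‖² minus itself, so it is half of ‖J†G‖².
  have h7 : a * (2 * ⟪G, X Y⟫_ℝ) = a * (a * ‖Y‖ ^ 2) := by nlinarith
  have h8 := mul_left_cancel₀ ha.ne' h7
  rw [mulTwo_apply, inner_add_right, real_inner_smul_right, h1]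
  linarith

/-- The stationary equation `a₀ ∂_x⁵w - ∂_x³w - a₁∂_xw - ½∂_xN - ∂_x^k m = P` with
`w = J²Y ∈ H²_0(I)` and `∂_x²w(L) = 0`, in integrated form; `j = 2 - k`. -/
def IsResolvent (a₀ a₁ : ℝ) (j : ℕ) (Y P N m : L2 L) : Prop :=
  Jt (Jt (Jt P)) - (J (J Y) + a₁ • Jt (Jt (J (J Y))) + (1 / 2 : ℝ) • Jt N - Jt ((Jt ^ j) m)) + a₀ • Y
    ∈ Submodule.span ℝ {Jt (one : L2 L), Jt (Jt one)}

/-- Every term of the identity, including both generators of the span and J²Y = -J†JY, has a factor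
J† that can be split off. What remains of the generators is affine and is invisible to second
derivatives of H²_0 functions. -/
theorem IsResolvent.exists_eq {a₀ a₁ : ℝ} {j : ℕ} {Y P N m : L2 L}
    (h : IsResolvent a₀ a₁ j Y P N m) (hY : IsSecondDeriv Y) :
    ∃ G : L2 L, a₀ • Y = Jt G ∧ ∀ Z, IsSecondDeriv Z → ⟪G, Z⟫_ℝ = -⟪J Y, Z⟫_ℝ
      + a₁ * ⟪J (J Y), J Z⟫_ℝ + 1 / 2 * ⟪N, Z⟫_ℝ - ⟪m, (J ^ j) Z⟫_ℝ - ⟪P, J (J Z)⟫_ℝ := by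
  obtain ⟨c, d, hcd⟩ := Submodule.mem_span_pair.1 h
  refine ⟨c • one + d • Jt one - J Y + a₁ • Jt (J (J Y)) + (1 / 2 : ℝ) • N - (Jt ^ j) m
    - Jt (Jt P), ?_, ?_⟩
  · have h1 : Jt (J Y) = - J (J Y) := by rw [Jt_eq, hY.2, zero_smul, zero_sub]
    simp only [map_add, map_sub, map_smul, h1]
    rw [hcd]
    abel
  · intro Z hZ
    simp only [inner_sub_left, inner_add_left, real_inner_smul_left, inner_Jt, inner_Jt_pow,
      hZ.1, hZ.2]
    ring

/-- The multiplier w itself: ⟪JY, Y⟫ and ⟪J²Y, JY⟫ are half the squares of ⟪1, Y⟫ and ⟪1, JY⟫, which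
vanish, and the fifth order term is a boundary term of favourable sign. -/
theorem IsResolvent.inner_le {a₀ a₁ : ℝ} (ha₀ : 0 < a₀) {j : ℕ} {Y P N m : L2 L}
    (h : IsResolvent a₀ a₁ j Y P N m) (hY : IsSecondDeriv Y) :
    ⟪P, J (J Y)⟫_ℝ ≤ 1 / 2 * ⟪N, Y⟫_ℝ - ⟪m, (J ^ j) Y⟫_ℝ := by
  obtain ⟨G, hG, hin⟩ := h.exists_eq hY
  have h1 := inner_nonneg_of_smul_eq_Jt ha₀ hG
  rw [hin Y hY] at h1
  have h2 := inner_J_add Y Y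
  rw [real_inner_comm (J Y) Y, hY.1] at h2
  have h3 := inner_J_add (J Y) (J Y)
  rw [real_inner_comm (J (J Y)) (J Y), hY.2] at h3
  have h4 : ⟪J Y, Y⟫_ℝ = 0 := by linarith
  have h5 : ⟪J (J Y), J Y⟫_ℝ = 0 := by linarith
  rw [h4, h5] at h1
  linarith

/-- Interpolation of w' between w and w'': one integration by parts without boundary term. -/
theorem norm_J_sq_le {Y : L2 L} (hY : IsSecondDeriv Y) : ‖J Y‖ ^ 2 ≤ ‖Y‖ * ‖J (J Y)‖ := by
  have h := inner_J_add Y (J Y)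
  rw [real_inner_self_eq_norm_sq, hY.1, zero_mul] at h
  have := abs_real_inner_le_norm Y (J (J Y))
  have := neg_abs_le ⟪Y, J (J Y)⟫_ℝ
  linarith

theorem young_absorb {a : ℝ} (ha : 0 < a) (c y z : ℝ) : c * z * y ≤ a / 4 * y ^ 2 + c ^ 2 / a * z ^ 2 := by
  have h : c ^ 2 / a * z ^ 2 = (c * z) ^ 2 / a := by ring
  rw [h, ← sub_nonneg]
  have : a / 4 * y ^ 2 + (c * z) ^ 2 / a - c * z * y = (a * y / 2 - c * z) ^ 2 / a := by
    field_simp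
    ring
  rw [this]
  positivity

/-- Kato smoothing at a fixed time, from the multiplier x w: the fifth order term yields
(5/2)a₀‖Y‖², and every other term is at most linear in ‖Y‖ and is absorbed by Young's inequality. -/
theorem exists_inner_X_le (L : ℝ) [Fact (0 < L)] {a₀ : ℝ} (ha₀ : 0 < a₀) (a₁ : ℝ) (j : ℕ) :
    ∃ C : ℝ, 0 ≤ C ∧ ∀ Y P N m : L2 L, IsSecondDeriv Y → IsResolvent a₀ a₁ j Y P N m →
      ⟪P, X (J (J Y))⟫_ℝ ≤ -a₀ * ‖Y‖ ^ 2 + C * (‖J (J Y)‖ ^ 2 + ‖N‖ ^ 2 + ‖m‖ ^ 2) := by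
  set μ := ‖(mulTwo : L2 L →L[ℝ] L2 L)‖
  set κ := ‖(J : L2 L →L[ℝ] L2 L)‖
  set ν := ‖(J ^ j : L2 L →L[ℝ] L2 L)‖
  have hC1 : 0 ≤ (μ ^ 2 / a₀) ^ 2 / a₀ := by positivity
  have hC2 : 0 ≤ (|a₁| * (κ * μ)) ^ 2 / a₀ := by positivity
  have hC3 : 0 ≤ (1 / 2 * μ) ^ 2 / a₀ := by positivity
  have hC4 : 0 ≤ (ν * μ) ^ 2 / a₀ := by positivity
  refine ⟨(μ ^ 2 / a₀) ^ 2 / a₀ + (|a₁| * (κ * μ)) ^ 2 / a₀ + (1 / 2 * μ) ^ 2 / a₀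
    + (ν * μ) ^ 2 / a₀, by positivity, ?_⟩
  intro Y P N m hY h
  obtain ⟨G, hG, hin⟩ := h.exists_eq hY
  have h1 := inner_mulTwo_of_smul_eq_Jt ha₀ hG
  rw [hin _ hY.mulTwo, J_J_mulTwo] at h1
  have hM : ‖mulTwo Y‖ ≤ μ * ‖Y‖ := mulTwo.le_opNorm Y
  have hJM : ‖J (mulTwo Y)‖ ≤ κ * μ * ‖Y‖ :=
    (J.le_opNorm _).trans (by rw [mul_assoc]; gcongr)
  have hjM : ‖(J ^ j) (mulTwo Y)‖ ≤ ν * μ * ‖Y‖ :=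
    ((J ^ j).le_opNorm _).trans (by rw [mul_assoc]; gcongr)
  have e1 : -⟪J Y, mulTwo Y⟫_ℝ ≤ μ * ‖J Y‖ * ‖Y‖ := by
    refine (neg_le_abs _).trans ((abs_real_inner_le_norm _ _).trans ?_)
    calc ‖J Y‖ * ‖mulTwo Y‖ ≤ ‖J Y‖ * (μ * ‖Y‖) := by gcongr
      _ = _ := by ring
  have e2 : a₁ * ⟪J (J Y), J (mulTwo Y)⟫_ℝ ≤ |a₁| * (κ * μ) * ‖J (J Y)‖ * ‖Y‖ := by
    refine (le_abs_self _).trans ?_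
    rw [abs_mul]
    calc |a₁| * |⟪J (J Y), J (mulTwo Y)⟫_ℝ| ≤ |a₁| * (‖J (J Y)‖ * (κ * μ * ‖Y‖)) := by
          gcongr
          exact (abs_real_inner_le_norm _ _).trans (by gcongr)
      _ = _ := by ring
  have e3 : 1 / 2 * ⟪N, mulTwo Y⟫_ℝ ≤ 1 / 2 * μ * ‖N‖ * ‖Y‖ := by
    calc 1 / 2 * ⟪N, mulTwo Y⟫_ℝ ≤ 1 / 2 * (‖N‖ * (μ * ‖Y‖)) := by
          gcongr
          exact (real_inner_le_norm _ _).trans (by gcongr)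
      _ = _ := by ring
  have e4 : -⟪m, (J ^ j) (mulTwo Y)⟫_ℝ ≤ ν * μ * ‖m‖ * ‖Y‖ := by
    refine (neg_le_abs _).trans ((abs_real_inner_le_norm _ _).trans ?_)
    calc ‖m‖ * ‖(J ^ j) (mulTwo Y)‖ ≤ ‖m‖ * (ν * μ * ‖Y‖) := by gcongr
      _ = _ := by ring
  -- Five applications cost a₀/4 · ‖Y‖² each, so of the factor 5/2 there remains 5/4 ≥ 1. The term
  -- of third order needs two of them: the first leaves ‖JY‖², which is interpolated and split
  -- again.
  have y1 := young_absorb ha₀ μ ‖Y‖ ‖J Y‖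
  have y1' : μ ^ 2 / a₀ * ‖J Y‖ ^ 2 ≤ μ ^ 2 / a₀ * ‖J (J Y)‖ * ‖Y‖ := by
    rw [mul_assoc, mul_comm ‖J (J Y)‖]
    exact mul_le_mul_of_nonneg_left (norm_J_sq_le hY) (by positivity)
  have y1'' := young_absorb ha₀ (μ ^ 2 / a₀) ‖Y‖ ‖J (J Y)‖
  have y2 := young_absorb ha₀ (|a₁| * (κ * μ)) ‖Y‖ ‖J (J Y)‖
  have y3 := young_absorb ha₀ (1 / 2 * μ) ‖Y‖ ‖N‖
  have y4 := young_absorb ha₀ (ν * μ) ‖Y‖ ‖m‖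
  have p1 := mul_nonneg hC1 (sq_nonneg ‖N‖)
  have p2 := mul_nonneg hC1 (sq_nonneg ‖m‖)
  have p3 := mul_nonneg hC2 (sq_nonneg ‖N‖)
  have p4 := mul_nonneg hC2 (sq_nonneg ‖m‖)
  have p5 := mul_nonneg hC3 (sq_nonneg ‖J (J Y)‖)
  have p6 := mul_nonneg hC3 (sq_nonneg ‖m‖)
  have p7 := mul_nonneg hC4 (sq_nonneg ‖J (J Y)‖)
  have p8 := mul_nonneg hC4 (sq_nonneg ‖N‖)
  have p9 := mul_nonneg ha₀.le (sq_nonneg ‖Y‖)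
  linarith

end

end Kawahara

/-! ### Weak derivatives, the spaces H^m_0(I) and density of test functions. -/

namespace Kawahara

noncomputable section

open scoped InnerProductSpace

variable {L : ℝ}

theorem continuous_iteratedDeriv_of_smooth {φ : ℝ → ℝ}
    (hφ : ContDiff ℝ ((⊤ : ℕ∞) : WithTop ℕ∞) φ) (j : ℕ) : Continuous (iteratedDeriv j φ) :=
  hφ.continuous_iteratedDeriv j (by exact_mod_cast le_top)

theorem hasDerivAt_iteratedDeriv {φ : ℝ → ℝ}
    (hφ : ContDiff ℝ ((⊤ : ℕ∞) : WithTop ℕ∞) φ) (j : ℕ) (x : ℝ) :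
    HasDerivAt (iteratedDeriv j φ) (iteratedDeriv (j + 1) φ x) x := by
  rw [iteratedDeriv_succ]
  exact (hφ.differentiable_iteratedDeriv j (by exact_mod_cast ENat.natCast_lt_top j) x).hasDerivAt

/-- The class in `L²(I)` of the `j`-th derivative of a smooth function. -/
def derivClass (L : ℝ) {φ : ℝ → ℝ} (hφ : ContDiff ℝ ((⊤ : ℕ∞) : WithTop ℕ∞) φ) (j : ℕ) : L2 L :=
  toL2 (iteratedDeriv j φ) (continuous_iteratedDeriv_of_smooth hφ j).continuousOn

theorem inner_derivClass (v : L2 L) {φ : ℝ → ℝ} (hφ : ContDiff ℝ ((⊤ : ℕ∞) : WithTop ℕ∞) φ)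
    (j : ℕ) : ⟪v, derivClass L hφ j⟫_ℝ = ∫ x in Ioo 0 L, v x * iteratedDeriv j φ x :=
  inner_toL2 _ _

theorem integral_iteratedDeriv_succ {φ : ℝ → ℝ} (hφ : ContDiff ℝ ((⊤ : ℕ∞) : WithTop ℕ∞) φ)
    (j : ℕ) (x : ℝ) :
    ∫ r in (0 : ℝ)..x, iteratedDeriv (j + 1) φ r = iteratedDeriv j φ x - iteratedDeriv j φ 0 :=
  intervalIntegral.integral_eq_sub_of_hasDerivAt (fun r _ => hasDerivAt_iteratedDeriv hφ j r)
    ((continuous_iteratedDeriv_of_smooth hφ (j + 1)).intervalIntegrable _ _)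

theorem inner_one_derivClass_succ (hL : 0 ≤ L) {φ : ℝ → ℝ}
    (hφ : ContDiff ℝ ((⊤ : ℕ∞) : WithTop ℕ∞) φ) (j : ℕ) :
    ⟪one, derivClass L hφ (j + 1)⟫_ℝ = iteratedDeriv j φ L - iteratedDeriv j φ 0 := by
  rw [inner_one, derivClass, integral_congr_ae
    (toL2_ae (continuous_iteratedDeriv_of_smooth hφ (j + 1)).continuousOn), setIntegral_Ioo_eq hL,
    integral_iteratedDeriv_succ hφ]

theorem J_derivClass_succ [Fact (0 < L)] {φ : ℝ → ℝ}
    (hφ : ContDiff ℝ ((⊤ : ℕ∞) : WithTop ℕ∞) φ) (j : ℕ) (h0 : iteratedDeriv j φ 0 = 0) :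
    J (derivClass L hφ (j + 1)) = derivClass L hφ j := by
  rw [derivClass, J_toL2]
  refine toL2_congr _ _ fun x _ => ?_
  rw [integral_iteratedDeriv_succ hφ, h0, sub_zero]

theorem tsupport_iteratedDeriv_subset (φ : ℝ → ℝ) (j : ℕ) :
    tsupport (iteratedDeriv j φ) ⊆ tsupport φ := by
  induction j with
  | zero => rw [iteratedDeriv_zero]
  | succ j ih =>
    rw [iteratedDeriv_succ]
    exact (closure_minimal support_deriv_subset (isClosed_tsupport _)).trans ih

theorem IsTest.iteratedDeriv_eq_zero {φ : ℝ → ℝ} (hφ : IsTest L φ) (j : ℕ) {x : ℝ}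
    (hx : x ∉ Ioo 0 L) : iteratedDeriv j φ x = 0 :=
  image_eq_zero_of_notMem_tsupport fun h => hx (hφ.support (tsupport_iteratedDeriv_subset φ j h))

theorem hasWeakDeriv_iff {m : ℕ} {v w : L2 L} : HasWeakDeriv L m v w ↔
    ∀ φ : ℝ → ℝ, ∀ hφ : IsTest L φ,
      ⟪v, derivClass L hφ.smooth m⟫_ℝ = (-1) ^ m * ⟪w, derivClass L hφ.smooth 0⟫_ℝ := by
  refine forall_congr' fun φ => forall_congr' fun hφ => ?_
  rw [inner_derivClass, inner_derivClass, iteratedDeriv_zero]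

theorem HasWeakDeriv.add {m : ℕ} {v w v' w' : L2 L} (h : HasWeakDeriv L m v w)
    (h' : HasWeakDeriv L m v' w') : HasWeakDeriv L m (v + v') (w + w') := by
  rw [hasWeakDeriv_iff] at *
  intro φ hφ
  rw [inner_add_left, inner_add_left, h φ hφ, h' φ hφ, mul_add]

theorem HasWeakDeriv.sub {m : ℕ} {v w v' w' : L2 L} (h : HasWeakDeriv L m v w)
    (h' : HasWeakDeriv L m v' w') : HasWeakDeriv L m (v - v') (w - w') := by
  rw [hasWeakDeriv_iff] at *
  intro φ hφ
  rw [inner_sub_left, inner_sub_left, h φ hφ, h' φ hφ, mul_sub]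

/-- A weak derivative is a family of identities between pairings with fixed vectors, and these pass
through Bochner integrals. -/
theorem HasWeakDeriv.integral {α : Type*} [MeasurableSpace α] {μ : Measure α} {m : ℕ}
    {v w : α → L2 L} (h : ∀ᵐ t ∂μ, HasWeakDeriv L m (v t) (w t)) (hv : Integrable v μ)
    (hw : Integrable w μ) : HasWeakDeriv L m (∫ t, v t ∂μ) (∫ t, w t ∂μ) := by
  rw [hasWeakDeriv_iff]
  intro φ hφ
  rw [real_inner_comm, ← integral_inner hv, real_inner_comm, ← integral_inner hw,
    ← integral_const_mul]
  refine integral_congr_ae ?_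
  filter_upwards [h] with t ht
  rw [hasWeakDeriv_iff] at ht
  rw [real_inner_comm, ht φ hφ, real_inner_comm]

theorem wderiv_spec {m : ℕ} {v : L2 L} (h : ∃ w, HasWeakDeriv L m v w) :
    HasWeakDeriv L m v (wderiv L m v) := by
  rw [wderiv, dif_pos h]
  exact h.choose_spec

theorem HasWeakDeriv.wderiv_eq {m : ℕ} {v w : L2 L} (h : HasWeakDeriv L m v w) :
    wderiv L m v = w :=
  (wderiv_spec ⟨w, h⟩).unique h

theorem wderiv_zero (v : L2 L) : wderiv L 0 v = v := by
  apply HasWeakDeriv.wderiv_eq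
  rw [hasWeakDeriv_iff]
  intro φ hφ
  rw [pow_zero, one_mul]

theorem MemH0.hasWeakDeriv {m : ℕ} {v : L2 L} (h : MemH0 L m v) {j : ℕ} (hj : j ≤ m) :
    HasWeakDeriv L j v (wderiv L j v) :=
  wderiv_spec (h.1 j hj)

theorem MemH0.exists_norm_sub_le {m : ℕ} {v : L2 L} (h : MemH0 L m v) {ε : ℝ} (hε : 0 < ε) :
    ∃ φ : ℝ → ℝ, ∃ hφ : IsTest L φ, ∀ j ≤ m, ‖derivClass L hφ.smooth j - wderiv L j v‖ ≤ ε := by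
  obtain ⟨φ, hφ, hb⟩ := h.2 ε hε
  refine ⟨φ, hφ, fun j hj => ?_⟩
  rw [Lp.norm_def]
  refine ENNReal.toReal_le_of_le_ofReal hε.le (le_trans (le_of_eq (eLpNorm_congr_ae ?_)) (hb j hj))
  filter_upwards [Lp.coeFn_sub (derivClass L hφ.smooth j) (wderiv L j v),
    toL2_ae (L := L) (continuous_iteratedDeriv_of_smooth hφ.smooth j).continuousOn] with x h1 h2
  rw [h1, Pi.sub_apply, derivClass, h2]

variable [hL : Fact (0 < L)]

/-- Exact for test functions, which vanish at 0, and stable under limits because J is bounded.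
Together with `MemH0.inner_one_wderiv`, where the zero value at L enters, it replaces traces
throughout. -/
theorem MemH0.wderiv_eq_J {m : ℕ} {v : L2 L} (h : MemH0 L m v) {j : ℕ} (hj : j < m) :
    wderiv L j v = J (wderiv L (j + 1) v) := by
  have key : ∀ ε > 0, ‖wderiv L j v - J (wderiv L (j + 1) v)‖ ≤
      ε * (1 + ‖(J : L2 L →L[ℝ] L2 L)‖) := by
    intro ε hε
    obtain ⟨φ, hφ, hb⟩ := h.exists_norm_sub_le hε
    have h1 := hb j hj.le
    have h2 := hb (j + 1) hj
    have h3 := J_derivClass_succ (L := L) hφ.smooth j (hφ.iteratedDeriv_eq_zero j (by simp))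
    have h4 : wderiv L j v - J (wderiv L (j + 1) v) = -(derivClass L hφ.smooth j - wderiv L j v)
        + J (derivClass L hφ.smooth (j + 1) - wderiv L (j + 1) v) := by
      rw [map_sub, h3]
      abel
    rw [h4]
    refine (norm_add_le _ _).trans ?_
    rw [norm_neg]
    have h5 := J.le_opNorm (derivClass L hφ.smooth (j + 1) - wderiv L (j + 1) v)
    have h6 : ‖(J : L2 L →L[ℝ] L2 L)‖ * ‖derivClass L hφ.smooth (j + 1) - wderiv L (j + 1) v‖
        ≤ ‖(J : L2 L →L[ℝ] L2 L)‖ * ε := by gcongr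
    linarith
  have h0 : ‖wderiv L j v - J (wderiv L (j + 1) v)‖ ≤ 0 := by
    refine le_of_forall_pos_le_add fun ε hε => ?_
    have hp : 0 < 1 + ‖(J : L2 L →L[ℝ] L2 L)‖ := by positivity
    refine (key (ε / (1 + ‖(J : L2 L →L[ℝ] L2 L)‖)) (by positivity)).trans ?_
    rw [div_mul_cancel₀ _ hp.ne']
    linarith
  exact sub_eq_zero.1 (norm_le_zero_iff.1 h0)

theorem MemH0.inner_one_wderiv {m : ℕ} {v : L2 L} (h : MemH0 L m v) {j : ℕ} (hj : j < m) :
    ⟪one, wderiv L (j + 1) v⟫_ℝ = 0 := by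
  have h0 : |⟪one, wderiv L (j + 1) v⟫_ℝ| ≤ 0 := by
    refine le_of_forall_pos_le_add fun ε hε => ?_
    have hp : 0 < 1 + ‖(one : L2 L)‖ := by positivity
    obtain ⟨φ, hφ, hb⟩ := h.exists_norm_sub_le (show 0 < ε / (1 + ‖(one : L2 L)‖) by positivity)
    have h2 := hb (j + 1) hj
    have h3 := inner_one_derivClass_succ hL.out.le hφ.smooth j
    rw [hφ.iteratedDeriv_eq_zero j (by simp), hφ.iteratedDeriv_eq_zero j (by simp), sub_zero] at h3
    have h4 := abs_real_inner_le_norm one (derivClass L hφ.smooth (j + 1) - wderiv L (j + 1) v)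
    rw [inner_sub_right, h3, zero_sub, abs_neg] at h4
    refine h4.trans ?_
    calc ‖(one : L2 L)‖ * _ ≤ (1 + ‖(one : L2 L)‖) * (ε / (1 + ‖(one : L2 L)‖)) := by
          gcongr
          linarith
      _ = 0 + ε := by rw [mul_div_cancel₀ _ hp.ne', zero_add]
  exact abs_nonpos_iff.1 h0

theorem MemH0.wderiv_eq_J_pow {m : ℕ} {v : L2 L} (h : MemH0 L m v) (i : ℕ) {j : ℕ}
    (hj : j + i ≤ m) : wderiv L j v = (J ^ i) (wderiv L (j + i) v) := by
  induction i with
  | zero => simp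
  | succ i ih =>
    rw [ih (by omega), h.wderiv_eq_J (show j + i < m by omega), pow_succ, mul_apply_eq_comp]
    rfl

theorem MemH0.isSecondDeriv {v : L2 L} (h : MemH0 L 2 v) : IsSecondDeriv (wderiv L 2 v) := by
  refine ⟨h.inner_one_wderiv one_lt_two, ?_⟩
  rw [← h.wderiv_eq_J one_lt_two]
  exact h.inner_one_wderiv two_pos

theorem MemH0.eq_J_J {v : L2 L} (h : MemH0 L 2 v) : v = J (J (wderiv L 2 v)) := by
  have h1 := h.wderiv_eq_J_pow 2 (j := 0) le_rfl
  rw [wderiv_zero] at h1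
  exact h1

theorem MemH0.norm_le {k : ℕ} {v : L2 L} (h : MemH0 L k v) :
    ‖v‖ ≤ ‖(J ^ k : L2 L →L[ℝ] L2 L)‖ * ‖wderiv L k v‖ := by
  have h1 := h.wderiv_eq_J_pow k (j := 0) (by omega)
  rw [wderiv_zero, zero_add] at h1
  conv_lhs => rw [h1]
  exact (J ^ k).le_opNorm _

theorem contDiff_primitive {χ : ℝ → ℝ} (hχ : ContDiff ℝ ((⊤ : ℕ∞) : WithTop ℕ∞) χ) :
    ContDiff ℝ ((⊤ : ℕ∞) : WithTop ℕ∞) (fun x => ∫ r in (0 : ℝ)..x, χ r) := by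
  have hd : ∀ x, HasDerivAt (fun x => ∫ r in (0 : ℝ)..x, χ r) (χ x) x := fun x =>
    (hχ.continuous).integral_hasStrictDerivAt 0 x |>.hasDerivAt
  rw [contDiff_infty_iff_deriv]
  refine ⟨fun x => (hd x).differentiableAt, ?_⟩
  rw [show deriv (fun x => ∫ r in (0 : ℝ)..x, χ r) = χ from funext fun x => (hd x).deriv]
  exact hχ

omit hL in
theorem iteratedDeriv_succ_primitive {χ : ℝ → ℝ} (hχ : ContDiff ℝ ((⊤ : ℕ∞) : WithTop ℕ∞) χ)
    (j : ℕ) : iteratedDeriv (j + 1) (fun x => ∫ r in (0 : ℝ)..x, χ r) = iteratedDeriv j χ := by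
  rw [iteratedDeriv_succ']
  congr 1
  ext x
  exact ((hχ.continuous).integral_hasStrictDerivAt 0 x).hasDerivAt.deriv

variable (L) in
/-- The classes of smooth functions in `L²(I)`. -/
def smoothSubmodule : Submodule ℝ (L2 L) where
  carrier := {v | ∃ χ, ∃ hχ : ContDiff ℝ ((⊤ : ℕ∞) : WithTop ℕ∞) χ, derivClass L hχ 0 = v}
  add_mem' := by
    rintro _ _ ⟨χ, hχ, rfl⟩ ⟨ψ, hψ, rfl⟩
    exact ⟨_, hχ.add hψ, rfl⟩
  zero_mem' := ⟨fun _ => 0, contDiff_const, rfl⟩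
  smul_mem' := by
    rintro c _ ⟨χ, hχ, rfl⟩
    exact ⟨_, contDiff_const.mul hχ (f := fun _ => c), rfl⟩

variable (L) in
/-- The classes of test functions in `L²(I)`. -/
def testSubmodule : Submodule ℝ (L2 L) where
  carrier := {v | ∃ φ, ∃ hφ : IsTest L φ, derivClass L hφ.smooth 0 = v}
  add_mem' := by
    rintro _ _ ⟨χ, hχ, rfl⟩ ⟨ψ, hψ, rfl⟩
    exact ⟨_, ⟨hχ.smooth.add hψ.smooth, hχ.compact.add hψ.compact,
      (tsupport_add χ ψ).trans (union_subset hχ.support hψ.support)⟩, rfl⟩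
  zero_mem' := ⟨fun _ => 0, ⟨contDiff_const, HasCompactSupport.zero, by simp⟩, rfl⟩
  smul_mem' := by
    rintro c _ ⟨χ, hχ, rfl⟩
    exact ⟨_, ⟨contDiff_const.mul hχ.smooth (f := fun _ => c), hχ.compact.mul_left,
      (tsupport_mul_subset_right).trans hχ.support⟩, rfl⟩

omit hL in
theorem one_mem_smoothSubmodule : (one : L2 L) ∈ smoothSubmodule L :=
  ⟨fun _ => 1, contDiff_const, rfl⟩

theorem J_mem_smoothSubmodule {v : L2 L} (hv : v ∈ smoothSubmodule L) :
    J v ∈ smoothSubmodule L := by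
  obtain ⟨χ, hχ, rfl⟩ := hv
  refine ⟨_, contDiff_primitive hχ, ?_⟩
  rw [derivClass, derivClass, J_toL2]
  exact toL2_congr _ _ fun x _ => rfl

theorem Jt_mem_smoothSubmodule {v : L2 L} (hv : v ∈ smoothSubmodule L) :
    Jt v ∈ smoothSubmodule L := by
  rw [Jt_eq]
  exact Submodule.sub_mem _ (Submodule.smul_mem _ _ one_mem_smoothSubmodule)
    (J_mem_smoothSubmodule hv)

omit hL in
theorem eq_zero_of_forall_test {v : L2 L}
    (h : ∀ φ : ℝ → ℝ, ∀ hφ : IsTest L φ, ⟪v, derivClass L hφ.smooth 0⟫_ℝ = 0) : v = 0 := by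
  have h1 : HasWeakDeriv L 0 v v := by
    rw [hasWeakDeriv_iff]
    intro φ hφ
    rw [pow_zero, one_mul]
  refine h1.unique ?_
  rw [hasWeakDeriv_iff]
  intro φ hφ
  rw [h φ hφ, inner_zero_left, mul_zero]

/-- A vector that is orthogonal to all smooth functions orthogonal to `J†1` and `(J†)²1` is a
combination of these two. -/
theorem mem_span_of_forall_smooth {S : L2 L}
    (h : ∀ χ : ℝ → ℝ, ∀ hχ : ContDiff ℝ ((⊤ : ℕ∞) : WithTop ℕ∞) χ,
      IsSecondDeriv (J (derivClass L hχ 0)) → ⟪S, derivClass L hχ 0⟫_ℝ = 0) :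
    S ∈ Submodule.span ℝ {Jt (one : L2 L), Jt (Jt one)} := by
  set F := Submodule.span ℝ {Jt (one : L2 L), Jt (Jt one)} with hF
  have : FiniteDimensional ℝ F := FiniteDimensional.span_of_finite ℝ (Set.toFinite _)
  -- Both generators are polynomials, so a test function minus its projection onto their span is
  -- still smooth and is admissible in the hypothesis.
  have hFs : F ≤ smoothSubmodule L := by
    rw [hF, Submodule.span_le]
    rintro _ (rfl | rfl)
    · exact Jt_mem_smoothSubmodule one_mem_smoothSubmodule
    · exact Jt_mem_smoothSubmodule (Jt_mem_smoothSubmodule one_mem_smoothSubmodule)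
  have hv : S - F.starProjection S = 0 := by
    refine eq_zero_of_forall_test fun φ hφ => ?_
    set c := derivClass L hφ.smooth 0
    have hperp : c - F.starProjection c ∈ Fᗮ := Submodule.sub_starProjection_mem_orthogonal c
    obtain ⟨χ, hχ, hχc⟩ : c - F.starProjection c ∈ smoothSubmodule L :=
      Submodule.sub_mem _ ⟨φ, hφ.smooth, rfl⟩ (hFs (Submodule.starProjection_apply_mem F c))
    have h1 : ⟪S, c - F.starProjection c⟫_ℝ = 0 := by
      rw [← hχc]
      refine h χ hχ ?_
      rw [hχc]
      constructor
      · rw [← inner_Jt]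
        exact hperp _ (Submodule.subset_span (by simp))
      · rw [← inner_Jt, ← inner_Jt]
        exact hperp _ (Submodule.subset_span (by simp))
    have h2 : ⟪F.starProjection S, c - F.starProjection c⟫_ℝ = 0 :=
      hperp _ (Submodule.starProjection_apply_mem F S)
    have h3 : ⟪S - F.starProjection S, F.starProjection c⟫_ℝ = 0 := by
      rw [real_inner_comm]
      exact Submodule.sub_starProjection_mem_orthogonal S _ (Submodule.starProjection_apply_mem F c)
    have h4 : ⟪S - F.starProjection S, c - F.starProjection c⟫_ℝ = 0 := by
      rw [inner_sub_left, h1, h2, sub_zero]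
    rw [inner_sub_right, h3, sub_zero] at h4
    exact h4
  rw [sub_eq_zero.1 hv]
  exact Submodule.starProjection_apply_mem F S

omit hL in
/-- Smooth functions with compact support in `I` are dense in `L²(I)`. -/
theorem exists_test_norm_sub_le (v : L2 L) {ε : ℝ} (hε : 0 < ε) :
    ∃ φ : ℝ → ℝ, ∃ hφ : IsTest L φ, ‖v - derivClass L hφ.smooth 0‖ ≤ ε := by
  have h1 : (testSubmodule L).topologicalClosure = ⊤ := by
    rw [Submodule.topologicalClosure_eq_top_iff, Submodule.eq_bot_iff]
    intro w hw
    refine eq_zero_of_forall_test fun φ hφ => ?_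
    rw [real_inner_comm]
    exact hw _ ⟨φ, hφ, rfl⟩
  have h2 : v ∈ closure (testSubmodule L : Set (L2 L)) := by
    rw [← Submodule.topologicalClosure_coe, h1]
    trivial
  obtain ⟨_, ⟨φ, hφ, rfl⟩, hd⟩ := Metric.mem_closure_iff.1 h2 ε hε
  refine ⟨φ, hφ, ?_⟩
  rw [← dist_eq_norm]
  exact hd.le

end

end Kawahara

namespace Kawahara

noncomputable section

open scoped InnerProductSpace

/-! ### Compactness of J: finite rank approximation with test functions as range. -/

section FiniteRank

variable {L : ℝ}

theorem measurable_cellIndex (L : ℝ) (n : ℕ) :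
    Measurable fun x : ℝ => Fin.ofNat (n + 1) ⌊x * (n + 1) / L⌋₊ :=
  (measurable_of_countable (Fin.ofNat (n + 1))).comp
    (Nat.measurable_floor.comp (by fun_prop))

theorem memLp_step (L : ℝ) (n : ℕ) (c : Fin (n + 1) → ℝ) :
    MemLp (fun x : ℝ => c (Fin.ofNat (n + 1) ⌊x * (n + 1) / L⌋₊)) 2 (intervalMeasure L) :=
  MemLp.of_bound ((measurable_of_countable c).comp (measurable_cellIndex L n)).aestronglyMeasurable
    ‖c‖ (ae_of_all _ fun _ => norm_le_pi_norm c _)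

/-- Step functions on the partition of `I` into `n + 1` cells of equal length. -/
def stepMap (L : ℝ) (n : ℕ) : (Fin (n + 1) → ℝ) →ₗ[ℝ] L2 L where
  toFun c := (memLp_step L n c).toLp _
  map_add' _ _ := MemLp.toLp_add _ _
  map_smul' _ _ := MemLp.toLp_const_smul _ _

theorem stepMap_ae (L : ℝ) (n : ℕ) (c : Fin (n + 1) → ℝ) : ∀ᵐ x ∂(intervalMeasure L),
    stepMap L n c x = c (Fin.ofNat (n + 1) ⌊x * (n + 1) / L⌋₊) :=
  (memLp_step L n c).coeFn_toLp

variable [hL : Fact (0 < L)]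

omit hL in
-- Cauchy-Schwarz against an indicator: primitives of L² functions are Hölder continuous of order
-- 1/2, which is where the compactness of J comes from.
theorem abs_integral_le_sqrt_mul (v : L2 L) {s x : ℝ} (hs : 0 ≤ s) (hsx : s ≤ x) (hx : x ≤ L) :
    |∫ r in s..x, v r| ≤ Real.sqrt (x - s) * ‖v‖ := by
  have hfin : intervalMeasure L (Ioc s x) ≠ ⊤ := measure_ne_top _ _
  have h1 : ∫ r in s..x, v r = ⟪indicatorConstLp 2 measurableSet_Ioc hfin (1 : ℝ), v⟫_ℝ := by
    rw [L2.inner_indicatorConstLp_one, intervalIntegral.integral_of_le hsx,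
      integral_Ioc_eq_integral_Ioo, Measure.restrict_restrict measurableSet_Ioc]
    have e : ∫ r in Ioc s x ∩ Ioo 0 L, v r = ∫ r in Ioo s x, v r := by
      apply setIntegral_congr_set
      have h2 : (Ioc s x ∩ Ioo 0 L : Set ℝ) =ᵐ[volume] (Ioo s x ∩ Ioo 0 L : Set ℝ) :=
        (Ioo_ae_eq_Ioc (μ := volume)).symm.inter (ae_eq_refl _)
      rwa [inter_eq_left.2 (Ioo_subset_Ioo hs hx)] at h2
    rw [e]
  rw [h1]
  refine (abs_real_inner_le_norm _ _).trans ?_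
  gcongr
  rw [norm_indicatorConstLp (by norm_num) (by norm_num), norm_one, one_mul]
  simp only [ENNReal.toReal_ofNat, ← Real.sqrt_eq_rpow]
  apply Real.sqrt_le_sqrt
  rw [measureReal_def]
  refine ENNReal.toReal_le_of_le_ofReal (by linarith) ?_
  refine (Measure.restrict_apply_le _ _).trans ?_
  rw [Real.volume_Ioc]

/-- Sample the primitive at the left end of each of n + 1 equal cells. The pointwise error is at
most √(L/(n + 1))‖z‖, so the L² error is at most L/√(n + 1) · ‖z‖, uniformly in z. -/
theorem exists_step_norm_sub_le {ε : ℝ} (hε : 0 < ε) :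
    ∃ n : ℕ, ∀ z : L2 L, ∃ w ∈ LinearMap.range (stepMap L n), ‖J z - w‖ ≤ ε * ‖z‖ := by
  have hLp := hL.out
  obtain ⟨n, hn⟩ := exists_nat_gt (L ^ 2 / ε ^ 2)
  refine ⟨n, fun z => ?_⟩
  set c : Fin (n + 1) → ℝ := fun i => ∫ r in (0 : ℝ)..(i * (L / (n + 1))), z r
  refine ⟨stepMap L n c, LinearMap.mem_range_self _ _, ?_⟩
  have hN : (0 : ℝ) < n + 1 := by positivity
  have hbound : ∀ᵐ x ∂(intervalMeasure L), ‖(J z - stepMap L n c) x‖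
      ≤ Real.sqrt (L / (n + 1)) * ‖z‖ := by
    filter_upwards [Lp.coeFn_sub (J z) (stepMap L n c), J_ae z, stepMap_ae L n c,
      ae_restrict_mem measurableSet_Ioo] with x h1 h2 h3 hx
    rw [h1, Pi.sub_apply, h2, h3]
    have hpos : 0 ≤ x * (n + 1) / L := by
      have := hx.1
      positivity
    have hlt : x * (n + 1) / L < n + 1 := by
      rw [div_lt_iff₀ hLp]
      nlinarith [hx.2]
    -- Since x < L, the cell index needs no reduction modulo n + 1 in `Fin.ofNat`.
    have hfl : ⌊x * (n + 1) / L⌋₊ < n + 1 := by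
      rw [Nat.floor_lt hpos]
      exact_mod_cast hlt
    have hval : ((Fin.ofNat (n + 1) ⌊x * (n + 1) / L⌋₊ : Fin (n + 1)) : ℕ)
        = ⌊x * (n + 1) / L⌋₊ := by
      simp [Fin.ofNat, Nat.mod_eq_of_lt hfl]
    simp only [c, hval]
    set s := (⌊x * (n + 1) / L⌋₊ : ℝ) * (L / (n + 1))
    have hs0 : 0 ≤ s := by positivity
    have e : x = x * (n + 1) / L * (L / (n + 1)) := by field_simp
    have hsx : s ≤ x := by
      conv_rhs => rw [e]
      exact mul_le_mul_of_nonneg_right (Nat.floor_le hpos) (by positivity)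
    have hxs : x - s ≤ L / (n + 1) := by
      have h4 := (Nat.lt_floor_add_one (x * (n + 1) / L)).le
      have h5 := mul_le_mul_of_nonneg_right h4 (show 0 ≤ L / ((n : ℝ) + 1) by positivity)
      rw [← e] at h5
      linarith
    rw [intervalIntegral.integral_interval_sub_left
      (intervalIntegrable_of_Ioo z.integrableOn (Ioo_subset_Icc_self hx))
      (intervalIntegrable_of_Ioo z.integrableOn ⟨hs0, hsx.trans hx.2.le⟩), Real.norm_eq_abs]
    refine (abs_integral_le_sqrt_mul z hs0 hsx hx.2.le).trans ?_
    gcongr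
  have h1 := Lp.norm_le_of_ae_bound (by positivity) hbound
  refine h1.trans ?_
  have h2 : (measureUnivNNReal (intervalMeasure L) : ℝ) = L := by
    rw [measureUnivNNReal, ENNReal.coe_toNNReal_eq_toReal]
    simp [hLp.le]
  simp only [ENNReal.toReal_ofNat, h2]
  have h3 : L ^ (2 : ℝ)⁻¹ = Real.sqrt L := by rw [Real.sqrt_eq_rpow, one_div]
  rw [h3, ← mul_assoc, ← Real.sqrt_mul hLp.le]
  gcongr
  rw [Real.sqrt_le_left hε.le]
  rw [div_lt_iff₀ (by positivity)] at hn
  rw [mul_div_assoc', div_le_iff₀ hN]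
  nlinarith [sq_nonneg ε]

/-- On the range of `J` the identity is approximated in norm by finite rank operators whose range
consists of test functions. -/
theorem exists_finiteRank_approx (L : ℝ) [Fact (0 < L)] {ε : ℝ} (hε : 0 < ε) :
    ∃ (d : ℕ) (e : Fin d → L2 L) (φ : Fin d → ℝ → ℝ) (hφ : ∀ i, IsTest L (φ i)), ∀ z : L2 L,
      ‖J z - ∑ i, ⟪e i, J z⟫_ℝ • derivClass L (hφ i).smooth 0‖ ≤ ε * ‖z‖ := by
  obtain ⟨n, hn⟩ := exists_step_norm_sub_le (L := L) (half_pos hε)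
  set W := LinearMap.range (stepMap L n)
  set b := stdOrthonormalBasis ℝ W
  set κ := ‖(J : L2 L →L[ℝ] L2 L)‖
  set d := Module.finrank ℝ W
  -- Replacing each of the d orthonormal vectors by a test function costs at most κη‖z‖; in total
  -- this stays below ε/2 · ‖z‖.
  set η := ε / 2 / (d * κ + 1)
  have hη : 0 < η := by positivity
  choose φ hφ hb using fun i : Fin d => exists_test_norm_sub_le ((b i : W) : L2 L) hη
  refine ⟨d, fun i => (b i : L2 L), φ, hφ, fun z => ?_⟩
  obtain ⟨w, hw, hwz⟩ := hn z
  have h1 : ‖J z - W.starProjection (J z)‖ ≤ ε / 2 * ‖z‖ := by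
    rw [Submodule.starProjection_minimal]
    exact (ciInf_le ⟨0, Set.forall_mem_range.mpr fun _ => norm_nonneg _⟩ (⟨w, hw⟩ : W)).trans hwz
  have h2 : W.starProjection (J z) = ∑ i, ⟪(b i : L2 L), J z⟫_ℝ • (b i : L2 L) := by
    rw [b.starProjection_eq_sum_rankOne]
    simp
  have h3 : ‖∑ i, ⟪(b i : L2 L), J z⟫_ℝ • ((b i : L2 L) - derivClass L (hφ i).smooth 0)‖
      ≤ d * κ * η * ‖z‖ := by
    refine (norm_sum_le _ _).trans ?_
    calc _ ≤ ∑ i : Fin d, κ * ‖z‖ * η := by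
          refine Finset.sum_le_sum fun i _ => ?_
          rw [norm_smul]
          refine mul_le_mul ?_ (hb i) (norm_nonneg _) (by positivity)
          refine (abs_real_inner_le_norm _ _).trans ?_
          have hbi : ‖((b i : W) : L2 L)‖ = 1 := b.orthonormal.1 i
          rw [hbi, one_mul]
          exact J.le_opNorm z
      _ = d * κ * η * ‖z‖ := by
          simp
          ring
  have h4 : d * κ * η ≤ ε / 2 := by
    have : (d * κ + 1) * η = ε / 2 := mul_div_cancel₀ _ (by positivity)
    nlinarith
  have h5 : J z - ∑ i, ⟪(b i : L2 L), J z⟫_ℝ • derivClass L (hφ i).smooth 0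
      = (J z - W.starProjection (J z)) +
        ∑ i, ⟪(b i : L2 L), J z⟫_ℝ • ((b i : L2 L) - derivClass L (hφ i).smooth 0) := by
    simp only [smul_sub, Finset.sum_sub_distrib]
    rw [h2]
    abel
  rw [h5]
  refine (norm_add_le _ _).trans ?_
  nlinarith [norm_nonneg z, mul_le_mul_of_nonneg_right h4 (norm_nonneg z)]

end FiniteRank

/-! ### The memory kernel. -/

section Kernel

/-- A positive decreasing integrable kernel `g` with derivative `-γ`, `0 ≤ γ ≤ c g`. -/
structure IsKernel (g γ : ℝ → ℝ) (c : ℝ) : Prop where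
  c_pos : 0 < c
  pos : ∀ s, 0 ≤ s → 0 < g s
  cont : ContinuousOn g (Ici 0)
  hasDerivAt : ∀ s, 0 < s → HasDerivAt g (-γ s) s
  cont_deriv : ContinuousOn γ (Ici 0)
  nonneg : ∀ s, 0 ≤ s → 0 ≤ γ s
  le : ∀ s, 0 ≤ s → γ s ≤ c * g s
  integrable : IntegrableOn g (Ioi 0)

theorem IsKernel.antitoneOn {g γ : ℝ → ℝ} {c : ℝ} (h : IsKernel g γ c) : AntitoneOn g (Ici 0) := by
  refine antitoneOn_of_deriv_nonpos (convex_Ici 0) h.cont ?_ ?_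
  · rw [interior_Ici]
    exact fun s hs => (h.hasDerivAt s hs).differentiableAt.differentiableWithinAt
  · rw [interior_Ici]
    intro s hs
    rw [(h.hasDerivAt s hs).deriv]
    linarith [h.nonneg s (le_of_lt hs)]

/-- Mean value inequality: on [s, s + δ] the derivative is bounded by c g, hence by c g(s) as g
decreases. The difference quotients of g are therefore dominated by c g, uniformly in δ. -/
theorem IsKernel.sub_le {g γ : ℝ → ℝ} {c : ℝ} (h : IsKernel g γ c) {s δ : ℝ} (hs : 0 < s)
    (hδ : 0 ≤ δ) : g s - g (s + δ) ≤ c * g s * δ := by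
  have h1 : ∀ r ∈ Icc s (s + δ), ‖-γ r‖ ≤ c * g s := by
    intro r hr
    have hr0 : 0 ≤ r := hs.le.trans hr.1
    rw [norm_neg, Real.norm_of_nonneg (h.nonneg r hr0)]
    exact (h.le r hr0).trans (mul_le_mul_of_nonneg_left (h.antitoneOn hs.le hr0 hr.1) h.c_pos.le)
  have h2 := (convex_Icc s (s + δ)).norm_image_sub_le_of_norm_hasDerivWithin_le (f := g)
    (fun r hr => (h.hasDerivAt r (hs.trans_le hr.1)).hasDerivWithinAt) h1
    (left_mem_Icc.2 (by linarith)) (right_mem_Icc.2 (by linarith))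
  rw [add_sub_cancel_left, Real.norm_of_nonneg hδ] at h2
  have h3 := (neg_le_abs _).trans h2
  linarith

theorem IsMemoryKernel.hasDerivAt {f : ℝ → ℝ} (hf : IsMemoryKernel f) {s : ℝ} (hs : 0 < s) :
    HasDerivAt f (-gker f s) s := by
  have h := (hf.contDiff.differentiableOn (by norm_num) s hs.le).hasDerivWithinAt
  rw [gker, neg_neg]
  exact h.hasDerivAt (Ici_mem_nhds hs)

theorem IsMemoryKernel.integral_Ioi {f : ℝ → ℝ} (hf : IsMemoryKernel f) {t : ℝ} (ht : 0 ≤ t) :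
    IntegrableOn (gker f) (Ioi t) ∧ ∫ s in Ioi t, gker f s = f t := by
  have hc : ContinuousWithinAt f (Ici t) t :=
    (hf.contDiff.continuousOn t ht).mono (Ici_subset_Ici.2 ht)
  have hd : ∀ x ∈ Ioi t, HasDerivAt f (-gker f x) x := fun x hx =>
    hf.hasDerivAt (lt_of_le_of_lt ht hx)
  have hn : ∀ x ∈ Ioi t, -gker f x ≤ 0 := fun x hx => by
    rw [gker, neg_neg]
    exact (hf.deriv_neg x (le_of_lt (lt_of_le_of_lt ht hx))).le
  refine ⟨?_, ?_⟩
  · simpa using (integrableOn_Ioi_deriv_of_nonpos hc hd hn hf.tendsto_zero).neg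
  · have := integral_Ioi_of_hasDerivAt_of_nonpos hc hd hn hf.tendsto_zero
    rw [integral_neg] at this
    linarith

/-- Here γ = -g' = f'', so the condition 0 ≤ f'' ≤ -c₀f' is the bound 0 ≤ γ ≤ c₀g, and integrability
of g is f(0) - f(∞) < ∞. -/
theorem IsMemoryKernel.exists_isKernel {f : ℝ → ℝ} (hf : IsMemoryKernel f) :
    ∃ c, IsKernel (gker f) (fun s => -derivWithin (gker f) (Ici 0) s) c := by
  obtain ⟨c, hc, hd2⟩ := hf.deriv2
  have hu : UniqueDiffOn ℝ (Ici (0 : ℝ)) := uniqueDiffOn_Ici 0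
  have hg1 : ContDiffOn ℝ 1 (gker f) (Ici 0) := by
    have h2 : ContDiffOn ℝ (1 + 1) f (Ici 0) := by
      have := hf.contDiff
      rwa [one_add_one_eq_two]
    exact ((contDiffOn_succ_iff_derivWithin hu).1 h2).2.2.neg
  have hder : ∀ s, -derivWithin (gker f) (Ici 0) s = iteratedDerivWithin 2 f (Ici 0) s := by
    intro s
    have e : gker f = fun s => -derivWithin f (Ici 0) s := rfl
    rw [e, derivWithin.fun_neg, neg_neg, iteratedDerivWithin_succ, iteratedDerivWithin_one]
  refine ⟨c, hc, fun s hs => neg_pos.2 (hf.deriv_neg s hs), hg1.continuousOn, fun s hs => ?_, ?_,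
    fun s hs => ?_, fun s hs => ?_, (hf.integral_Ioi le_rfl).1⟩
  · rw [neg_neg]
    exact (hg1.differentiableOn (by norm_num) s (le_of_lt hs)).hasDerivWithinAt.hasDerivAt
      (Ici_mem_nhds hs)
  · exact ((contDiffOn_one_iff_derivWithin hu).1 hg1).2.neg
  · rw [hder]
    exact (hd2 s hs).1
  · rw [hder]
    refine (hd2 s hs).2.trans (le_of_eq ?_)
    rw [gker]
    ring

end Kernel

end

end Kawahara

/-! ### The time-averaged equation in integrated form. -/

namespace Kawahara

noncomputable section

open scoped InnerProductSpace

variable {L : ℝ}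

/-- The memory source `∫_0^∞ g(s) ∂_x^k η(s) ds ∈ L²(I)`. -/
def memSource (L : ℝ) (k : ℕ) (g : ℝ → ℝ) (η : ℝ → L2 L) : L2 L :=
  ∫ s in Ioi 0, g s • wderiv L k (η s)

theorem integrable_smul_of_sq {E : Type*} [NormedAddCommGroup E] [NormedSpace ℝ E] {S : Set ℝ}
    (hS : MeasurableSet S) {g : ℝ → ℝ} {z : ℝ → E} (hg0 : ∀ s ∈ S, 0 ≤ g s) (hg : IntegrableOn g S)
    (hz : AEStronglyMeasurable z (volume.restrict S))
    (hz2 : IntegrableOn (fun s => g s * ‖z s‖ ^ 2) S) : IntegrableOn (fun s => g s • z s) S := by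
  refine Integrable.mono' (hg.add hz2) (hg.aestronglyMeasurable.smul hz) ?_
  filter_upwards [ae_restrict_mem hS] with s hs
  rw [norm_smul, Real.norm_of_nonneg (hg0 s hs), Pi.add_apply]
  have := hg0 s hs
  nlinarith [mul_nonneg this (sq_nonneg (‖z s‖ - 1)), mul_nonneg this (sq_nonneg ‖z s‖),
    mul_nonneg this (norm_nonneg (z s))]

theorem MemLg.integrable_smul {k : ℕ} {g γ : ℝ → ℝ} {c : ℝ} (hg : IsKernel g γ c)
    {η : ℝ → L2 L} (hη : MemLg L k g η) :
    IntegrableOn (fun s => g s • wderiv L k (η s)) (Ioi 0) :=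
  integrable_smul_of_sq measurableSet_Ioi (fun s hs => (hg.pos s (le_of_lt hs)).le) hg.integrable
    hη.measurable hη.integrable

/-- All terms become pairings with L² vectors that are continuous in time along a solution. The
condition φ'(0) = 0 gives φ' = Jφ'', which moves one derivative from u² onto the test function. -/
theorem weakRHS_eq [Fact (0 < L)] {a₀ a₁ : ℝ} {k : ℕ} {g γ : ℝ → ℝ} {c : ℝ} (hg : IsKernel g γ c)
    {v : L2 L} {η : ℝ → L2 L} (hη : MemLg L k g η) {φ : ℝ → ℝ}
    (hφ : ContDiff ℝ ((⊤ : ℕ∞) : WithTop ℕ∞) φ) (h0 : iteratedDeriv 1 φ 0 = 0) :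
    weakRHS L a₀ a₁ k g v η φ =
      ⟪v, derivClass L hφ 3 - a₀ • derivClass L hφ 5 + a₁ • derivClass L hφ 1⟫_ℝ
        + 1 / 2 * ⟪quadSource v, derivClass L hφ 2⟫_ℝ
        - ⟪memSource L k g η, derivClass L hφ k⟫_ℝ := by
  have h1 : ∫ x in Ioo 0 L, v x * (iteratedDeriv 3 φ x - a₀ * iteratedDeriv 5 φ x
      + a₁ * iteratedDeriv 1 φ x)
      = ⟪v, derivClass L hφ 3 - a₀ • derivClass L hφ 5 + a₁ • derivClass L hφ 1⟫_ℝ := by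
    have hi : ∀ j, IntegrableOn (fun x => v x * iteratedDeriv j φ x) (Ioo 0 L) := fun j => by
      refine (L2.integrable_mul v (derivClass L hφ j)).congr ?_
      filter_upwards [toL2_ae (L := L) (continuous_iteratedDeriv_of_smooth hφ j).continuousOn]
        with x hx
      rw [derivClass, hx]
    rw [inner_add_right, inner_sub_right, real_inner_smul_right, real_inner_smul_right,
      inner_derivClass, inner_derivClass, inner_derivClass, ← integral_const_mul,
      ← integral_const_mul, ← integral_sub (hi 3) ((hi 5).const_mul _)]
    refine Eq.trans ?_ (integral_add ((hi 3).sub ((hi 5).const_mul a₀)) ((hi 1).const_mul a₁))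
    congr 1
    ext x
    ring
  have h2 : ∫ x in Ioo 0 L, v x ^ 2 * iteratedDeriv 1 φ x
      = ⟪quadSource v, derivClass L hφ 2⟫_ℝ := by
    rw [inner_quadSource]
    refine setIntegral_congr_fun measurableSet_Ioo fun x hx => ?_
    have e := primitive_congr (toL2_ae (L := L)
      (continuous_iteratedDeriv_of_smooth hφ 2).continuousOn) (Ioo_subset_Icc_self hx)
    rw [integral_iteratedDeriv_succ hφ, h0, sub_zero] at e
    simp only [derivClass]
    rw [e]
  have h3 : ∫ s in Ioi 0, g s * ∫ x in Ioo 0 L, wderiv L k (η s) x * iteratedDeriv k φ x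
      = ⟪memSource L k g η, derivClass L hφ k⟫_ℝ := by
    rw [memSource, real_inner_comm, ← integral_inner (hη.integrable_smul hg)]
    refine setIntegral_congr_fun measurableSet_Ioi fun s _ => ?_
    rw [← inner_derivClass _ hφ, real_inner_smul_right, real_inner_comm]
  rw [weakRHS, h1, h2, h3]

variable [hL : Fact (0 < L)]

/-- Two integrations by parts; as J²Y vanishes to second order at both ends, the boundary values of
φ and its derivatives do not matter. -/
theorem IsSecondDeriv.inner_derivClass_add_two {Y : L2 L} (hY : IsSecondDeriv Y) {φ : ℝ → ℝ}
    (hφ : ContDiff ℝ ((⊤ : ℕ∞) : WithTop ℕ∞) φ) (j : ℕ) :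
    ⟪J (J Y), derivClass L hφ (j + 2)⟫_ℝ = ⟪Y, derivClass L hφ j⟫_ℝ := by
  have key : ∀ i, J (derivClass L hφ (i + 1)) = derivClass L hφ i
      - iteratedDeriv i φ 0 • (one : L2 L) := by
    intro i
    have hc : ContinuousOn (fun x => iteratedDeriv i φ x - iteratedDeriv i φ 0) (Icc 0 L) :=
      ((continuous_iteratedDeriv_of_smooth hφ i).sub continuous_const).continuousOn
    have e1 : J (derivClass L hφ (i + 1)) = toL2 _ hc := by
      rw [derivClass, J_toL2]
      exact toL2_congr _ _ fun x _ => integral_iteratedDeriv_succ hφ i x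
    rw [e1]
    apply Lp.ext
    filter_upwards [toL2_ae hc, Lp.coeFn_sub (derivClass L hφ i) (iteratedDeriv i φ 0 • (one : L2 L)),
      Lp.coeFn_smul (iteratedDeriv i φ 0) (one : L2 L),
      toL2_ae (L := L) (φ := fun _ => (1 : ℝ)) continuousOn_const,
      toL2_ae (L := L) (continuous_iteratedDeriv_of_smooth hφ i).continuousOn] with x h1 h2 h3 h4 h5
    rw [h1, h2, Pi.sub_apply, h3, Pi.smul_apply, one, h4, derivClass, h5, smul_eq_mul, mul_one]
  obtain ⟨h1, h2⟩ := hY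
  rw [inner_J_left, h2, key, inner_sub_right, real_inner_smul_right, real_inner_comm one (J Y), h2,
    inner_J_left, h1, key, inner_sub_right, real_inner_smul_right, real_inner_comm one Y, h1]
  ring

/-- The average of `F` over `[t, t + δ]`. -/
def steklov {E : Type*} [NormedAddCommGroup E] [NormedSpace ℝ E] (δ : ℝ) (F : ℝ → E) (t : ℝ) : E :=
  δ⁻¹ • ∫ τ in t..(t + δ), F τ

/-- The difference quotient of `F` with step `δ`. -/
def diffQuot {E : Type*} [NormedAddCommGroup E] [NormedSpace ℝ E] (δ : ℝ) (F : ℝ → E) (t : ℝ) : E :=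
  δ⁻¹ • (F (t + δ) - F t)

theorem intervalIntegrable_of_Ici {E : Type*} [NormedAddCommGroup E] {F : ℝ → E}
    (hF : ContinuousOn F (Ici 0)) {a b : ℝ} (ha : 0 ≤ a) (hb : 0 ≤ b) :
    IntervalIntegrable F volume a b :=
  (hF.mono fun _ hx => (le_min ha hb).trans hx.1).intervalIntegrable

omit hL in
theorem IsSolution.intervalIntegrable_wderiv {a₀ a₁ : ℝ} {k : ℕ} {g : ℝ → ℝ} {v₀ : L2 L}
    {η₀ u : ℝ → L2 L} (h : IsSolution L a₀ a₁ k g v₀ η₀ u) {j : ℕ} (hj : j ≤ 2) {a b : ℝ}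
    (ha : 0 ≤ a) (hb : 0 ≤ b) : IntervalIntegrable (fun t => wderiv L j (u t)) volume a b := by
  have h1 : IntegrableOn (fun t => wderiv L j (u t)) (Ioo 0 (max a b + 1)) :=
    (h.memL2H2 _ (by positivity) j hj).integrable (by norm_num)
  rw [intervalIntegrable_iff]
  refine h1.mono_set fun x hx => ?_
  rw [uIoc, mem_Ioc] at hx
  exact ⟨(le_min ha hb).trans_lt hx.1, hx.2.trans_lt (lt_add_one _)⟩

theorem ae_uIoc_of_Ioi {p : ℝ → Prop} (h : ∀ᵐ t ∂(volume.restrict (Ioi (0 : ℝ))), p t) {a b : ℝ}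
    (ha : 0 ≤ a) (hb : 0 ≤ b) : ∀ᵐ t ∂volume, t ∈ uIoc a b → p t := by
  rw [ae_restrict_iff' measurableSet_Ioi] at h
  filter_upwards [h] with t ht htm
  exact ht ((le_min ha hb).trans_lt (mem_Ioc.1 htm).1)

/-- The constraints defining H²_0(I) and the relations between derivatives are bounded linear ones,
so they survive time integration. -/
theorem integral_wderiv_mem {a₀ a₁ : ℝ} {k : ℕ} {g : ℝ → ℝ} {v₀ : L2 L}
    {η₀ u : ℝ → L2 L} (h : IsSolution L a₀ a₁ k g v₀ η₀ u) {a b : ℝ} (ha : 0 ≤ a) (hb : 0 ≤ b) :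
    IsSecondDeriv (∫ t in a..b, wderiv L 2 (u t)) ∧
      ∫ t in a..b, u t = J (J (∫ t in a..b, wderiv L 2 (u t))) ∧
      ∀ i j, i + j = 2 → ∫ t in a..b, wderiv L i (u t) = (J ^ j) (∫ t in a..b, wderiv L 2 (u t)) := by
  have hi := h.intervalIntegrable_wderiv le_rfl ha hb
  have hae := ae_uIoc_of_Ioi h.memH0 ha hb
  have hpow : ∀ i j, i + j = 2 →
      ∫ t in a..b, wderiv L i (u t) = (J ^ j) (∫ t in a..b, wderiv L 2 (u t)) := by
    intro i j hij
    rw [← ContinuousLinearMap.intervalIntegral_comp_comm _ hi]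
    refine intervalIntegral.integral_congr_ae ?_
    filter_upwards [hae] with t ht hm
    have := (ht hm).wderiv_eq_J_pow j (j := i) hij.le
    rwa [hij] at this
  refine ⟨⟨?_, ?_⟩, ?_, hpow⟩
  · have := ContinuousLinearMap.intervalIntegral_comp_comm (innerSL ℝ (one : L2 L)) hi
    simp only [innerSL_apply_apply] at this
    rw [← this]
    refine intervalIntegral.integral_zero_ae ?_
    filter_upwards [hae] with t ht hm
    exact (ht hm).isSecondDeriv.1
  · have := ContinuousLinearMap.intervalIntegral_comp_comm ((innerSL ℝ (one : L2 L)).comp J) hi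
    simp only [ContinuousLinearMap.comp_apply, innerSL_apply_apply] at this
    rw [← this]
    refine intervalIntegral.integral_zero_ae ?_
    filter_upwards [hae] with t ht hm
    exact (ht hm).isSecondDeriv.2
  · have := hpow 0 2 rfl
    simp only [wderiv_zero] at this
    exact this

omit hL in
theorem inner_intervalIntegral {c : L2 L} {F : ℝ → L2 L} {a b : ℝ}
    (hF : IntervalIntegrable F volume a b) : ⟪∫ t in a..b, F t, c⟫_ℝ = ∫ t in a..b, ⟪F t, c⟫_ℝ := by
  have := ContinuousLinearMap.intervalIntegral_comp_comm (innerSL ℝ c) hF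
  simp only [innerSL_apply_apply] at this
  rw [real_inner_comm, ← this]
  simp only [real_inner_comm]

omit hL in
theorem intervalIntegrable_inner {c : L2 L} {F : ℝ → L2 L} {a b : ℝ}
    (hF : IntervalIntegrable F volume a b) : IntervalIntegrable (fun t => ⟪F t, c⟫_ℝ) volume a b := by
  have : IntervalIntegrable (fun t => innerSL ℝ c (F t)) volume a b :=
    ⟨(innerSL ℝ c).integrable_comp hF.1, (innerSL ℝ c).integrable_comp hF.2⟩
  simpa only [innerSL_apply_apply, real_inner_comm] using this

theorem continuousOn_weakRHS {a₀ a₁ : ℝ} {k : ℕ} {g γ : ℝ → ℝ} {c : ℝ} (hg : IsKernel g γ c)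
    {v₀ : L2 L} {η₀ u : ℝ → L2 L} (h : IsSolution L a₀ a₁ k g v₀ η₀ u)
    (hm : ContinuousOn (fun t => memSource L k g (history u η₀ t)) (Ici 0)) {φ : ℝ → ℝ}
    (hφ : ContDiff ℝ ((⊤ : ℕ∞) : WithTop ℕ∞) φ) (h0 : iteratedDeriv 1 φ 0 = 0) :
    ContinuousOn (fun t => weakRHS L a₀ a₁ k g (u t) (history u η₀ t) φ) (Ici 0) := by
  have hu := h.cont
  have hq := continuous_quadSource.comp_continuousOn hu
  refine ContinuousOn.congr (f := fun t =>
    ⟪u t, derivClass L hφ 3 - a₀ • derivClass L hφ 5 + a₁ • derivClass L hφ 1⟫_ℝ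
        + 1 / 2 * ⟪quadSource (u t), derivClass L hφ 2⟫_ℝ
        - ⟪memSource L k g (history u η₀ t), derivClass L hφ k⟫_ℝ) ?_
    fun t ht => weakRHS_eq hg (h.memLg t ht) hφ h0
  exact ((hu.inner continuousOn_const).add (continuousOn_const.mul (hq.inner continuousOn_const))).sub
    (hm.inner continuousOn_const)

theorem IsSolution.inner_sub_eq {a₀ a₁ : ℝ} {k : ℕ} {g γ : ℝ → ℝ} {c : ℝ} (hg : IsKernel g γ c)
    {v₀ : L2 L} {η₀ u : ℝ → L2 L} (h : IsSolution L a₀ a₁ k g v₀ η₀ u)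
    (hm : ContinuousOn (fun t => memSource L k g (history u η₀ t)) (Ici 0)) {φ : ℝ → ℝ}
    (hφ : IsAdjointTest L φ) {a b : ℝ} (ha : 0 ≤ a) (hb : 0 ≤ b) :
    ⟪u b - u a, derivClass L hφ.smooth 0⟫_ℝ
      = ∫ t in a..b, weakRHS L a₀ a₁ k g (u t) (history u η₀ t) φ := by
  have hc := continuousOn_weakRHS hg h hm hφ.smooth hφ.deriv_left
  have h1 := h.equation φ hφ a ha
  have h2 := h.equation φ hφ b hb
  rw [inner_sub_left, inner_derivClass, inner_derivClass, iteratedDeriv_zero]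
  rw [← intervalIntegral.integral_interval_sub_left (intervalIntegrable_of_Ici hc le_rfl hb)
    (intervalIntegrable_of_Ici hc le_rfl ha), ← h1, ← h2]
  ring

/-- Test functions φ = J³χ satisfy all conditions at 0; those at L, φ(L) = φ'(L) = 0, are two moment
conditions on χ. A vector annihilated by every such χ lies in the span of the two moment functions,
which both vanish at L. That φ''(L) is free is what leaves no constant function in the span and so
encodes ∂_x²u(L) = 0. -/
theorem IsSolution.isResolvent {a₀ a₁ : ℝ} {k : ℕ} (hk : k ≤ 2) {g γ : ℝ → ℝ} {c : ℝ}
    (hg : IsKernel g γ c) {v₀ : L2 L} {η₀ u : ℝ → L2 L} (h : IsSolution L a₀ a₁ k g v₀ η₀ u)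
    (hm : ContinuousOn (fun t => memSource L k g (history u η₀ t)) (Ici 0)) {t δ : ℝ} (ht : 0 ≤ t)
    (hδ : 0 < δ) :
    IsResolvent a₀ a₁ (2 - k) (steklov δ (fun τ => wderiv L 2 (u τ)) t) (diffQuot δ u t)
      (steklov δ (fun τ => quadSource (u τ)) t)
      (steklov δ (fun τ => memSource L k g (history u η₀ τ)) t) := by
  have htδ : 0 ≤ t + δ := by linarith
  refine mem_span_of_forall_smooth fun χ hχ hV => ?_
  set D := derivClass L hχ 0
  have hψ := contDiff_primitive hχ
  have hψ₁ := contDiff_primitive hψ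
  have hφ := contDiff_primitive hψ₁
  set φ : ℝ → ℝ := fun x => ∫ r in (0 : ℝ)..x, ∫ r in (0 : ℝ)..r, ∫ r in (0 : ℝ)..r, χ r with hφdef
  have c3 : ∀ j, derivClass L hφ (j + 3) = derivClass L hχ j := by
    intro j
    simp only [derivClass]
    congr 1
    rw [iteratedDeriv_succ_primitive hψ₁, iteratedDeriv_succ_primitive hψ,
      iteratedDeriv_succ_primitive hχ]
  have z0 : iteratedDeriv 0 φ 0 = 0 := by simp [hφdef]
  have z1 : iteratedDeriv 1 φ 0 = 0 := by
    rw [hφdef, iteratedDeriv_succ_primitive hψ₁]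
    simp
  have z2 : iteratedDeriv 2 φ 0 = 0 := by
    rw [hφdef, iteratedDeriv_succ_primitive hψ₁, iteratedDeriv_succ_primitive hψ]
    simp
  have c2 : derivClass L hφ 2 = J D := by
    rw [← J_derivClass_succ hφ 2 z2, c3]
  have c1 : derivClass L hφ 1 = J (J D) := by
    rw [← J_derivClass_succ hφ 1 z1, c2]
  have c0 : derivClass L hφ 0 = J (J (J D)) := by
    rw [← J_derivClass_succ hφ 0 z0, c1]
  have w1 : iteratedDeriv 1 φ L = 0 := by
    have := inner_one_derivClass_succ hL.out.le hφ 1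
    rw [c2, hV.1, z1, sub_zero] at this
    exact this.symm
  have w0 : φ L = 0 := by
    have := inner_one_derivClass_succ hL.out.le hφ 0
    rw [c1, hV.2, z0, sub_zero, iteratedDeriv_zero] at this
    exact this.symm
  have hT : IsAdjointTest L φ := ⟨hφ, by rw [← iteratedDeriv_zero (f := φ), z0], w0, z1, w1, z2⟩
  have ck : derivClass L hφ k = J ((J ^ (2 - k)) D) := by
    interval_cases k
    · exact c0
    · exact c1
    · exact c2
  have hmain := h.inner_sub_eq hg hm hT ht htδ
  rw [c0] at hmain
  have hiy := h.intervalIntegrable_wderiv (j := 2) le_rfl ht htδ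
  have hiu := intervalIntegrable_of_Ici h.cont ht htδ
  have hiq := intervalIntegrable_of_Ici (continuous_quadSource.comp_continuousOn h.cont) ht htδ
  have him := intervalIntegrable_of_Ici hm ht htδ
  have hrhs : ∫ τ in t..(t + δ), weakRHS L a₀ a₁ k g (u τ) (history u η₀ τ) φ
      = ∫ τ in t..(t + δ), (⟪u τ, D⟫_ℝ - a₀ * ⟪wderiv L 2 (u τ), D⟫_ℝ + a₁ * ⟪u τ, J (J D)⟫_ℝ
        + 1 / 2 * ⟪quadSource (u τ), J D⟫_ℝ
        - ⟪memSource L k g (history u η₀ τ), J ((J ^ (2 - k)) D)⟫_ℝ) := by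
    refine intervalIntegral.integral_congr_ae ?_
    filter_upwards [ae_uIoc_of_Ioi h.memH0 ht htδ] with τ hτ hmτ
    have hτ0 : 0 ≤ τ := ht.trans (by
      rw [uIoc_of_le (by linarith)] at hmτ
      exact hmτ.1.le)
    have hH := hτ hmτ
    rw [weakRHS_eq hg (h.memLg τ hτ0) hφ z1, ck, c1, c2, c3 0, c3 2, inner_add_right,
      inner_sub_right, real_inner_smul_right, real_inner_smul_right]
    -- φ has fifth derivative χ''; both remaining derivatives return to u, which gives the pairing
    -- of ∂_x²u with χ.
    have e := hH.isSecondDeriv.inner_derivClass_add_two hχ 0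
    rw [← hH.eq_J_J] at e
    rw [e]
  have hsplit : ∫ τ in t..(t + δ), (⟪u τ, D⟫_ℝ - a₀ * ⟪wderiv L 2 (u τ), D⟫_ℝ
        + a₁ * ⟪u τ, J (J D)⟫_ℝ + 1 / 2 * ⟪quadSource (u τ), J D⟫_ℝ
        - ⟪memSource L k g (history u η₀ τ), J ((J ^ (2 - k)) D)⟫_ℝ)
      = ⟪∫ τ in t..(t + δ), u τ, D⟫_ℝ - a₀ * ⟪∫ τ in t..(t + δ), wderiv L 2 (u τ), D⟫_ℝ
        + a₁ * ⟪∫ τ in t..(t + δ), u τ, J (J D)⟫_ℝ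
        + 1 / 2 * ⟪∫ τ in t..(t + δ), quadSource (u τ), J D⟫_ℝ
        - ⟪∫ τ in t..(t + δ), memSource L k g (history u η₀ τ), J ((J ^ (2 - k)) D)⟫_ℝ := by
    have i1 := intervalIntegrable_inner (c := D) hiu
    have i2 := (intervalIntegrable_inner (c := D) hiy).const_mul a₀
    have i3 := (intervalIntegrable_inner (c := J (J D)) hiu).const_mul a₁
    have i4 := (intervalIntegrable_inner (c := J D) hiq).const_mul (1 / 2)
    have i5 := intervalIntegrable_inner (c := J ((J ^ (2 - k)) D)) him
    have e1 := intervalIntegral.integral_sub (((i1.sub i2).add i3).add i4) i5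
    have e2 := intervalIntegral.integral_add ((i1.sub i2).add i3) i4
    have e3 := intervalIntegral.integral_add (i1.sub i2) i3
    have e4 := intervalIntegral.integral_sub i1 i2
    rw [inner_intervalIntegral hiu, inner_intervalIntegral hiy, inner_intervalIntegral hiu,
      inner_intervalIntegral him]
    have e5 := inner_intervalIntegral (c := J D) hiq
    simp only [Function.comp_apply] at e5 e1 e2
    rw [e5]
    refine e1.trans ?_
    rw [e2, e3, e4]
    simp only [intervalIntegral.integral_const_mul]
  rw [hrhs, hsplit, (integral_wderiv_mem h ht htδ).2.1] at hmain
  have hcomm : (J ^ (2 - k)) (J D) = J ((J ^ (2 - k)) D) := by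
    rw [← mul_apply_eq_comp, ← mul_apply_eq_comp, ← pow_succ, pow_succ']
  simp only [steklov, diffQuot, map_smul, inner_add_left, inner_sub_left, real_inner_smul_left,
    inner_Jt, inner_Jt_pow, hcomm] at hmain ⊢
  linear_combination δ⁻¹ * hmain

end

end Kawahara

/-! ### Steklov averages and difference quotients in time. -/

namespace Kawahara

noncomputable section

open scoped InnerProductSpace

section Steklov

variable {E : Type*} [NormedAddCommGroup E] [NormedSpace ℝ E]

/-- Constant extension to negative times gives access to two-sided derivatives at every time;
forward averages taken at t ≥ 0 do not see the extension. -/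
theorem ContinuousOn.extend_Ici {F : ℝ → E} (hF : ContinuousOn F (Ici 0)) :
    Continuous fun t => F (max t 0) :=
  hF.comp_continuous (continuous_id.max continuous_const) fun _ => mem_Ici.2 (le_max_right _ _)

omit [NormedAddCommGroup E] [NormedSpace ℝ E] in
theorem eq_extend_Ici (F : ℝ → E) {t : ℝ} (ht : 0 ≤ t) : F (max t 0) = F t := by
  rw [max_eq_left ht]

theorem intervalIntegral_extend_Ici (F : ℝ → E) {a b : ℝ} (ha : 0 ≤ a) (hb : 0 ≤ b) :
    ∫ t in a..b, F (max t 0) = ∫ t in a..b, F t :=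
  intervalIntegral.integral_congr fun _ ht => eq_extend_Ici F ((le_min ha hb).trans ht.1)

theorem steklov_extend_Ici {δ : ℝ} (hδ : 0 ≤ δ) (F : ℝ → E) {t : ℝ} (ht : 0 ≤ t) :
    steklov δ (fun t => F (max t 0)) t = steklov δ F t := by
  rw [steklov, steklov, intervalIntegral_extend_Ici F ht (by linarith)]

theorem hasDerivAt_steklov [CompleteSpace E] {F : ℝ → E} (hF : Continuous F) (δ t : ℝ) :
    HasDerivAt (steklov δ F) (diffQuot δ F t) t := by
  have hd : ∀ x, HasDerivAt (fun x => ∫ τ in (0 : ℝ)..x, F τ) (F x) x := fun x =>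
    (hF.integral_hasStrictDerivAt 0 x).hasDerivAt
  have h2 := (((hd (t + δ)).comp_add_const t δ).sub (hd t)).const_smul δ⁻¹
  refine h2.congr_of_eventuallyEq (Eventually.of_forall fun x => ?_)
  simp only [steklov, Pi.smul_apply, Pi.sub_apply]
  rw [intervalIntegral.integral_interval_sub_left (hF.intervalIntegrable _ _)
    (hF.intervalIntegrable _ _)]

theorem continuousOn_steklov [CompleteSpace E] {F : ℝ → E} (hF : ContinuousOn F (Ici 0)) {δ : ℝ}
    (hδ : 0 ≤ δ) : ContinuousOn (steklov δ F) (Ici 0) := by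
  have h1 : Continuous (steklov δ fun t => F (max t 0)) :=
    continuous_iff_continuousAt.2 fun t =>
      (hasDerivAt_steklov (ContinuousOn.extend_Ici hF) δ t).continuousAt
  exact h1.continuousOn.congr fun t ht => (steklov_extend_Ici hδ F ht).symm

omit [NormedSpace ℝ E] in
/-- Uniform continuity on compact time intervals. -/
theorem eventually_forall_dist_le {F : ℝ → E} (hF : ContinuousOn F (Ici 0)) {a b : ℝ} (ha : 0 ≤ a)
    {ε : ℝ} (hε : 0 < ε) : ∀ᶠ δ in 𝓝[>] (0 : ℝ), ∀ t ∈ Icc a b, ∀ τ ∈ Icc t (t + δ),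
      ‖F t - F τ‖ ≤ ε := by
  have hu : UniformContinuousOn F (Icc a (b + 1)) :=
    isCompact_Icc.uniformContinuousOn_of_continuous (hF.mono fun x hx => ha.trans hx.1)
  obtain ⟨η, hη, h⟩ := Metric.uniformContinuousOn_iff.1 hu ε hε
  filter_upwards [Ioo_mem_nhdsGT (lt_min hη one_pos)] with δ hδ t ht τ hτ
  have h1 : δ < η := hδ.2.trans_le (min_le_left _ _)
  have h2 : δ < 1 := hδ.2.trans_le (min_le_right _ _)
  have := h t ⟨ht.1, by linarith [ht.2]⟩ τ ⟨ht.1.trans hτ.1, by linarith [ht.2, hτ.2]⟩ (by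
    rw [Real.dist_eq, abs_sub_lt_iff]
    constructor <;> linarith [hτ.1, hτ.2])
  rw [← dist_eq_norm]
  exact this.le

theorem norm_steklov_sub_le [CompleteSpace E] {F : ℝ → E} {δ t ε : ℝ} (hδ : 0 < δ) {c : E}
    (hF : IntervalIntegrable F volume t (t + δ)) (h : ∀ τ ∈ Icc t (t + δ), ‖F τ - c‖ ≤ ε) :
    ‖steklov δ F t - c‖ ≤ ε := by
  have e : steklov δ F t - c = δ⁻¹ • ∫ τ in t..(t + δ), (F τ - c) := by
    rw [intervalIntegral.integral_sub hF intervalIntegrable_const, steklov, smul_sub,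
      intervalIntegral.integral_const, add_sub_cancel_left, inv_smul_smul₀ hδ.ne']
  have h1 : ‖∫ τ in t..(t + δ), (F τ - c)‖ ≤ ε * |t + δ - t| := by
    refine intervalIntegral.norm_integral_le_of_norm_le_const fun τ hτ => h τ ?_
    rw [uIoc_of_le (by linarith)] at hτ
    exact Ioc_subset_Icc_self hτ
  rw [add_sub_cancel_left, abs_of_pos hδ] at h1
  rw [e, norm_smul, Real.norm_of_nonneg (by positivity)]
  calc δ⁻¹ * _ ≤ δ⁻¹ * (ε * δ) := by gcongr
    _ = ε := by field_simp

theorem tendsto_steklov [CompleteSpace E] {F : ℝ → E} (hF : ContinuousOn F (Ici 0)) {t : ℝ}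
    (ht : 0 ≤ t) : Tendsto (fun δ => steklov δ F t) (𝓝[>] 0) (𝓝 (F t)) := by
  rw [Metric.tendsto_nhds]
  intro ε hε
  filter_upwards [eventually_forall_dist_le hF ht (half_pos hε) (b := t), self_mem_nhdsWithin]
    with δ h hδ
  rw [dist_eq_norm]
  refine (norm_steklov_sub_le hδ (intervalIntegrable_of_Ici hF ht (by linarith [mem_Ioi.1 hδ]))
    fun τ hτ => ?_).trans_lt (half_lt_self hε)
  rw [norm_sub_rev]
  exact h t ⟨le_rfl, le_rfl⟩ τ hτ

/-- After the shift t ↦ t + δ the integrals cancel except on the end intervals [b, b + δ] and [a, a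
+ δ]. -/
theorem integral_diffQuot {Q : ℝ → E} (hQ : ContinuousOn Q (Ici 0)) {a b δ : ℝ}
    (ha : 0 ≤ a) (hab : a ≤ b) (hδ : 0 < δ) :
    ∫ t in a..b, diffQuot δ Q t = steklov δ Q b - steklov δ Q a := by
  have hi : ∀ {x y : ℝ}, 0 ≤ x → 0 ≤ y → IntervalIntegrable Q volume x y := fun hx hy =>
    intervalIntegrable_of_Ici hQ hx hy
  have hb := ha.trans hab
  have h1 : IntervalIntegrable (fun t => Q (t + δ)) volume a b := by
    have := (hi (show 0 ≤ a + δ by linarith) (show 0 ≤ b + δ by linarith)).comp_add_right δ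
    simpa using this
  simp only [diffQuot, steklov]
  rw [intervalIntegral.integral_smul, intervalIntegral.integral_sub h1 (hi ha hb),
    intervalIntegral.integral_comp_add_right, ← smul_sub]
  congr 1
  have e1 := intervalIntegral.integral_add_adjacent_intervals
    (hi ha (show 0 ≤ a + δ by linarith)) (hi (show 0 ≤ a + δ by linarith) (show 0 ≤ b + δ by linarith))
  have e2 := intervalIntegral.integral_add_adjacent_intervals
    (hi ha hb) (hi hb (show 0 ≤ b + δ by linarith))
  rw [sub_eq_sub_iff_add_eq_add, add_comm, e1, ← e2, add_comm]

theorem tendsto_integral_diffQuot [CompleteSpace E] {Q : ℝ → E} (hQ : ContinuousOn Q (Ici 0))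
    {a b : ℝ} (ha : 0 ≤ a) (hab : a ≤ b) :
    Tendsto (fun δ => ∫ t in a..b, diffQuot δ Q t) (𝓝[>] 0) (𝓝 (Q b - Q a)) := by
  refine ((tendsto_steklov hQ (ha.trans hab)).sub (tendsto_steklov hQ ha)).congr' ?_
  filter_upwards [self_mem_nhdsWithin] with δ hδ
  exact (integral_diffQuot hQ ha hab hδ).symm

/-- `F` is integrable on all bounded subintervals of `[0, ∞)`. -/
def LocInt (F : ℝ → E) : Prop := ∀ ⦃a b : ℝ⦄, 0 ≤ a → 0 ≤ b → IntervalIntegrable F volume a b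

theorem LocInt.continuousOn_primitive {F : ℝ → E} (hF : LocInt F) :
    ContinuousOn (fun t => ∫ τ in (0 : ℝ)..t, F τ) (Ici 0) := by
  intro t ht
  have ht0 : (0 : ℝ) ≤ t := ht
  have h1 : IntegrableOn F (uIcc 0 (t + 1)) := by
    rw [uIcc_of_le (by linarith), integrableOn_Icc_iff_integrableOn_Ioc,
      ← intervalIntegrable_iff_integrableOn_Ioc_of_le (by linarith)]
    exact hF le_rfl (by linarith)
  have h2 := intervalIntegral.continuousOn_primitive_interval h1
  rw [uIcc_of_le (by linarith)] at h2
  refine (h2 t ⟨ht, by linarith⟩).mono_of_mem_nhdsWithin ?_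
  rw [← Ici_inter_Iic]
  exact inter_mem self_mem_nhdsWithin (mem_nhdsWithin_of_mem_nhds (Iic_mem_nhds (by linarith)))

theorem LocInt.steklov_eq {F : ℝ → E} (hF : LocInt F) {δ t : ℝ} (hδ : 0 < δ) (ht : 0 ≤ t) :
    steklov δ F t = diffQuot δ (fun t => ∫ τ in (0 : ℝ)..t, F τ) t := by
  rw [steklov, diffQuot, intervalIntegral.integral_interval_sub_left (hF le_rfl (by linarith))
    (hF le_rfl ht)]

theorem LocInt.continuousOn_steklov {F : ℝ → E} (hF : LocInt F) {δ : ℝ} (hδ : 0 < δ) :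
    ContinuousOn (steklov δ F) (Ici 0) := by
  have h := hF.continuousOn_primitive
  refine ContinuousOn.congr (f := diffQuot δ fun t => ∫ τ in (0 : ℝ)..t, F τ) ?_
    fun t ht => hF.steklov_eq hδ ht
  refine ContinuousOn.const_smul (ContinuousOn.sub ?_ h) δ⁻¹
  refine h.comp (by fun_prop) fun t ht => ?_
  have : (0 : ℝ) ≤ t := ht
  exact add_nonneg this hδ.le

theorem LocInt.tendsto_integral_steklov [CompleteSpace E] {F : ℝ → E} (hF : LocInt F) {a b : ℝ}
    (ha : 0 ≤ a) (hab : a ≤ b) : Tendsto (fun δ => ∫ t in a..b, steklov δ F t) (𝓝[>] 0)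
      (𝓝 (∫ t in a..b, F t)) := by
  have hb := ha.trans hab
  have h1 := tendsto_integral_diffQuot hF.continuousOn_primitive ha hab
  rw [intervalIntegral.integral_interval_sub_left (hF le_rfl hb) (hF le_rfl ha)] at h1
  refine h1.congr' ?_
  filter_upwards [self_mem_nhdsWithin] with δ hδ
  refine intervalIntegral.integral_congr fun t ht => ?_
  rw [uIcc_of_le hab] at ht
  exact (hF.steklov_eq hδ (ha.trans ht.1)).symm

end Steklov

section Hilbert

variable {E : Type*} [NormedAddCommGroup E] [InnerProductSpace ℝ E] [CompleteSpace E]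

omit [CompleteSpace E] in
theorem LocInt.inner {F r : ℝ → E} (hF : ContinuousOn F (Ici 0)) (hr : LocInt r) :
    LocInt fun t => ⟪F t, r t⟫_ℝ := by
  intro a b ha hb
  have hc : ContinuousOn F (uIcc a b) := hF.mono fun x hx => (le_min ha hb).trans hx.1
  obtain ⟨C, hC⟩ := isCompact_uIcc.exists_bound_of_continuousOn hc
  rw [intervalIntegrable_iff]
  refine Integrable.mono' ((intervalIntegrable_iff.1 (hr ha hb)).norm.const_mul C) ?_ ?_
  · exact ((hc.mono uIoc_subset_uIcc).aestronglyMeasurable measurableSet_uIoc).inner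
      (intervalIntegrable_iff.1 (hr ha hb)).aestronglyMeasurable
  · filter_upwards [ae_restrict_mem measurableSet_uIoc] with t ht
    refine (norm_inner_le_norm _ _).trans ?_
    exact mul_le_mul_of_nonneg_right (hC t (uIoc_subset_uIcc ht)) (norm_nonneg _)

/-- Products of locally uniform approximations of `F` with averages of `r`. -/
theorem tendsto_integral_inner_steklov {F r : ℝ → E} (hF : ContinuousOn F (Ici 0))
    (hr : LocInt r) {a b : ℝ} (ha : 0 ≤ a) (hab : a ≤ b) {G : ℝ → ℝ → E}
    (hGc : ∀ δ, 0 < δ → ContinuousOn (G δ) (Ici 0))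
    (hG : ∀ ε, 0 < ε → ∀ᶠ δ in 𝓝[>] (0 : ℝ), ∀ t ∈ Icc a b, ‖G δ t - F t‖ ≤ ε) :
    Tendsto (fun δ => ∫ t in a..b, ⟪G δ t, steklov δ r t⟫_ℝ) (𝓝[>] 0)
      (𝓝 (∫ t in a..b, ⟪F t, r t⟫_ℝ)) := by
  have hb := ha.trans hab
  have h1 := (LocInt.inner hF hr).tendsto_integral_steklov ha hab
  have hn : LocInt fun t => ‖r t‖ := fun a b ha hb => (hr ha hb).norm
  have h2 := hn.tendsto_integral_steklov ha hab
  set B := ∫ t in a..b, ‖r t‖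
  have hB : 0 ≤ B := intervalIntegral.integral_nonneg hab fun _ _ => norm_nonneg _
  -- Move F inside the average: ⟪G, avg r⟫ and avg ⟪F, r⟫ differ by at most the uniform error of G
  -- plus the oscillation of F, times avg ‖r‖, whose time integral eventually stays below B + 1.
  have key : ∀ ε, 0 < ε → ∀ᶠ δ in 𝓝[>] (0 : ℝ), ‖(∫ t in a..b, ⟪G δ t, steklov δ r t⟫_ℝ)
      - ∫ t in a..b, steklov δ (fun t => ⟪F t, r t⟫_ℝ) t‖ ≤ ε := by
    intro ε hε
    have hη : 0 < ε / (2 * (B + 1)) := by positivity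
    filter_upwards [hG _ hη, eventually_forall_dist_le hF ha hη (b := b), self_mem_nhdsWithin,
      h2.eventually_le_const (lt_add_one B)] with δ g1 g2 hδ g3
    have hδ0 : 0 < δ := hδ
    have hI : ∀ {f : ℝ → ℝ}, ContinuousOn f (Ici 0) → IntervalIntegrable f volume a b := fun hf =>
      intervalIntegrable_of_Ici hf ha hb
    rw [← intervalIntegral.integral_sub (hI ((hGc δ hδ).inner (hr.continuousOn_steklov hδ)))
      (hI ((LocInt.inner hF hr).continuousOn_steklov hδ))]
    have hpt : ∀ t ∈ Icc a b, ‖⟪G δ t, steklov δ r t⟫_ℝ - steklov δ (fun t => ⟪F t, r t⟫_ℝ) t‖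
        ≤ ε / (B + 1) * steklov δ (fun t => ‖r t‖) t := by
      intro t ht
      have ht0 := ha.trans ht.1
      have htδ : 0 ≤ t + δ := by linarith
      have hrt := hr ht0 htδ
      have e1 : ⟪G δ t, ∫ τ in t..(t + δ), r τ⟫_ℝ = ∫ τ in t..(t + δ), ⟪G δ t, r τ⟫_ℝ := by
        have := ContinuousLinearMap.intervalIntegral_comp_comm (innerSL ℝ (G δ t)) hrt
        simp only [innerSL_apply_apply] at this
        exact this.symm
      have i1 : IntervalIntegrable (fun τ => ⟪G δ t, r τ⟫_ℝ) volume t (t + δ) :=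
        LocInt.inner continuousOn_const hr ht0 htδ
      rw [steklov, steklov, steklov, real_inner_smul_right, e1, smul_eq_mul, ← mul_sub,
        ← intervalIntegral.integral_sub i1 (LocInt.inner hF hr ht0 htδ), norm_mul,
        Real.norm_of_nonneg (by positivity), smul_eq_mul, mul_left_comm]
      refine mul_le_mul_of_nonneg_left ?_ (by positivity)
      rw [← intervalIntegral.integral_const_mul]
      refine intervalIntegral.norm_integral_le_of_norm_le (by linarith) (ae_of_all _ fun τ hτ => ?_)
        (hrt.norm.const_mul _)
      rw [← inner_sub_left]
      refine (norm_inner_le_norm _ _).trans (mul_le_mul_of_nonneg_right ?_ (norm_nonneg _))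
      have e2 : G δ t - F τ = (G δ t - F t) + (F t - F τ) := by abel
      rw [e2]
      refine (norm_add_le _ _).trans ((add_le_add (g1 t ht)
        (g2 t ht τ (Ioc_subset_Icc_self hτ))).trans (le_of_eq ?_))
      field_simp
      ring
    refine (intervalIntegral.norm_integral_le_of_norm_le hab (ae_of_all _ fun t ht =>
      hpt t (Ioc_subset_Icc_self ht)) ((hI (hn.continuousOn_steklov hδ)).const_mul _)).trans ?_
    rw [intervalIntegral.integral_const_mul]
    calc ε / (B + 1) * _ ≤ ε / (B + 1) * (B + 1) := by gcongr
      _ = ε := div_mul_cancel₀ _ (by positivity)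
  have h3 : Tendsto (fun δ => (∫ t in a..b, ⟪G δ t, steklov δ r t⟫_ℝ)
      - ∫ t in a..b, steklov δ (fun t => ⟪F t, r t⟫_ℝ) t) (𝓝[>] 0) (𝓝 0) := by
    rw [Metric.tendsto_nhds]
    intro ε hε
    filter_upwards [key (ε / 2) (half_pos hε)] with δ h
    rw [dist_zero_right]
    exact h.trans_lt (half_lt_self hε)
  simpa using h3.add h1

theorem eventually_norm_steklov_sub_le {F : ℝ → E} (hF : ContinuousOn F (Ici 0)) {a b : ℝ}
    (ha : 0 ≤ a) {ε : ℝ} (hε : 0 < ε) :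
    ∀ᶠ δ in 𝓝[>] (0 : ℝ), ∀ t ∈ Icc a b, ‖steklov δ F t - F t‖ ≤ ε := by
  filter_upwards [eventually_forall_dist_le hF ha hε (b := b), self_mem_nhdsWithin] with δ h hδ t ht
  refine norm_steklov_sub_le hδ (intervalIntegrable_of_Ici hF (ha.trans ht.1)
    (by linarith [mem_Ioi.1 hδ, ha.trans ht.1])) fun τ hτ => ?_
  rw [norm_sub_rev]
  exact h t ht τ hτ

/-- `d/dt ½⟨w, Bw⟩ = ⟨w', Bw⟩` for the average `w` of `F` and a symmetric operator `B`. -/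
theorem integral_inner_diffQuot {F : ℝ → E} (hF : ContinuousOn F (Ici 0)) (B : E →L[ℝ] E)
    (hB : ∀ x y, ⟪B x, y⟫_ℝ = ⟪x, B y⟫_ℝ) {a b δ : ℝ} (ha : 0 ≤ a) (hab : a ≤ b) (hδ : 0 < δ) :
    ∫ t in a..b, ⟪diffQuot δ F t, B (steklov δ F t)⟫_ℝ
      = 1 / 2 * ⟪steklov δ F b, B (steklov δ F b)⟫_ℝ
        - 1 / 2 * ⟪steklov δ F a, B (steklov δ F a)⟫_ℝ := by
  set F' : ℝ → E := fun t => F (max t 0)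
  have hF' : Continuous F' := ContinuousOn.extend_Ici hF
  have hw : Continuous (steklov δ F') := continuous_iff_continuousAt.2 fun t =>
    (hasDerivAt_steklov hF' δ t).continuousAt
  have hd : ∀ t, HasDerivAt (fun t => 1 / 2 * ⟪steklov δ F' t, B (steklov δ F' t)⟫_ℝ)
      ⟪diffQuot δ F' t, B (steklov δ F' t)⟫_ℝ t := by
    intro t
    have h1 := hasDerivAt_steklov hF' δ t
    have h2 := (h1.inner ℝ (B.hasFDerivAt.comp_hasDerivAt t h1)).const_mul (1 / 2 : ℝ)
    convert! h2 using 1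
    have e : ⟪steklov δ F' t, B (diffQuot δ F' t)⟫_ℝ = ⟪diffQuot δ F' t, B (steklov δ F' t)⟫_ℝ := by
      rw [← hB, real_inner_comm]
    simp only [Function.comp_apply]
    rw [e]
    ring
  have hc : Continuous fun t => ⟪diffQuot δ F' t, B (steklov δ F' t)⟫_ℝ := by
    unfold diffQuot
    fun_prop
  have h := intervalIntegral.integral_eq_sub_of_hasDerivAt (fun t _ => hd t)
    (hc.intervalIntegrable a b)
  rw [steklov_extend_Ici hδ.le F ha, steklov_extend_Ici hδ.le F (ha.trans hab)] at h
  rw [← h]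
  refine intervalIntegral.integral_congr fun t ht => ?_
  rw [uIcc_of_le hab] at ht
  have ht0 := ha.trans ht.1
  simp only [diffQuot, F']
  rw [steklov_extend_Ici hδ.le F ht0, eq_extend_Ici F ht0,
    eq_extend_Ici F (show 0 ≤ t + δ by linarith)]

end Hilbert

end

end Kawahara

/-! ### Curves in weighted L² spaces over the history variable. -/

namespace Kawahara

noncomputable section

open scoped InnerProductSpace

section Weighted

variable {E : Type*} [NormedAddCommGroup E] [InnerProductSpace ℝ E] [CompleteSpace E]

/-- A continuous curve `t ↦ z t` in the space `L²(g ds; E)` on `(0, ∞)`. -/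
structure IsCurve (g : ℝ → ℝ) (z : ℝ → ℝ → E) : Prop where
  meas : ∀ t, 0 ≤ t → AEStronglyMeasurable (z t) (volume.restrict (Ioi 0))
  int : ∀ t, 0 ≤ t → IntegrableOn (fun s => g s * ‖z t s‖ ^ 2) (Ioi 0)
  cont : ∀ t, 0 ≤ t → Tendsto (fun r => ∫ s in Ioi 0, g s * ‖z r s - z t s‖ ^ 2) (𝓝[Ici 0] t) (𝓝 0)

/-- A measurable weight `ω` on `(0, ∞)` with `0 ≤ ω ≤ C g`. -/
structure IsWeight (g ω : ℝ → ℝ) (C : ℝ) : Prop where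
  C_nonneg : 0 ≤ C
  meas : AEStronglyMeasurable ω (volume.restrict (Ioi 0))
  nonneg : ∀ s, 0 < s → 0 ≤ ω s
  le : ∀ s, 0 < s → ω s ≤ C * g s

variable {g γ ω : ℝ → ℝ} {c C : ℝ} {z : ℝ → ℝ → E}

omit [CompleteSpace E] in
theorem integrable_weight_sq (hω : IsWeight g ω C) {x : ℝ → E}
    (hx : AEStronglyMeasurable x (volume.restrict (Ioi 0)))
    (hx2 : IntegrableOn (fun s => g s * ‖x s‖ ^ 2) (Ioi 0)) :
    IntegrableOn (fun s => ω s * ‖x s‖ ^ 2) (Ioi 0) := by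
  refine Integrable.mono' (hx2.const_mul C) (hω.meas.mul (hx.norm.pow 2)) ?_
  filter_upwards [ae_restrict_mem measurableSet_Ioi] with s hs
  rw [norm_mul, Real.norm_of_nonneg (hω.nonneg s hs), Real.norm_of_nonneg (sq_nonneg _), ← mul_assoc]
  exact mul_le_mul_of_nonneg_right (hω.le s hs) (sq_nonneg _)

omit [CompleteSpace E] in
theorem integral_weight_sq_le (hω : IsWeight g ω C) {x : ℝ → E}
    (hx : AEStronglyMeasurable x (volume.restrict (Ioi 0)))
    (hx2 : IntegrableOn (fun s => g s * ‖x s‖ ^ 2) (Ioi 0)) :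
    ∫ s in Ioi 0, ω s * ‖x s‖ ^ 2 ≤ C * ∫ s in Ioi 0, g s * ‖x s‖ ^ 2 := by
  rw [← integral_const_mul]
  refine setIntegral_mono_on (integrable_weight_sq hω hx hx2) (hx2.const_mul C) measurableSet_Ioi
    fun s hs => ?_
  rw [← mul_assoc]
  exact mul_le_mul_of_nonneg_right (hω.le s hs) (sq_nonneg _)

omit [CompleteSpace E] in
theorem integrable_sq_sub (hg : IsKernel g γ c) {x y : ℝ → E}
    (hx : AEStronglyMeasurable x (volume.restrict (Ioi 0)))
    (hx2 : IntegrableOn (fun s => g s * ‖x s‖ ^ 2) (Ioi 0))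
    (hy : AEStronglyMeasurable y (volume.restrict (Ioi 0)))
    (hy2 : IntegrableOn (fun s => g s * ‖y s‖ ^ 2) (Ioi 0)) :
    IntegrableOn (fun s => g s * ‖x s - y s‖ ^ 2) (Ioi 0) := by
  refine Integrable.mono' ((hx2.const_mul 2).add (hy2.const_mul 2))
    (hg.integrable.aestronglyMeasurable.mul ((hx.sub hy).norm.pow 2)) ?_
  filter_upwards [ae_restrict_mem measurableSet_Ioi] with s hs
  have hgs := (hg.pos s (le_of_lt hs)).le
  rw [norm_mul, Real.norm_of_nonneg hgs, Real.norm_of_nonneg (sq_nonneg _), Pi.add_apply]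
  have h1 : ‖x s - y s‖ ^ 2 ≤ 2 * ‖x s‖ ^ 2 + 2 * ‖y s‖ ^ 2 := by
    have := norm_sub_le (x s) (y s)
    nlinarith [norm_nonneg (x s - y s), sq_nonneg (‖x s‖ - ‖y s‖)]
  nlinarith [mul_le_mul_of_nonneg_left h1 hgs]

omit [InnerProductSpace ℝ E] [CompleteSpace E] in
theorem abs_sq_sub_sq_le (a b : E) {θ : ℝ} (hθ : 0 < θ) :
    |‖a‖ ^ 2 - ‖b‖ ^ 2| ≤ (1 + 1 / θ) * ‖a - b‖ ^ 2 + θ * ‖b‖ ^ 2 := by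
  have h1 : ‖a‖ ≤ ‖a - b‖ + ‖b‖ := by
    simpa using norm_add_le (a - b) b
  have h2 : ‖b‖ ≤ ‖a - b‖ + ‖a‖ := by
    rw [norm_sub_rev]
    simpa using norm_add_le (b - a) a
  have h3 : 2 * ‖a - b‖ * ‖b‖ ≤ 1 / θ * ‖a - b‖ ^ 2 + θ * ‖b‖ ^ 2 := by
    have : 1 / θ * ‖a - b‖ ^ 2 + θ * ‖b‖ ^ 2 - 2 * ‖a - b‖ * ‖b‖ = (‖a - b‖ - θ * ‖b‖) ^ 2 / θ := by
      field_simp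
      ring
    have h4 : 0 ≤ (‖a - b‖ - θ * ‖b‖) ^ 2 / θ := by positivity
    linarith
  rw [abs_le]
  have := norm_nonneg (a - b)
  have := norm_nonneg a
  have := norm_nonneg b
  constructor
  · nlinarith
  · nlinarith

omit [CompleteSpace E] in
theorem IsCurve.continuousOn_sq (hz : IsCurve g z) (hg : IsKernel g γ c) (hω : IsWeight g ω C) :
    ContinuousOn (fun t => ∫ s in Ioi 0, ω s * ‖z t s‖ ^ 2) (Ici 0) := by
  intro t ht
  rw [ContinuousWithinAt, Metric.tendsto_nhds]
  intro ε hε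
  set M := ∫ s in Ioi 0, g s * ‖z t s‖ ^ 2
  have hM : 0 ≤ M := setIntegral_nonneg measurableSet_Ioi fun s hs =>
    mul_nonneg (hg.pos s (le_of_lt hs)).le (sq_nonneg _)
  have hC := hω.C_nonneg
  -- θ makes the term with ‖z t‖² at most ε/2; the distance between the two times is then adjusted
  -- to the large factor 1 + 1/θ.
  set θ := ε / (2 * (C * M + 1))
  have hθ : 0 < θ := by positivity
  have hη : 0 < ε / (2 * (C * (1 + 1 / θ) + 1)) := by positivity
  filter_upwards [(hz.cont t ht).eventually_lt_const hη, self_mem_nhdsWithin] with r hr hr0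
  set D := ∫ s in Ioi 0, g s * ‖z r s - z t s‖ ^ 2
  have hD : 0 ≤ D := setIntegral_nonneg measurableSet_Ioi fun s hs =>
    mul_nonneg (hg.pos s (le_of_lt hs)).le (sq_nonneg _)
  have i1 := integrable_weight_sq hω (hz.meas r hr0) (hz.int r hr0)
  have i2 := integrable_weight_sq hω (hz.meas t ht) (hz.int t ht)
  have i3 := integrable_sq_sub hg (hz.meas r hr0) (hz.int r hr0) (hz.meas t ht) (hz.int t ht)
  rw [Real.dist_eq, ← integral_sub i1 i2]
  have h1 : |∫ s in Ioi 0, (ω s * ‖z r s‖ ^ 2 - ω s * ‖z t s‖ ^ 2)|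
      ≤ ∫ s in Ioi 0, (C * (1 + 1 / θ) * (g s * ‖z r s - z t s‖ ^ 2)
        + C * θ * (g s * ‖z t s‖ ^ 2)) := by
    refine (abs_integral_le_integral_abs).trans ?_
    refine setIntegral_mono_on (i1.sub i2).abs
      ((i3.const_mul _).add ((hz.int t ht).const_mul _)) measurableSet_Ioi fun s hs => ?_
    rw [← mul_sub, abs_mul, abs_of_nonneg (hω.nonneg s hs)]
    have h2 := mul_le_mul (hω.le s hs) (abs_sq_sub_sq_le (z r s) (z t s) hθ) (abs_nonneg _)
      (mul_nonneg hC (hg.pos s (le_of_lt hs)).le)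
    linarith
  rw [integral_add (i3.const_mul _) ((hz.int t ht).const_mul _), integral_const_mul,
    integral_const_mul] at h1
  refine h1.trans_lt ?_
  have h2 : C * (1 + 1 / θ) * D < ε / 2 := by
    have h3 : C * (1 + 1 / θ) * D ≤ (C * (1 + 1 / θ) + 1) * D := by nlinarith
    refine h3.trans_lt ?_
    have hp : 0 < C * (1 + 1 / θ) + 1 := by positivity
    calc (C * (1 + 1 / θ) + 1) * D < (C * (1 + 1 / θ) + 1) * (ε / (2 * (C * (1 + 1 / θ) + 1))) := by
          gcongr
      _ = ε / 2 := by field_simp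
  have h4 : C * θ * M ≤ ε / 2 := by
    calc C * θ * M ≤ (C * M + 1) * θ := by nlinarith
      _ = ε / 2 := by
        simp only [θ]
        field_simp
  linarith

omit [CompleteSpace E] in
theorem norm_integral_weight_sq_le (hg : IsKernel g γ c) (hω : IsWeight g ω C) {x : ℝ → E}
    (hx : AEStronglyMeasurable x (volume.restrict (Ioi 0)))
    (hx2 : IntegrableOn (fun s => g s * ‖x s‖ ^ 2) (Ioi 0)) :
    ‖∫ s in Ioi 0, ω s • x s‖ ^ 2
      ≤ C ^ 2 * (∫ s in Ioi 0, g s) * ∫ s in Ioi 0, g s * ‖x s‖ ^ 2 := by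
  have hgn : ∀ s ∈ Ioi (0 : ℝ), 0 ≤ g s := fun s hs => (hg.pos s (le_of_lt hs)).le
  have i1 : IntegrableOn (fun s => g s * ‖x s‖) (Ioi 0) := by
    have := integrable_smul_of_sq measurableSet_Ioi hgn hg.integrable hx.norm (by simpa using hx2)
    exact this
  set A := ∫ s in Ioi 0, g s * ‖x s‖ ^ 2
  set B := ∫ s in Ioi 0, g s * ‖x s‖
  set F := ∫ s in Ioi 0, g s
  have hF : 0 < F := by
    refine (setIntegral_pos_iff_support_of_nonneg_ae ?_ hg.integrable).2 ?_
    · filter_upwards [ae_restrict_mem measurableSet_Ioi] with s hs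
      exact hgn s hs
    · have : Function.support g ∩ Ioi 0 = Ioi 0 :=
        inter_eq_right.2 fun s hs => (hg.pos s (le_of_lt hs)).ne'
      rw [this]
      simp
  have hB : 0 ≤ B := setIntegral_nonneg measurableSet_Ioi fun s hs =>
    mul_nonneg (hgn s hs) (norm_nonneg _)
  have h1 : ‖∫ s in Ioi 0, ω s • x s‖ ≤ C * B := by
    rw [← integral_const_mul]
    refine norm_integral_le_of_norm_le (i1.const_mul C) ?_
    filter_upwards [ae_restrict_mem measurableSet_Ioi] with s hs
    rw [norm_smul, Real.norm_of_nonneg (hω.nonneg s hs), ← mul_assoc]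
    exact mul_le_mul_of_nonneg_right (hω.le s hs) (norm_nonneg _)
  -- Cauchy-Schwarz for the measure g ds, by expanding ∫ g (‖x‖ - B/F)² ≥ 0.
  have h2 : B ^ 2 ≤ F * A := by
    have h3 : 0 ≤ ∫ s in Ioi 0, (g s * ‖x s‖ ^ 2 - 2 * (B / F) * (g s * ‖x s‖)
        + (B / F) ^ 2 * g s) := setIntegral_nonneg measurableSet_Ioi fun s hs => by
      nlinarith [mul_nonneg (hgn s hs) (sq_nonneg (‖x s‖ - B / F))]
    have e := integral_add (hx2.sub (i1.const_mul (2 * (B / F))))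
      (hg.integrable.const_mul ((B / F) ^ 2))
    have e' := integral_sub hx2 (i1.const_mul (2 * (B / F)))
    simp only [Pi.sub_apply] at e
    rw [e, e', integral_const_mul, integral_const_mul] at h3
    have e2 : A - 2 * (B / F) * B + (B / F) ^ 2 * F = (F * A - B ^ 2) / F := by
      field_simp
      ring
    change 0 ≤ A - 2 * (B / F) * B + (B / F) ^ 2 * F at h3
    rw [e2] at h3
    have := (div_nonneg_iff.1 h3).resolve_right (fun h => absurd h.2 (not_le.2 hF))
    linarith [this.1]
  calc ‖∫ s in Ioi 0, ω s • x s‖ ^ 2 ≤ (C * B) ^ 2 :=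
        pow_le_pow_left₀ (norm_nonneg _) h1 2
    _ = C ^ 2 * B ^ 2 := by ring
    _ ≤ C ^ 2 * (F * A) := by gcongr
    _ = _ := by ring

omit [CompleteSpace E] in
theorem integrable_weight_smul (hg : IsKernel g γ c) (hω : IsWeight g ω C) {x : ℝ → E}
    (hx : AEStronglyMeasurable x (volume.restrict (Ioi 0)))
    (hx2 : IntegrableOn (fun s => g s * ‖x s‖ ^ 2) (Ioi 0)) :
    IntegrableOn (fun s => ω s • x s) (Ioi 0) := by
  refine integrable_smul_of_sq measurableSet_Ioi hω.nonneg ?_ hx (integrable_weight_sq hω hx hx2)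
  refine Integrable.mono' (hg.integrable.const_mul C) hω.meas ?_
  filter_upwards [ae_restrict_mem measurableSet_Ioi] with s hs
  rw [Real.norm_of_nonneg (hω.nonneg s hs)]
  exact hω.le s hs

theorem IsCurve.continuousOn_integral (hz : IsCurve g z) (hg : IsKernel g γ c)
    (hω : IsWeight g ω C) : ContinuousOn (fun t => ∫ s in Ioi 0, ω s • z t s) (Ici 0) := by
  intro t ht
  rw [ContinuousWithinAt, tendsto_iff_norm_sub_tendsto_zero]
  have h1 : Tendsto (fun r => Real.sqrt (C ^ 2 * (∫ s in Ioi 0, g s)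
      * ∫ s in Ioi 0, g s * ‖z r s - z t s‖ ^ 2)) (𝓝[Ici 0] t) (𝓝 0) := by
    have := ((hz.cont t ht).const_mul (C ^ 2 * ∫ s in Ioi 0, g s)).sqrt
    simpa using this
  refine squeeze_zero' (Eventually.of_forall fun _ => norm_nonneg _) ?_ h1
  filter_upwards [self_mem_nhdsWithin] with r hr
  apply Real.le_sqrt_of_sq_le
  rw [← integral_sub (integrable_weight_smul hg hω (hz.meas r hr) (hz.int r hr))
    (integrable_weight_smul hg hω (hz.meas t ht) (hz.int t ht))]
  simp only [← smul_sub]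
  exact norm_integral_weight_sq_le hg hω ((hz.meas r hr).sub (hz.meas t ht))
    (integrable_sq_sub hg (hz.meas r hr) (hz.int r hr) (hz.meas t ht) (hz.int t ht))

theorem IsKernel.isWeight_self (hg : IsKernel g γ c) : IsWeight g g 1 where
  C_nonneg := zero_le_one
  meas := hg.integrable.aestronglyMeasurable
  nonneg s hs := (hg.pos s hs.le).le
  le s _ := by rw [one_mul]

theorem IsKernel.isWeight_deriv (hg : IsKernel g γ c) : IsWeight g γ c where
  C_nonneg := hg.c_pos.le
  meas := (hg.cont_deriv.mono Ioi_subset_Ici_self).aestronglyMeasurable measurableSet_Ioi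
  nonneg s hs := hg.nonneg s hs.le
  le s hs := hg.le s hs.le

theorem IsKernel.continuousOn_shift (hg : IsKernel g γ c) {δ : ℝ} (hδ : 0 ≤ δ) :
    ContinuousOn (fun s => g (s + δ)) (Ici 0) :=
  hg.cont.comp (by fun_prop) fun _ hs => add_nonneg (mem_Ici.1 hs) hδ

theorem IsKernel.isWeight_shift (hg : IsKernel g γ c) {δ : ℝ} (hδ : 0 ≤ δ) :
    IsWeight g (fun s => g (s + δ)) 1 where
  C_nonneg := zero_le_one
  meas := ((hg.continuousOn_shift hδ).mono Ioi_subset_Ici_self).aestronglyMeasurable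
    measurableSet_Ioi
  nonneg s hs := (hg.pos _ (by linarith)).le
  le s hs := by
    rw [one_mul]
    exact hg.antitoneOn hs.le (mem_Ici.2 (by linarith)) (by linarith)

theorem IsKernel.isWeight_diffQuot (hg : IsKernel g γ c) {δ : ℝ} (hδ : 0 < δ) :
    IsWeight g (fun s => (g s - g (s + δ)) / δ) c where
  C_nonneg := hg.c_pos.le
  meas := (((hg.cont.sub (hg.continuousOn_shift hδ.le)).div_const δ).mono
    Ioi_subset_Ici_self).aestronglyMeasurable measurableSet_Ioi
  nonneg s hs := div_nonneg (sub_nonneg.2 (hg.antitoneOn hs.le (mem_Ici.2 (by linarith))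
    (by linarith))) hδ.le
  le s hs := by
    rw [div_le_iff₀ hδ]
    exact hg.sub_le hs hδ.le

theorem IsKernel.isWeight_diff (hg : IsKernel g γ c) {δ : ℝ} (hδ : 0 ≤ δ) :
    IsWeight g (fun s => g s - g (s + δ)) (c * δ) where
  C_nonneg := mul_nonneg hg.c_pos.le hδ
  meas := ((hg.cont.sub (hg.continuousOn_shift hδ)).mono
    Ioi_subset_Ici_self).aestronglyMeasurable measurableSet_Ioi
  nonneg s hs := sub_nonneg.2 (hg.antitoneOn hs.le (mem_Ici.2 (by linarith)) (by linarith))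
  le s hs := (hg.sub_le hs hδ).trans (le_of_eq (by ring))

/-- `∫ (g(s) - g(s + δ))/δ ‖z‖² ds → ∫ γ ‖z‖² ds`. -/
theorem tendsto_integral_diffQuot_weight (hg : IsKernel g γ c) {x : ℝ → E}
    (hx : AEStronglyMeasurable x (volume.restrict (Ioi 0)))
    (hx2 : IntegrableOn (fun s => g s * ‖x s‖ ^ 2) (Ioi 0)) :
    Tendsto (fun δ => ∫ s in Ioi 0, (g s - g (s + δ)) / δ * ‖x s‖ ^ 2) (𝓝[>] 0)
      (𝓝 (∫ s in Ioi 0, γ s * ‖x s‖ ^ 2)) := by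
  refine tendsto_integral_filter_of_dominated_convergence (fun s => c * (g s * ‖x s‖ ^ 2)) ?_ ?_
    (hx2.const_mul c) ?_
  · filter_upwards [self_mem_nhdsWithin] with δ hδ
    exact (hg.isWeight_diffQuot hδ).meas.mul (hx.norm.pow 2)
  · filter_upwards [self_mem_nhdsWithin] with δ hδ
    filter_upwards [ae_restrict_mem measurableSet_Ioi] with s hs
    have hw := hg.isWeight_diffQuot hδ
    rw [norm_mul, Real.norm_of_nonneg (hw.nonneg s hs), Real.norm_of_nonneg (sq_nonneg _),
      ← mul_assoc]
    exact mul_le_mul_of_nonneg_right (hw.le s hs) (sq_nonneg _)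
  · filter_upwards [ae_restrict_mem measurableSet_Ioi] with s hs
    refine Tendsto.mul_const _ ?_
    have h := (hg.hasDerivAt s hs).tendsto_slope_zero_right.neg
    rw [neg_neg] at h
    refine h.congr fun δ => ?_
    rw [smul_eq_mul, div_eq_inv_mul]
    ring

end Weighted

end

end Kawahara

/-! ### The energy balance of the memory. -/

namespace Kawahara

noncomputable section

set_option linter.unusedSectionVars false

open scoped InnerProductSpace

theorem setIntegral_Ioi_shift (F : ℝ → ℝ) (δ : ℝ) :
    ∫ s in Ioi δ, F s = ∫ s in Ioi 0, F (s + δ) := by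
  have h := (measurePreserving_add_right volume δ).setIntegral_preimage_emb
    (measurableEmbedding_addRight δ) F (Ioi δ)
  rw [← h, preimage_add_const_Ioi, sub_self]

theorem norm_intervalIntegral_sq_le {E : Type*} [NormedAddCommGroup E] [NormedSpace ℝ E]
    {p : ℝ → E} {a b : ℝ} (hab : a ≤ b) (hp : IntervalIntegrable p volume a b)
    (hp2 : IntervalIntegrable (fun t => ‖p t‖ ^ 2) volume a b) :
    ‖∫ t in a..b, p t‖ ^ 2 ≤ (b - a) * ∫ t in a..b, ‖p t‖ ^ 2 := by
  rcases hab.eq_or_lt with rfl | hlt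
  · simp
  have h1 := intervalIntegral.norm_integral_le_integral_norm (f := p) (μ := volume) hab
  set B := ∫ t in a..b, ‖p t‖
  set A := ∫ t in a..b, ‖p t‖ ^ 2
  have hpos : 0 < b - a := sub_pos.2 hlt
  set μ := B / (b - a)
  -- Nonnegativity of the variance of ‖p‖ about its mean μ.
  have h2 : 0 ≤ ∫ t in a..b, ((‖p t‖ ^ 2 - 2 * μ * ‖p t‖) + μ ^ 2) :=
    intervalIntegral.integral_nonneg hab fun t _ => by nlinarith [sq_nonneg (‖p t‖ - μ)]
  rw [intervalIntegral.integral_add (hp2.sub (hp.norm.const_mul _)) intervalIntegrable_const,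
    intervalIntegral.integral_sub hp2 (hp.norm.const_mul _), intervalIntegral.integral_const_mul,
    intervalIntegral.integral_const, smul_eq_mul] at h2
  have e : (b - a) * (A - 2 * μ * B + (b - a) * μ ^ 2) = (b - a) * A - B ^ 2 := by
    simp only [μ]
    field_simp
    ring
  have h3 := mul_nonneg hpos.le h2
  have h4 : ‖∫ t in a..b, p t‖ ^ 2 ≤ B ^ 2 := pow_le_pow_left₀ (norm_nonneg _) h1 2
  change 0 ≤ (b - a) * (A - 2 * μ * B + (b - a) * μ ^ 2) at h3
  linarith

variable {L a₀ a₁ : ℝ} {k : ℕ} {g γ : ℝ → ℝ} {c : ℝ} {v₀ : L2 L} {η₀ u : ℝ → L2 L}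

theorem IsSolution.locInt_wderiv (h : IsSolution L a₀ a₁ k g v₀ η₀ u) {j : ℕ} (hj : j ≤ 2) :
    LocInt fun t => wderiv L j (u t) :=
  fun _ _ ha hb => h.intervalIntegrable_wderiv hj ha hb

theorem IsSolution.locInt_sq (h : IsSolution L a₀ a₁ k g v₀ η₀ u) {j : ℕ} (hj : j ≤ 2) :
    LocInt fun t => ‖wderiv L j (u t)‖ ^ 2 := by
  intro a b ha hb
  have h1 : IntegrableOn (fun t => ‖wderiv L j (u t)‖ ^ 2) (Ioo 0 (max a b + 1)) :=
    (h.memL2H2 _ (by positivity) j hj).integrable_norm_pow (by norm_num)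
  rw [intervalIntegrable_iff]
  refine h1.mono_set fun x hx => ?_
  rw [uIoc, mem_Ioc] at hx
  exact ⟨(le_min ha hb).trans_lt hx.1, hx.2.trans_lt (lt_add_one _)⟩

theorem IsSolution.locInt (h : IsSolution L a₀ a₁ k g v₀ η₀ u) : LocInt u :=
  fun _ _ ha hb => intervalIntegrable_of_Ici h.cont ha hb

theorem IsSolution.hasWeakDeriv_integral (h : IsSolution L a₀ a₁ k g v₀ η₀ u) {j : ℕ} (hj : j ≤ 2)
    {a b : ℝ} (ha : 0 ≤ a) (hab : a ≤ b) :
    HasWeakDeriv L j (∫ t in a..b, u t) (∫ t in a..b, wderiv L j (u t)) := by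
  rw [intervalIntegral.integral_of_le hab, intervalIntegral.integral_of_le hab]
  have hs : Ioc a b ⊆ Ioi 0 := fun x hx => ha.trans_lt hx.1
  refine HasWeakDeriv.integral ?_ (h.locInt ha (ha.trans hab)).1
    (h.locInt_wderiv hj ha (ha.trans hab)).1
  filter_upwards [ae_mono (Measure.restrict_mono hs le_rfl) h.memH0] with t ht
  exact ht.hasWeakDeriv hj

/-- The transport equation ∂_tη + ∂_sη = u, integrated along its characteristics; it needs no
differentiability of η. -/
theorem IsSolution.history_add (h : IsSolution L a₀ a₁ k g v₀ η₀ u) {t s δ : ℝ} (ht : 0 ≤ t)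
    (hδ : 0 ≤ δ) :
    history u η₀ (t + δ) (s + δ) = history u η₀ t s + ∫ τ in t..(t + δ), u τ := by
  have htδ : 0 ≤ t + δ := by linarith
  unfold history
  by_cases hst : s ≤ t
  · rw [if_pos hst, if_pos (by linarith), show t + δ - (s + δ) = t - s by ring,
      intervalIntegral.integral_add_adjacent_intervals
        (h.locInt (sub_nonneg.2 hst) ht) (h.locInt ht htδ)]
  · rw [if_neg hst, if_neg (by linarith), show s + δ - (t + δ) = s - t by ring, add_assoc,
      intervalIntegral.integral_add_adjacent_intervals (h.locInt le_rfl ht) (h.locInt ht htδ)]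

theorem IsSolution.wderiv_history_add (h : IsSolution L a₀ a₁ k g v₀ η₀ u) (hk : k ≤ 2) {t δ : ℝ}
    (ht : 0 ≤ t) (hδ : 0 ≤ δ) : ∀ᵐ s ∂(volume.restrict (Ioi 0)),
      wderiv L k (history u η₀ (t + δ) (s + δ)) = wderiv L k (history u η₀ t s)
        + ∫ τ in t..(t + δ), wderiv L k (u τ) := by
  filter_upwards [(h.memLg t ht).memH0] with s hs
  rw [h.history_add ht hδ]
  exact ((hs.hasWeakDeriv le_rfl).add
    (h.hasWeakDeriv_integral hk ht (by linarith))).wderiv_eq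

theorem IsSolution.wderiv_history_of_le (h : IsSolution L a₀ a₁ k g v₀ η₀ u) (hk : k ≤ 2) {t s : ℝ}
    (hs : 0 ≤ s) (hst : s ≤ t) :
    wderiv L k (history u η₀ t s) = ∫ τ in (t - s)..t, wderiv L k (u τ) := by
  rw [history, if_pos hst]
  exact (h.hasWeakDeriv_integral hk (sub_nonneg.2 hst) (by linarith)).wderiv_eq

/-- The continuity assumption on a solution concerns the derivative of a difference of histories.
`wderiv` is additive only where the derivatives exist, hence the passage through almost every s. -/
theorem IsSolution.isCurve (h : IsSolution L a₀ a₁ k g v₀ η₀ u) :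
    IsCurve g fun t s => wderiv L k (history u η₀ t s) where
  meas t ht := (h.memLg t ht).measurable
  int t ht := (h.memLg t ht).integrable
  cont t ht := by
    refine (h.contLg t ht).congr' ?_
    filter_upwards [self_mem_nhdsWithin] with r hr
    refine integral_congr_ae ?_
    filter_upwards [(h.memLg t ht).memH0, (h.memLg r hr).memH0] with s h1 h2
    rw [((h2.hasWeakDeriv le_rfl).sub (h1.hasWeakDeriv le_rfl)).wderiv_eq]

variable [hL : Fact (0 < L)]

theorem IsSolution.continuousOn_memSource (h : IsSolution L a₀ a₁ k g v₀ η₀ u)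
    (hg : IsKernel g γ c) : ContinuousOn (fun t => memSource L k g (history u η₀ t)) (Ici 0) :=
  h.isCurve.continuousOn_integral hg hg.isWeight_self

theorem IsSolution.continuousOn_LgNormSq (h : IsSolution L a₀ a₁ k g v₀ η₀ u)
    (hg : IsKernel g γ c) : ContinuousOn (fun t => LgNormSq L k g (history u η₀ t)) (Ici 0) :=
  h.isCurve.continuousOn_sq hg hg.isWeight_self

/-- The dissipation `∫_0^∞ γ(s) ‖∂_x^k η(s)‖² ds`, `γ = -g'`, of the memory. -/
def memDissipation (L : ℝ) (k : ℕ) (γ : ℝ → ℝ) (η : ℝ → L2 L) : ℝ :=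
  ∫ s in Ioi 0, γ s * ‖wderiv L k (η s)‖ ^ 2

theorem IsSolution.continuousOn_memDissipation (h : IsSolution L a₀ a₁ k g v₀ η₀ u)
    (hg : IsKernel g γ c) :
    ContinuousOn (fun t => memDissipation L k γ (history u η₀ t)) (Ici 0) :=
  h.isCurve.continuousOn_sq hg hg.isWeight_deriv

/-- Cut the norm at time t + δ at s = δ and shift the outer part back along characteristics: there
the history is the old one plus ∂_x^k of ∫u over [t, t + δ], and the square is expanded. The shifted
weight yields the dissipation, the cross term yields the pairing with u, and the inner part and the
pure square are errors that vanish with δ. -/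
theorem IsSolution.diffQuot_LgNormSq_le (h : IsSolution L a₀ a₁ k g v₀ η₀ u)
    (hk : k ≤ 2) (hg : IsKernel g γ c) {t δ : ℝ} (ht : 0 ≤ t) (hδ : 0 < δ) :
    diffQuot δ (fun t => LgNormSq L k g (history u η₀ t)) t
      ≤ -(∫ s in Ioi 0, (g s - g (s + δ)) / δ * ‖wderiv L k (history u η₀ t s)‖ ^ 2)
        + 2 * ⟪∫ s in Ioi 0, g (s + δ) • wderiv L k (history u η₀ t s),
            steklov δ (fun τ => wderiv L k (u τ)) t⟫_ℝ
        + (g 0 * δ ^ 2 + (∫ s in Ioi 0, g s) * δ) * steklov δ (fun τ => ‖wderiv L k (u τ)‖ ^ 2) t := by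
  have htδ : 0 ≤ t + δ := by linarith
  set ζ : ℝ → ℝ → L2 L := fun t s => wderiv L k (history u η₀ t s)
  set p : ℝ → L2 L := fun τ => wderiv L k (u τ)
  have hζ : IsCurve g ζ := h.isCurve
  have hp : LocInt p := h.locInt_wderiv hk
  have hp2 : LocInt fun τ => ‖p τ‖ ^ 2 := h.locInt_sq hk
  set P := ∫ τ in t..(t + δ), p τ
  set S := ∫ τ in t..(t + δ), ‖p τ‖ ^ 2
  have hS : 0 ≤ S := intervalIntegral.integral_nonneg (by linarith) fun _ _ => sq_nonneg _
  have hP : ‖P‖ ^ 2 ≤ δ * S := by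
    have := norm_intervalIntegral_sq_le (show t ≤ t + δ by linarith) (hp ht htδ) (hp2 ht htδ)
    rwa [add_sub_cancel_left] at this
  have hshift := hg.isWeight_shift hδ.le
  have j1 := integrable_weight_sq hshift (hζ.meas t ht) (hζ.int t ht)
  have j2 := integrable_weight_smul hg hshift (hζ.meas t ht) (hζ.int t ht)
  have j3 : IntegrableOn (fun s => g (s + δ)) (Ioi 0) := by
    refine Integrable.mono' hg.integrable hshift.meas ?_
    filter_upwards [ae_restrict_mem measurableSet_Ioi] with s hs
    rw [Real.norm_of_nonneg (hshift.nonneg s hs)]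
    simpa using hshift.le s hs
  have j4 : IntegrableOn (fun s => 2 * ⟪P, g (s + δ) • ζ t s⟫_ℝ) (Ioi 0) :=
    (((innerSL ℝ P).integrable_comp j2).const_mul 2)
  have hae : ∀ᵐ s ∂(volume.restrict (Ioi 0)), g (s + δ) * ‖ζ (t + δ) (s + δ)‖ ^ 2
      = g (s + δ) * ‖ζ t s‖ ^ 2 + 2 * ⟪P, g (s + δ) • ζ t s⟫_ℝ + ‖P‖ ^ 2 * g (s + δ) := by
    filter_upwards [h.wderiv_history_add hk ht hδ.le] with s hs
    simp only [ζ]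
    rw [hs, norm_add_sq_real, real_inner_smul_right, real_inner_comm]
    ring
  have hI0 : IntegrableOn (fun s => g s * ‖ζ (t + δ) s‖ ^ 2) (Ioc 0 δ) :=
    (hζ.int (t + δ) htδ).mono_set Ioc_subset_Ioi_self
  have hI1 : IntegrableOn (fun s => g s * ‖ζ (t + δ) s‖ ^ 2) (Ioi δ) :=
    (hζ.int (t + δ) htδ).mono_set (Ioi_subset_Ioi hδ.le)
  have hsplit : LgNormSq L k g (history u η₀ (t + δ))
      = (∫ s in Ioc 0 δ, g s * ‖ζ (t + δ) s‖ ^ 2)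
        + ((∫ s in Ioi 0, g (s + δ) * ‖ζ t s‖ ^ 2)
          + 2 * ⟪P, ∫ s in Ioi 0, g (s + δ) • ζ t s⟫_ℝ + ‖P‖ ^ 2 * ∫ s in Ioi 0, g (s + δ)) := by
    have e1 : LgNormSq L k g (history u η₀ (t + δ))
        = ∫ s in Ioc 0 δ ∪ Ioi δ, g s * ‖ζ (t + δ) s‖ ^ 2 := by
      rw [Ioc_union_Ioi_eq_Ioi hδ.le]
      rfl
    rw [e1, setIntegral_union (by
      rw [Set.disjoint_left]
      intro x hx hx'
      exact absurd hx' (not_lt.2 hx.2)) measurableSet_Ioi hI0 hI1, setIntegral_Ioi_shift,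
      integral_congr_ae hae]
    have e2 := integral_add (j1.add j4) (j3.const_mul (‖P‖ ^ 2))
    have e3 := integral_add j1 j4
    simp only [Pi.add_apply] at e2
    rw [e2, e3, integral_const_mul, integral_const_mul, integral_inner j2]
  -- For s ≤ δ the history is an integral of ∂_x^k u over an interval of length s, of squared norm
  -- at most δS; the range of s gives the second δ.
  have hfirst : ∫ s in Ioc 0 δ, g s * ‖ζ (t + δ) s‖ ^ 2 ≤ g 0 * δ ^ 2 * S := by
    have h1 : ∀ s ∈ Ioc 0 δ, g s * ‖ζ (t + δ) s‖ ^ 2 ≤ g 0 * (δ * S) := by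
      intro s hs
      have h2 : t ≤ t + δ - s := by linarith [hs.2]
      have h3 : ζ (t + δ) s = ∫ τ in (t + δ - s)..(t + δ), p τ :=
        h.wderiv_history_of_le hk hs.1.le (by linarith [hs.2])
      have h4 := norm_intervalIntegral_sq_le (show t + δ - s ≤ t + δ by linarith [hs.1])
        (hp (ht.trans h2) htδ) (hp2 (ht.trans h2) htδ)
      have h5 : ∫ τ in (t + δ - s)..(t + δ), ‖p τ‖ ^ 2 ≤ S :=
        intervalIntegral.integral_mono_interval h2 (by linarith [hs.1]) le_rfl
          (ae_of_all _ fun _ => sq_nonneg _) (hp2 ht htδ)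
      have h6 : ‖ζ (t + δ) s‖ ^ 2 ≤ δ * S := by
        rw [h3]
        refine h4.trans ?_
        rw [sub_sub_cancel]
        exact mul_le_mul hs.2 h5 (intervalIntegral.integral_nonneg (by linarith [hs.1])
          fun _ _ => sq_nonneg _) hδ.le
      exact mul_le_mul (hg.antitoneOn (mem_Ici.2 le_rfl) (mem_Ici.2 hs.1.le) hs.1.le) h6
        (sq_nonneg _) (hg.pos 0 le_rfl).le
    have h2 := setIntegral_mono_on hI0 (integrableOn_const (by simp)) measurableSet_Ioc h1
    refine h2.trans (le_of_eq ?_)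
    simp [hδ.le]
    ring
  have hlast : ‖P‖ ^ 2 * ∫ s in Ioi 0, g (s + δ) ≤ (∫ s in Ioi 0, g s) * δ * S := by
    have h1 : ∫ s in Ioi 0, g (s + δ) ≤ ∫ s in Ioi 0, g s :=
      setIntegral_mono_on j3 hg.integrable measurableSet_Ioi fun s hs => by
        simpa using hshift.le s hs
    have h0 : 0 ≤ ∫ s in Ioi 0, g (s + δ) :=
      setIntegral_nonneg measurableSet_Ioi fun s hs => hshift.nonneg s hs
    calc ‖P‖ ^ 2 * ∫ s in Ioi 0, g (s + δ) ≤ (δ * S) * ∫ s in Ioi 0, g s :=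
          mul_le_mul hP h1 h0 (by positivity)
      _ = _ := by ring
  have hD : ∫ s in Ioi 0, (g s - g (s + δ)) / δ * ‖ζ t s‖ ^ 2
      = δ⁻¹ * (LgNormSq L k g (history u η₀ t) - ∫ s in Ioi 0, g (s + δ) * ‖ζ t s‖ ^ 2) := by
    rw [LgNormSq, ← integral_sub (hζ.int t ht) j1, ← integral_const_mul]
    congr 1
    ext s
    simp only [ζ]
    ring
  simp only [diffQuot, steklov, real_inner_smul_right, smul_eq_mul]
  rw [hD, hsplit, real_inner_comm P]
  have hfin := mul_le_mul_of_nonneg_left (add_le_add hfirst hlast) (inv_nonneg.2 hδ.le)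
  change _ ≤ _ + _ + _ * (δ⁻¹ * S)
  linarith

/-- The energy balance of the memory. -/
theorem IsSolution.LgNormSq_sub_le (h : IsSolution L a₀ a₁ k g v₀ η₀ u)
    (hk : k ≤ 2) (hg : IsKernel g γ c) {a b : ℝ} (ha : 0 ≤ a) (hab : a ≤ b) :
    LgNormSq L k g (history u η₀ b) - LgNormSq L k g (history u η₀ a)
      ≤ 2 * (∫ t in a..b, ⟪memSource L k g (history u η₀ t), wderiv L k (u t)⟫_ℝ)
        - ∫ t in a..b, memDissipation L k γ (history u η₀ t) := by
  have hb := ha.trans hab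
  set ζ : ℝ → ℝ → L2 L := fun t s => wderiv L k (history u η₀ t s) with hζdef
  set p : ℝ → L2 L := fun τ => wderiv L k (u τ)
  have hζ : IsCurve g ζ := h.isCurve
  have hp : LocInt p := h.locInt_wderiv hk
  have hp2 : LocInt fun τ => ‖p τ‖ ^ 2 := h.locInt_sq hk
  have hM := h.continuousOn_LgNormSq hg
  have hm := h.continuousOn_memSource hg
  set F := ∫ s in Ioi 0, g s
  have t1 := tendsto_integral_diffQuot hM ha hab
  have t2 : Tendsto (fun δ => ∫ t in a..b, ∫ s in Ioi 0, (g s - g (s + δ)) / δ * ‖ζ t s‖ ^ 2)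
      (𝓝[>] 0) (𝓝 (∫ t in a..b, memDissipation L k γ (history u η₀ t))) := by
    refine intervalIntegral.tendsto_integral_filter_of_dominated_convergence
      (fun t => c * LgNormSq L k g (history u η₀ t)) ?_ ?_
      ((intervalIntegrable_of_Ici hM ha hb).const_mul c) ?_
    · filter_upwards [self_mem_nhdsWithin] with δ hδ
      have := intervalIntegrable_of_Ici (hζ.continuousOn_sq hg (hg.isWeight_diffQuot hδ)) ha hb
      exact (intervalIntegrable_iff.1 this).aestronglyMeasurable
    · filter_upwards [self_mem_nhdsWithin] with δ hδ
      refine ae_of_all _ fun t ht => ?_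
      rw [uIoc_of_le hab] at ht
      have ht0 := ha.trans ht.1.le
      have hw := hg.isWeight_diffQuot hδ
      rw [Real.norm_of_nonneg (setIntegral_nonneg measurableSet_Ioi fun s hs =>
        mul_nonneg (hw.nonneg s hs) (sq_nonneg _))]
      exact integral_weight_sq_le hw (hζ.meas t ht0) (hζ.int t ht0)
    · refine ae_of_all _ fun t ht => ?_
      rw [uIoc_of_le hab] at ht
      have ht0 := ha.trans ht.1.le
      exact tendsto_integral_diffQuot_weight hg (hζ.meas t ht0) (hζ.int t ht0)
  obtain ⟨K, hK⟩ := isCompact_Icc.exists_bound_of_continuousOn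
    (hM.mono (fun x hx => ha.trans hx.1 : Icc a b ⊆ Ici 0))
  have t3 : Tendsto (fun δ => ∫ t in a..b, ⟪∫ s in Ioi 0, g (s + δ) • ζ t s, steklov δ p t⟫_ℝ)
      (𝓝[>] 0) (𝓝 (∫ t in a..b, ⟪memSource L k g (history u η₀ t), p t⟫_ℝ)) := by
    refine tendsto_integral_inner_steklov hm hp ha hab
      (fun δ hδ => hζ.continuousOn_integral hg (hg.isWeight_shift hδ.le)) fun ε hε => ?_
    -- By g - g(· + δ) ≤ cδg, shifting the weight changes the memory source by at most this amount,
    -- uniformly on [a, b].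
    have hlim : Tendsto (fun δ : ℝ => Real.sqrt ((c * δ) ^ 2 * F * K)) (𝓝[>] 0) (𝓝 0) := by
      have : Continuous fun δ : ℝ => Real.sqrt ((c * δ) ^ 2 * F * K) := by fun_prop
      have h0 := this.tendsto 0
      simp only [mul_zero, ne_eq, OfNat.ofNat_ne_zero, not_false_eq_true, zero_pow, zero_mul,
        Real.sqrt_zero] at h0
      exact h0.mono_left nhdsWithin_le_nhds
    filter_upwards [hlim.eventually_le_const hε, self_mem_nhdsWithin] with δ hδ hδ0 t ht
    have ht0 := ha.trans ht.1
    have hδ1 : 0 < δ := hδ0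
    have hw := hg.isWeight_diff hδ1.le
    refine le_trans ?_ hδ
    apply Real.le_sqrt_of_sq_le
    have e : (∫ s in Ioi 0, g (s + δ) • ζ t s) - memSource L k g (history u η₀ t)
        = -∫ s in Ioi 0, (g s - g (s + δ)) • ζ t s := by
      simp only [sub_smul]
      rw [integral_sub (integrable_weight_smul hg hg.isWeight_self (hζ.meas t ht0) (hζ.int t ht0))
        (integrable_weight_smul hg (hg.isWeight_shift hδ1.le) (hζ.meas t ht0) (hζ.int t ht0)),
        neg_sub]
      rfl
    rw [e, norm_neg]
    refine (norm_integral_weight_sq_le hg hw (hζ.meas t ht0) (hζ.int t ht0)).trans ?_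
    have hF : 0 ≤ F := setIntegral_nonneg measurableSet_Ioi fun s hs => (hg.pos s (le_of_lt hs)).le
    refine mul_le_mul_of_nonneg_left ?_ (by positivity)
    exact (le_abs_self _).trans (hK t ht)
  have t4 : Tendsto (fun δ => (g 0 * δ ^ 2 + F * δ) * ∫ t in a..b, steklov δ (fun τ => ‖p τ‖ ^ 2) t)
      (𝓝[>] 0) (𝓝 0) := by
    have h1 := hp2.tendsto_integral_steklov ha hab
    have h2 : Tendsto (fun δ : ℝ => g 0 * δ ^ 2 + F * δ) (𝓝[>] 0) (𝓝 0) := by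
      have : Continuous fun δ : ℝ => g 0 * δ ^ 2 + F * δ := by fun_prop
      have h0 := this.tendsto 0
      simp only [ne_eq, OfNat.ofNat_ne_zero, not_false_eq_true, zero_pow, mul_zero, add_zero] at h0
      exact h0.mono_left nhdsWithin_le_nhds
    simpa using h2.mul h1
  have t5 := (t2.neg.add (t3.const_mul 2)).add t4
  rw [add_zero] at t5
  refine (le_of_tendsto_of_tendsto t1 t5 ?_).trans (le_of_eq (by ring))
  filter_upwards [self_mem_nhdsWithin] with δ hδ
  have hδ0 : 0 < δ := hδ
  have hI : ∀ {f : ℝ → ℝ}, ContinuousOn f (Ici 0) → IntervalIntegrable f volume a b := fun hf =>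
    intervalIntegrable_of_Ici hf ha hb
  have i1 := hI (hζ.continuousOn_sq hg (hg.isWeight_diffQuot hδ0))
  have i2 := hI ((hζ.continuousOn_integral hg (hg.isWeight_shift hδ0.le)).inner
    (hp.continuousOn_steklov hδ0))
  have i3 := hI (hp2.continuousOn_steklov hδ0)
  have i0 : IntervalIntegrable (diffQuot δ fun t => LgNormSq L k g (history u η₀ t)) volume a b := by
    refine hI (ContinuousOn.const_smul (ContinuousOn.sub ?_ hM) δ⁻¹)
    exact hM.comp (by fun_prop) fun t ht => add_nonneg (mem_Ici.1 ht) hδ0.le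
  have hle := intervalIntegral.integral_mono_on hab i0
    ((i1.neg.add (i2.const_mul 2)).add (i3.const_mul (g 0 * δ ^ 2 + F * δ)))
    fun t ht => h.diffQuot_LgNormSq_le hk hg (ha.trans ht.1) hδ0
  refine hle.trans (le_of_eq ?_)
  have e1 := intervalIntegral.integral_add (i1.neg.add (i2.const_mul 2))
    (i3.const_mul (g 0 * δ ^ 2 + F * δ))
  have e2 := intervalIntegral.integral_add i1.neg (i2.const_mul 2)
  refine e1.trans ?_
  rw [intervalIntegral.integral_const_mul]
  congr 1
  refine e2.trans ?_
  rw [intervalIntegral.integral_const_mul]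
  congr 1
  exact intervalIntegral.integral_neg

end

end Kawahara

/-! ### The energy inequality and the smoothing effect for solutions. -/

namespace Kawahara
noncomputable section
open scoped InnerProductSpace

section
variable {E : Type*} [NormedAddCommGroup E] [InnerProductSpace ℝ E] [CompleteSpace E]

theorem continuousOn_diffQuot {F : ℝ → E} (hF : ContinuousOn F (Ici 0)) {δ : ℝ} (hδ : 0 ≤ δ) :
    ContinuousOn (diffQuot δ F) (Ici 0) := by
  unfold diffQuot
  refine ContinuousOn.const_smul (ContinuousOn.sub ?_ hF) _
  refine hF.comp (by fun_prop) fun t ht => ?_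
  simp only [mem_Ici] at *
  linarith

theorem tendsto_integral_steklov_sq {F : ℝ → E} (hF : ContinuousOn F (Ici 0)) {a b : ℝ}
    (ha : 0 ≤ a) (hab : a ≤ b) :
    Tendsto (fun δ => ∫ t in a..b, ‖steklov δ F t‖ ^ 2) (𝓝[>] 0) (𝓝 (∫ t in a..b, ‖F t‖ ^ 2)) := by
  have h := tendsto_integral_inner_steklov hF (r := F)
    (fun a b ha hb => intervalIntegrable_of_Ici hF ha hb) ha hab
    (G := fun δ t => steklov δ F t) (fun δ hδ => continuousOn_steklov hF hδ.le)
    (fun ε hε => eventually_norm_steklov_sub_le hF ha hε)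
  simpa only [real_inner_self_eq_norm_sq] using h

theorem LocInt.of_continuousOn {F : ℝ → E} (hF : ContinuousOn F (Ici 0)) : LocInt F :=
  fun _ _ ha hb => intervalIntegrable_of_Ici hF ha hb

theorem intervalIntegrable_norm_sq {F : ℝ → E} (hF : ContinuousOn F (Ici 0)) {a b : ℝ}
    (ha : 0 ≤ a) (hb : 0 ≤ b) : IntervalIntegrable (fun t => ‖F t‖ ^ 2) volume a b :=
  intervalIntegrable_of_Ici (hF.norm.pow 2) ha hb

theorem map_steklov (B : E →L[ℝ] E) {F : ℝ → E} (hF : LocInt F) {δ t : ℝ} (hδ : 0 ≤ δ)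
    (ht : 0 ≤ t) : B (steklov δ F t) = steklov δ (fun τ => B (F τ)) t := by
  simp only [steklov, map_smul]
  rw [B.intervalIntegral_comp_comm (hF ht (by linarith))]

end

section
variable {L a₀ a₁ : ℝ} {k : ℕ} {g γ : ℝ → ℝ} {c : ℝ} {v₀ : L2 L} {η₀ u : ℝ → L2 L}
variable [hL : Fact (0 < L)]

theorem IsSecondDeriv.smul {Y : L2 L} (hY : IsSecondDeriv Y) (r : ℝ) : IsSecondDeriv (r • Y) := by
  constructor
  · rw [inner_smul_right, hY.1, mul_zero]
  · rw [map_smul, inner_smul_right, hY.2, mul_zero]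

theorem IsSolution.isSecondDeriv_steklov (h : IsSolution L a₀ a₁ k g v₀ η₀ u) {t δ : ℝ}
    (ht : 0 ≤ t) (hδ : 0 ≤ δ) : IsSecondDeriv (steklov δ (fun τ => wderiv L 2 (u τ)) t) :=
  (integral_wderiv_mem h ht (by linarith)).1.smul _

theorem IsSolution.J_J_steklov (h : IsSolution L a₀ a₁ k g v₀ η₀ u) {t δ : ℝ}
    (ht : 0 ≤ t) (hδ : 0 ≤ δ) :
    J (J (steklov δ (fun τ => wderiv L 2 (u τ)) t)) = steklov δ u t := by
  simp only [steklov, map_smul]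
  rw [(integral_wderiv_mem h ht (by linarith)).2.1]

theorem IsSolution.J_pow_steklov (h : IsSolution L a₀ a₁ k g v₀ η₀ u) (hk : k ≤ 2) {t δ : ℝ}
    (ht : 0 ≤ t) (hδ : 0 ≤ δ) :
    (J ^ (2 - k)) (steklov δ (fun τ => wderiv L 2 (u τ)) t)
      = steklov δ (fun τ => wderiv L k (u τ)) t := by
  simp only [steklov, map_smul]
  rw [(integral_wderiv_mem h ht (by linarith)).2.2 k (2 - k) (by omega)]

/-- The multiplier u, applied to averages. Squaring does not commute with averaging, so the
nonlinear term need not vanish for δ > 0; it converges to ∫⟪N(u), ∂_x²u⟫, which is zero because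
∫u²∂_xu = 0. -/
theorem IsSolution.norm_sq_sub_le (h : IsSolution L a₀ a₁ k g v₀ η₀ u) (ha₀ : 0 < a₀)
    (hk : k ≤ 2) (hg : IsKernel g γ c) {a b : ℝ} (ha : 0 ≤ a) (hab : a ≤ b) :
    1 / 2 * ‖u b‖ ^ 2 - 1 / 2 * ‖u a‖ ^ 2
      ≤ -∫ t in a..b, ⟪memSource L k g (history u η₀ t), wderiv L k (u t)⟫_ℝ := by
  have hb := ha.trans hab
  have hm := h.continuousOn_memSource hg
  have hN : ContinuousOn (fun t => quadSource (u t)) (Ici 0) :=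
    continuous_quadSource.comp_continuousOn h.cont
  have hy := h.locInt_wderiv (le_refl 2)
  have hp := h.locInt_wderiv hk
  have lim1 := tendsto_integral_inner_steklov hN hy ha hab
    (G := fun δ => steklov δ fun t => quadSource (u t))
    (fun δ hδ => continuousOn_steklov hN hδ.le)
    (fun ε hε => eventually_norm_steklov_sub_le hN ha hε)
  have lim2 := tendsto_integral_inner_steklov hm hp ha hab
    (G := fun δ => steklov δ fun t => memSource L k g (history u η₀ t))
    (fun δ hδ => continuousOn_steklov hm hδ.le)
    (fun ε hε => eventually_norm_steklov_sub_le hm ha hε)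
  have zero : ∫ t in a..b, ⟪quadSource (u t), wderiv L 2 (u t)⟫_ℝ = 0 := by
    rw [← intervalIntegral.integral_zero (a := a) (b := b) (μ := volume) (E := ℝ)]
    refine intervalIntegral.integral_congr_ae ?_
    filter_upwards [ae_uIoc_of_Ioi h.memH0 ha hb] with t ht hmem
    have hv := ht hmem
    have e := inner_quadSource_eq_zero hv.isSecondDeriv.2
    rwa [← hv.eq_J_J] at e
  have lim0 : ∀ t, 0 ≤ t → Tendsto (fun δ => 1 / 2 * ‖steklov δ u t‖ ^ 2) (𝓝[>] 0)
      (𝓝 (1 / 2 * ‖u t‖ ^ 2)) := fun t ht => ((tendsto_steklov h.cont ht).norm.pow 2).const_mul _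
  have key : ∀ δ, 0 < δ → 1 / 2 * ‖steklov δ u b‖ ^ 2 - 1 / 2 * ‖steklov δ u a‖ ^ 2 ≤
      1 / 2 * (∫ t in a..b, ⟪steklov δ (fun t => quadSource (u t)) t,
        steklov δ (fun t => wderiv L 2 (u t)) t⟫_ℝ)
      - ∫ t in a..b, ⟪steklov δ (fun t => memSource L k g (history u η₀ t)) t,
        steklov δ (fun t => wderiv L k (u t)) t⟫_ℝ := by
    intro δ hδ
    have e := integral_inner_diffQuot h.cont (ContinuousLinearMap.id ℝ (L2 L))
      (fun _ _ => rfl) ha hab hδ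
    simp only [ContinuousLinearMap.id_apply, real_inner_self_eq_norm_sq] at e
    have i1 := intervalIntegrable_of_Ici
      ((continuousOn_steklov hN hδ.le).inner (𝕜 := ℝ) (hy.continuousOn_steklov hδ)) ha hb
    have i2 := intervalIntegrable_of_Ici
      ((continuousOn_steklov hm hδ.le).inner (𝕜 := ℝ) (hp.continuousOn_steklov hδ)) ha hb
    rw [← e, ← intervalIntegral.integral_const_mul, ← intervalIntegral.integral_sub
      (i1.const_mul _) i2]
    refine intervalIntegral.integral_mono_on hab (intervalIntegrable_of_Ici
      ((continuousOn_diffQuot h.cont hδ.le).inner (𝕜 := ℝ) (continuousOn_steklov h.cont hδ.le))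
      ha hb) ((i1.const_mul _).sub i2) fun t ht => ?_
    have ht0 := ha.trans ht.1
    have := (h.isResolvent hk hg hm ht0 hδ).inner_le ha₀ (h.isSecondDeriv_steklov ht0 hδ.le)
    rwa [h.J_J_steklov ht0 hδ.le, h.J_pow_steklov hk ht0 hδ.le] at this
  have := le_of_tendsto_of_tendsto ((lim0 b hb).sub (lim0 a ha)) ((lim1.const_mul (1 / 2)).sub lim2)
    (eventually_mem_nhdsWithin.mono fun δ hδ => key δ hδ)
  rw [zero] at this
  linarith

/-- The pairing of ∂_x^k u with the memory source enters the balances of u and of the memory with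
opposite signs and cancels. -/
theorem IsSolution.energy_add_le (h : IsSolution L a₀ a₁ k g v₀ η₀ u) (ha₀ : 0 < a₀)
    (hk : k ≤ 2) (hg : IsKernel g γ c) {a b : ℝ} (ha : 0 ≤ a) (hab : a ≤ b) :
    energy L k g η₀ u b + 1 / 2 * ∫ t in a..b, memDissipation L k γ (history u η₀ t)
      ≤ energy L k g η₀ u a := by
  have h1 := h.norm_sq_sub_le ha₀ hk hg ha hab
  have h2 := h.LgNormSq_sub_le hk hg ha hab
  unfold energy
  linarith

theorem IsSolution.exists_smoothing (L : ℝ) [Fact (0 < L)] {a₀ : ℝ} (ha₀ : 0 < a₀) (a₁ : ℝ)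
    {k : ℕ} (hk : k ≤ 2) {g γ : ℝ → ℝ} {c : ℝ} (hg : IsKernel g γ c) :
    ∃ C : ℝ, 0 ≤ C ∧ ∀ {v₀ : L2 L} {η₀ u : ℝ → L2 L}, IsSolution L a₀ a₁ k g v₀ η₀ u →
      ∀ {a b δ : ℝ}, 0 ≤ a → a ≤ b → 0 < δ →
      1 / 2 * ⟪steklov δ u b, X (steklov δ u b)⟫_ℝ - 1 / 2 * ⟪steklov δ u a, X (steklov δ u a)⟫_ℝ
        + a₀ * (∫ t in a..b, ‖steklov δ (fun τ => wderiv L 2 (u τ)) t‖ ^ 2)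
        ≤ C * ((∫ t in a..b, ‖steklov δ u t‖ ^ 2)
          + (∫ t in a..b, ‖steklov δ (fun τ => quadSource (u τ)) t‖ ^ 2)
          + ∫ t in a..b, ‖steklov δ (fun τ => memSource L k g (history u η₀ τ)) t‖ ^ 2) := by
  obtain ⟨C, hC, key⟩ := exists_inner_X_le L ha₀ a₁ (2 - k)
  refine ⟨C, hC, fun {v₀ η₀ u} h {a b δ} ha hab hδ => ?_⟩
  have hb := ha.trans hab
  have hm := h.continuousOn_memSource hg
  have hN : ContinuousOn (fun t => quadSource (u t)) (Ici 0) :=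
    continuous_quadSource.comp_continuousOn h.cont
  have hy := h.locInt_wderiv (le_refl 2)
  have e := integral_inner_diffQuot h.cont (X (L := L)) inner_X ha hab hδ
  have iy := intervalIntegrable_norm_sq (hy.continuousOn_steklov hδ) ha hb
  have iu := intervalIntegrable_norm_sq (continuousOn_steklov h.cont hδ.le) ha hb
  have iN := intervalIntegrable_norm_sq (continuousOn_steklov hN hδ.le) ha hb
  have im := intervalIntegrable_norm_sq (continuousOn_steklov hm hδ.le) ha hb
  have ic : IntervalIntegrable (fun t => ⟪diffQuot δ u t, X (steklov δ u t)⟫_ℝ) volume a b :=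
    intervalIntegrable_of_Ici ((continuousOn_diffQuot h.cont hδ.le).inner (𝕜 := ℝ)
      ((X (L := L)).continuous.comp_continuousOn (continuousOn_steklov h.cont hδ.le))) ha hb
  rw [← e, ← intervalIntegral.integral_const_mul, ← intervalIntegral.integral_add iu iN,
    ← intervalIntegral.integral_add (iu.add iN) im, ← intervalIntegral.integral_const_mul,
    ← intervalIntegral.integral_add ic (iy.const_mul _)]
  refine intervalIntegral.integral_mono_on hab (ic.add (iy.const_mul _))
    (((iu.add iN).add im).const_mul _) fun t ht => ?_
  have ht0 := ha.trans ht.1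
  have := key _ _ _ _ (h.isSecondDeriv_steklov ht0 hδ.le) (h.isResolvent hk hg hm ht0 hδ)
  rw [h.J_J_steklov ht0 hδ.le] at this
  linarith

/-- The limit δ → 0 of the averaged smoothing estimate. Instead of ∫‖∂_x²u‖² it retains two weaker
quantities whose limits are immediate: a bounded operator applied to u with a norm dominated by that
of ∂_x²u, used with I - B, and the norm of ∫∂_x²u, used for the displacement. -/
theorem IsSolution.exists_integrated_smoothing (L : ℝ) [Fact (0 < L)] {a₀ : ℝ} (ha₀ : 0 < a₀)
    (a₁ : ℝ) {k : ℕ} (hk : k ≤ 2) {g γ : ℝ → ℝ} {c : ℝ} (hg : IsKernel g γ c) :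
    ∃ C : ℝ, 0 ≤ C ∧ ∀ {v₀ : L2 L} {η₀ u : ℝ → L2 L}, IsSolution L a₀ a₁ k g v₀ η₀ u →
      ∀ {a b : ℝ}, 0 ≤ a → a ≤ b →
      (∀ (D : L2 L →L[ℝ] L2 L) (κ : ℝ), (∀ z, κ * ‖D (J (J z))‖ ^ 2 ≤ a₀ * ‖z‖ ^ 2) →
        1 / 2 * ⟪u b, X (u b)⟫_ℝ - 1 / 2 * ⟪u a, X (u a)⟫_ℝ + κ * (∫ t in a..b, ‖D (u t)‖ ^ 2)
          ≤ C * ((∫ t in a..b, ‖u t‖ ^ 2) + (∫ t in a..b, ‖quadSource (u t)‖ ^ 2)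
            + ∫ t in a..b, ‖memSource L k g (history u η₀ t)‖ ^ 2)) ∧
      a₀ * ‖∫ t in a..b, wderiv L 2 (u t)‖ ^ 2 ≤ (b - a) * (1 / 2 * ⟪u a, X (u a)⟫_ℝ
          + C * ((∫ t in a..b, ‖u t‖ ^ 2) + (∫ t in a..b, ‖quadSource (u t)‖ ^ 2)
            + ∫ t in a..b, ‖memSource L k g (history u η₀ t)‖ ^ 2)) := by
  obtain ⟨C, hC, key⟩ := IsSolution.exists_smoothing L ha₀ a₁ hk hg
  refine ⟨C, hC, fun {v₀ η₀ u} h {a b} ha hab => ?_⟩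
  have hb := ha.trans hab
  have hm := h.continuousOn_memSource hg
  have hN : ContinuousOn (fun t => quadSource (u t)) (Ici 0) :=
    continuous_quadSource.comp_continuousOn h.cont
  have hy := h.locInt_wderiv (le_refl 2)
  have limX : ∀ t, 0 ≤ t → Tendsto (fun δ => 1 / 2 * ⟪steklov δ u t, X (steklov δ u t)⟫_ℝ)
      (𝓝[>] 0) (𝓝 (1 / 2 * ⟪u t, X (u t)⟫_ℝ)) := fun t ht => by
    have h1 := tendsto_steklov h.cont ht
    exact (h1.inner (((X (L := L)).continuous.tendsto _).comp h1)).const_mul _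
  have limR := (((tendsto_integral_steklov_sq h.cont ha hab).add
    (tendsto_integral_steklov_sq hN ha hab)).add
    (tendsto_integral_steklov_sq hm ha hab)).const_mul C
  constructor
  · intro D κ hD
    have hDu : ContinuousOn (fun t => D (u t)) (Ici 0) := D.continuous.comp_continuousOn h.cont
    refine le_of_tendsto_of_tendsto (((limX b hb).sub (limX a ha)).add
      ((tendsto_integral_steklov_sq hDu ha hab).const_mul κ)) limR
      (eventually_mem_nhdsWithin.mono fun δ (hδ : 0 < δ) => ?_)
    refine le_trans ?_ (key h ha hab hδ)
    refine add_le_add_right ?_ _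
    rw [← intervalIntegral.integral_const_mul, ← intervalIntegral.integral_const_mul]
    refine intervalIntegral.integral_mono_on hab
      ((intervalIntegrable_norm_sq (continuousOn_steklov hDu hδ.le) ha hb).const_mul κ)
      ((intervalIntegrable_norm_sq (hy.continuousOn_steklov hδ) ha hb).const_mul a₀) fun t ht => ?_
    have ht0 := ha.trans ht.1
    rw [← map_steklov D (LocInt.of_continuousOn h.cont) hδ.le ht0, ← h.J_J_steklov ht0 hδ.le]
    exact hD _
  · refine le_of_tendsto_of_tendsto
      (((hy.tendsto_integral_steklov ha hab).norm.pow 2).const_mul a₀)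
      (((limX a ha).add limR).const_mul (b - a))
      (eventually_mem_nhdsWithin.mono fun δ (hδ : 0 < δ) => ?_)
    have cy := hy.continuousOn_steklov hδ
    have h1 := norm_intervalIntegral_sq_le hab (intervalIntegrable_of_Ici cy ha hb)
      (intervalIntegrable_norm_sq cy ha hb)
    have h2 := key h ha hab hδ
    have h3 := inner_X_self_nonneg (steklov δ u b)
    have h4 := mul_le_mul_of_nonneg_left h1 ha₀.le
    have h5 : 0 ≤ b - a := sub_nonneg.2 hab
    refine h4.trans ?_
    rw [mul_left_comm]
    refine mul_le_mul_of_nonneg_left ?_ h5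
    linarith

end

end
end Kawahara

/-! ### Delay means of u, and the ingredients of observability. -/

namespace Kawahara
noncomputable section
open scoped InnerProductSpace

section
variable {E : Type*} [NormedAddCommGroup E] [NormedSpace ℝ E]

/-- The primitive of `F` that vanishes at `0`. -/
def primitive (F : ℝ → E) (t : ℝ) : E := ∫ τ in (0 : ℝ)..t, F τ

/-- `∫_0^1 ∫_{t-s}^t F(τ) dτ ds`, in closed form. -/
def delayMean (F : ℝ → E) (t : ℝ) : E :=
  primitive F t - (primitive (primitive F) t - primitive (primitive F) (t - 1))

/-- `∫_0^1 (1 - s) ∫_{t-s}^t F(τ) dτ ds`, in closed form. -/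
def delayAvg (F : ℝ → E) (t : ℝ) : E :=
  (1 / 2 : ℝ) • primitive F t - primitive (primitive F) t
    + (primitive (primitive (primitive F)) t - primitive (primitive (primitive F)) (t - 1))

variable [CompleteSpace E] {F : ℝ → E}

theorem hasDerivAt_primitive (hF : Continuous F) (t : ℝ) : HasDerivAt (primitive F) (F t) t :=
  intervalIntegral.integral_hasDerivAt_right (hF.intervalIntegrable _ _)
    (hF.stronglyMeasurableAtFilter _ _) hF.continuousAt

theorem continuous_primitive (hF : Continuous F) : Continuous (primitive F) :=
  continuous_iff_continuousAt.2 fun t => (hasDerivAt_primitive hF t).continuousAt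

/-- Transport ∂_tη = u - ∂_sη against the weight 1 - s: the first term gives ∫_0^1 (1 - s) ds = 1/2,
and integration by parts in s is free of boundary terms since η(0) = 0 and the weight vanishes at 1.
The closed form reduces this to iterated primitives. -/
theorem hasDerivAt_delayAvg (hF : Continuous F) (t : ℝ) :
    HasDerivAt (delayAvg F) ((1 / 2 : ℝ) • F t - delayMean F t) t := by
  have hU := continuous_primitive hF
  have hW := continuous_primitive hU
  have h3 := hasDerivAt_primitive hW (t - 1)
  have := (((hasDerivAt_primitive hF t).const_smul (1 / 2 : ℝ)).sub (hasDerivAt_primitive hU t)).add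
    ((hasDerivAt_primitive hW t).sub (h3.comp_sub_const t 1))
  refine this.congr_deriv ?_
  unfold delayMean
  abel

theorem continuous_delayMean (hF : Continuous F) : Continuous (delayMean F) := by
  have hU := continuous_primitive hF
  have hW := continuous_primitive hU
  exact hU.sub (hW.sub (hW.comp (by fun_prop)))

theorem primitive_sub (hF : Continuous F) (a b : ℝ) :
    primitive F b - primitive F a = ∫ τ in a..b, F τ :=
  intervalIntegral.integral_interval_sub_left (hF.intervalIntegrable _ _)
    (hF.intervalIntegrable _ _)

theorem HasDerivAt.comp_const_sub' {G : ℝ → E} {G' : E} {t s : ℝ} (h : HasDerivAt G G' (t - s)) :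
    HasDerivAt (fun s => G (t - s)) (-G') s := HasDerivAt.comp_const_sub t s h

theorem continuous_delay (hF : Continuous F) (t : ℝ) :
    Continuous fun s => ∫ τ in (t - s)..t, F τ := by
  simp_rw [← primitive_sub hF]
  exact continuous_const.sub ((continuous_primitive hF).comp (by fun_prop))

theorem delayMean_eq (hF : Continuous F) (t : ℝ) :
    delayMean F t = ∫ s in (0 : ℝ)..1, ∫ τ in (t - s)..t, F τ := by
  have hU := continuous_primitive hF
  have hd : ∀ s, HasDerivAt (fun s => s • primitive F t + primitive (primitive F) (t - s))
      (∫ τ in (t - s)..t, F τ) s := fun s => by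
    have := ((hasDerivAt_id s).smul_const (primitive F t)).add
      (HasDerivAt.comp_const_sub' (hasDerivAt_primitive hU (t - s)))
    rw [one_smul, ← sub_eq_add_neg, primitive_sub hF] at this
    exact this
  rw [intervalIntegral.integral_eq_sub_of_hasDerivAt (fun s _ => hd s)
    ((continuous_delay hF t).intervalIntegrable _ _)]
  simp only [delayMean, one_smul, zero_smul, sub_zero]
  abel

theorem delayAvg_eq (hF : Continuous F) (t : ℝ) :
    delayAvg F t = ∫ s in (0 : ℝ)..1, (1 - s) • ∫ τ in (t - s)..t, F τ := by
  have hU := continuous_primitive hF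
  have hW := continuous_primitive hU
  have hd : ∀ s, HasDerivAt (fun s => (s - 1 / 2 * s ^ 2) • primitive F t
      + (1 - s) • primitive (primitive F) (t - s) - primitive (primitive (primitive F)) (t - s))
      ((1 - s) • ∫ τ in (t - s)..t, F τ) s := fun s => by
    have e1 : HasDerivAt (fun s : ℝ => s - 1 / 2 * s ^ 2) (1 - s) s := by
      exact ((hasDerivAt_id s).sub ((hasDerivAt_pow 2 s).const_mul (1 / 2))).congr_deriv
        (by push_cast; ring)
    have e2 : HasDerivAt (fun s : ℝ => 1 - s) (-1) s := by
      simpa using (hasDerivAt_id s).const_sub 1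
    have := ((e1.smul_const (primitive F t)).add
      (e2.smul (HasDerivAt.comp_const_sub' (hasDerivAt_primitive hU (t - s))))).sub
      (HasDerivAt.comp_const_sub' (hasDerivAt_primitive hW (t - s)))
    refine this.congr_deriv ?_
    rw [← primitive_sub hF]
    simp only [smul_sub, smul_neg, neg_smul, one_smul]
    abel
  rw [intervalIntegral.integral_eq_sub_of_hasDerivAt (fun s _ => hd s)
    ((((continuous_const.sub continuous_id).smul (continuous_delay hF t))).intervalIntegrable _ _)]
  simp only [delayAvg, zero_smul, sub_zero, sub_self]
  norm_num
  abel

theorem norm_delayMean_sq_le (hF : Continuous F) (t : ℝ) :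
    ‖delayMean F t‖ ^ 2 ≤ ∫ s in (0 : ℝ)..1, ‖∫ τ in (t - s)..t, F τ‖ ^ 2 := by
  have hc := continuous_delay hF t
  rw [delayMean_eq hF]
  simpa using norm_intervalIntegral_sq_le zero_le_one (hc.intervalIntegrable _ _)
    ((hc.norm.pow 2).intervalIntegrable _ _)

theorem norm_delayAvg_sq_le (hF : Continuous F) (t : ℝ) :
    ‖delayAvg F t‖ ^ 2 ≤ ∫ s in (0 : ℝ)..1, ‖∫ τ in (t - s)..t, F τ‖ ^ 2 := by
  have hc := continuous_delay hF t
  have hc' : Continuous fun s => (1 - s) • ∫ τ in (t - s)..t, F τ := by fun_prop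
  rw [delayAvg_eq hF]
  refine (norm_intervalIntegral_sq_le zero_le_one (hc'.intervalIntegrable _ _)
    ((hc'.norm.pow 2).intervalIntegrable _ _)).trans ?_
  rw [sub_zero, one_mul]
  refine intervalIntegral.integral_mono_on zero_le_one ((hc'.norm.pow 2).intervalIntegrable _ _)
    ((hc.norm.pow 2).intervalIntegrable _ _) fun s hs => ?_
  rw [norm_smul, mul_pow, Real.norm_eq_abs, sq_abs]
  have : (1 - s) ^ 2 ≤ 1 := by nlinarith [hs.1, hs.2]
  exact mul_le_of_le_one_left (by positivity) this

end

section
variable {L a₀ a₁ : ℝ} {k : ℕ} {g γ : ℝ → ℝ} {c : ℝ} {v₀ : L2 L} {η₀ u : ℝ → L2 L}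
variable [hL : Fact (0 < L)]

theorem IsSolution.continuous_extend (h : IsSolution L a₀ a₁ k g v₀ η₀ u) :
    Continuous fun t => u (max t 0) := ContinuousOn.extend_Ici h.cont

/-- On (0, 1] the kernel is at least g(1). Since t ≥ 1, delays up to 1 involve only u at nonnegative
times, so the delay integral is the history variable itself. -/
theorem IsSolution.integral_delay_sq_le (h : IsSolution L a₀ a₁ k g v₀ η₀ u)
    (hg : IsKernel g γ c) {t : ℝ} (ht : 1 ≤ t) :
    ∫ s in (0 : ℝ)..1, ‖∫ τ in (t - s)..t, u (max τ 0)‖ ^ 2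
      ≤ ‖(J ^ k : L2 L →L[ℝ] L2 L)‖ ^ 2 / g 1 * LgNormSq L k g (history u η₀ t) := by
  have hη := h.memLg t (by linarith)
  have g1 := hg.pos 1 zero_le_one
  have hc := (continuous_delay h.continuous_extend t).norm.pow 2
  have hpos : 0 ≤ᵐ[volume.restrict (Ioi 0)]
      fun s => g s * ‖wderiv L k (history u η₀ t s)‖ ^ 2 := by
    filter_upwards [ae_restrict_mem measurableSet_Ioi] with s (hs : 0 < s)
    have := (hg.pos s hs.le).le
    positivity
  have hsub : Ioc (0 : ℝ) 1 ⊆ Ioi 0 := fun s hs => hs.1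
  rw [intervalIntegral.integral_of_le zero_le_one]
  calc _ ≤ ∫ s in Ioc (0 : ℝ) 1, ‖(J ^ k : L2 L →L[ℝ] L2 L)‖ ^ 2 / g 1 *
        (g s * ‖wderiv L k (history u η₀ t s)‖ ^ 2) := by
        refine setIntegral_mono_on_ae ((hc.integrableOn_Icc).mono_set Ioc_subset_Icc_self)
          ((hη.integrable.mono_set hsub).const_mul _) measurableSet_Ioc ?_
        filter_upwards [(ae_restrict_iff' measurableSet_Ioi).1 hη.memH0] with s hs hs1
        have h1 := (hs hs1.1).norm_le
        have e : history u η₀ t s = ∫ τ in (t - s)..t, u (max τ 0) := by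
          rw [history, if_pos (by linarith [hs1.2]),
            intervalIntegral_extend_Ici u (by linarith [hs1.2]) (by linarith)]
        rw [← e]
        have h2 : g 1 ≤ g s := hg.antitoneOn hs1.1.le (mem_Ici.2 zero_le_one) hs1.2
        have h3 : 1 ≤ g s / g 1 := (one_le_div g1).2 h2
        calc _ ≤ (‖(J ^ k : L2 L →L[ℝ] L2 L)‖ * ‖wderiv L k (history u η₀ t s)‖) ^ 2 := by gcongr
          _ ≤ (g s / g 1) * (‖(J ^ k : L2 L →L[ℝ] L2 L)‖ *
              ‖wderiv L k (history u η₀ t s)‖) ^ 2 := le_mul_of_one_le_left (by positivity) h3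
          _ = _ := by ring
    _ = ‖(J ^ k : L2 L →L[ℝ] L2 L)‖ ^ 2 / g 1 *
        ∫ s in Ioc (0 : ℝ) 1, g s * ‖wderiv L k (history u η₀ t s)‖ ^ 2 := integral_const_mul _ _
    _ ≤ _ := by
        refine mul_le_mul_of_nonneg_left (setIntegral_mono_set hη.integrable hpos
          (Filter.Eventually.of_forall hsub)) (by positivity)

theorem IsTest.isAdjointTest {φ : ℝ → ℝ} (hφ : IsTest L φ) : IsAdjointTest L φ where
  smooth := hφ.smooth
  left := by simpa using hφ.iteratedDeriv_eq_zero 0 (x := 0) (by simp)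
  right := by simpa using hφ.iteratedDeriv_eq_zero 0 (x := L) (by simp)
  deriv_left := hφ.iteratedDeriv_eq_zero 1 (by simp)
  deriv_right := hφ.iteratedDeriv_eq_zero 1 (by simp)
  deriv2_left := hφ.iteratedDeriv_eq_zero 2 (by simp)

theorem exists_abs_weakRHS_le (a₀ a₁ : ℝ) (k : ℕ) {g γ : ℝ → ℝ} {c : ℝ} (hg : IsKernel g γ c)
    {φ : ℝ → ℝ} (hφ : IsTest L φ) : ∃ C : ℝ, 0 ≤ C ∧ ∀ (v : L2 L) (η : ℝ → L2 L), MemLg L k g η →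
      |weakRHS L a₀ a₁ k g v η φ| ≤ C * (‖v‖ + ‖quadSource v‖ + ‖memSource L k g η‖) := by
  set P := derivClass L hφ.smooth 3 - a₀ • derivClass L hφ.smooth 5 + a₁ • derivClass L hφ.smooth 1
  refine ⟨‖P‖ + ‖derivClass L hφ.smooth 2‖ + ‖derivClass L hφ.smooth k‖, by positivity,
    fun v η hη => ?_⟩
  rw [weakRHS_eq hg hη hφ.smooth (hφ.iteratedDeriv_eq_zero 1 (by simp))]
  have h1 := abs_le.1 (abs_real_inner_le_norm v P)
  have h2 := abs_le.1 (abs_real_inner_le_norm (quadSource v) (derivClass L hφ.smooth 2))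
  have h3 := abs_le.1 (abs_real_inner_le_norm (memSource L k g η) (derivClass L hφ.smooth k))
  have p1 := mul_nonneg (norm_nonneg v) (norm_nonneg P)
  have p2 := mul_nonneg (norm_nonneg (quadSource v)) (norm_nonneg (derivClass L hφ.smooth 2))
  have p3 := mul_nonneg (norm_nonneg v) (norm_nonneg (derivClass L hφ.smooth 2))
  have p4 := mul_nonneg (norm_nonneg v) (norm_nonneg (derivClass L hφ.smooth k))
  have p5 := mul_nonneg (norm_nonneg (quadSource v)) (norm_nonneg P)
  have p6 := mul_nonneg (norm_nonneg (quadSource v)) (norm_nonneg (derivClass L hφ.smooth k))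
  have p7 := mul_nonneg (norm_nonneg (memSource L k g η)) (norm_nonneg P)
  have p8 := mul_nonneg (norm_nonneg (memSource L k g η)) (norm_nonneg (derivClass L hφ.smooth 2))
  rw [abs_le]
  constructor <;> linarith [h1.1, h1.2, h2.1, h2.2, h3.1, h3.2]

/-- The weak formulation makes t ↦ ⟪u t, φ⟫ a primitive of a continuous function. Extended to all
times it can be differentiated classically, the only sense in which u itself is differentiated in
time. -/
theorem IsSolution.exists_hasDerivAt_inner (h : IsSolution L a₀ a₁ k g v₀ η₀ u)
    (hg : IsKernel g γ c) {φ : ℝ → ℝ} (hφ : IsTest L φ) :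
    ∃ α r : ℝ → ℝ, Continuous r ∧ (∀ t, HasDerivAt α (r t) t) ∧ ∀ t, 0 ≤ t →
      α t = ⟪u t, derivClass L hφ.smooth 0⟫_ℝ ∧
      r t = weakRHS L a₀ a₁ k g (u t) (history u η₀ t) φ := by
  have hm := h.continuousOn_memSource hg
  have hc := continuousOn_weakRHS hg h hm hφ.smooth (hφ.iteratedDeriv_eq_zero 1 (by simp))
  set r₀ := fun t => weakRHS L a₀ a₁ k g (u t) (history u η₀ t) φ
  have hr : Continuous fun t => r₀ (max t 0) := ContinuousOn.extend_Ici hc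
  refine ⟨fun t => ⟪u 0, derivClass L hφ.smooth 0⟫_ℝ + primitive (fun t => r₀ (max t 0)) t,
    fun t => r₀ (max t 0), hr, fun t => (hasDerivAt_primitive hr t).const_add _, fun t ht => ?_⟩
  refine ⟨?_, eq_extend_Ici r₀ ht⟩
  have e := h.inner_sub_eq hg hm hφ.isAdjointTest le_rfl ht
  rw [inner_sub_left] at e
  simp only [primitive]
  rw [intervalIntegral_extend_Ici r₀ le_rfl ht]
  linarith

/-- The finite rank operator `z ↦ ∑ ⟪e i, z⟫ φ i`. -/
def finiteRank {d : ℕ} (e φ : Fin d → L2 L) : L2 L →L[ℝ] L2 L :=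
  ∑ i, (innerSL ℝ (e i)).smulRight (φ i)

theorem finiteRank_apply {d : ℕ} (e φ : Fin d → L2 L) (z : L2 L) :
    finiteRank e φ z = ∑ i, ⟪e i, z⟫_ℝ • φ i := by
  simp [finiteRank]

/-- Lower bound for the derivative of ⟪u, Bβ⟫, with x = u and ρ the mean of the history. From ½⟪x,
Bx⟫ one gets ¼‖x‖² - ¼‖x - Bx‖²; the terms with β and ρ consume ‖x‖²/16 each, which leaves 1/8. -/
theorem observability_pointwise {E : Type*} [NormedAddCommGroup E] [InnerProductSpace ℝ E]
    (B : E →L[ℝ] E) {C Q R n m : ℝ} (hC : 0 ≤ C) {x β ρ : E} (hn : n ≤ Q * ‖x‖)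
    (hR : |R| ≤ C * (‖x‖ + n + m) * ‖β‖) :
    1 / 8 * ‖x‖ ^ 2 - 1 / 4 * ‖x - B x‖ ^ 2 - m ^ 2
        - (4 * C ^ 2 * (1 + Q) ^ 2 + C ^ 2 + 4 * ‖B‖ ^ 2) * (‖β‖ ^ 2 + ‖ρ‖ ^ 2)
      ≤ R + ⟪x, B ((1 / 2 : ℝ) • x - ρ)⟫_ℝ := by
  have h1 : ⟪x, B x⟫_ℝ = ‖x‖ ^ 2 - ⟪x, x - B x⟫_ℝ := by
    rw [inner_sub_right, real_inner_self_eq_norm_sq]; ring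
  have h2 := real_inner_le_norm x (x - B x)
  have h3 : ⟪x, B ρ⟫_ℝ ≤ ‖x‖ * (‖B‖ * ‖ρ‖) := (real_inner_le_norm _ _).trans
    (mul_le_mul_of_nonneg_left (B.le_opNorm ρ) (norm_nonneg _))
  have h4 : C * (‖x‖ + n + m) * ‖β‖ ≤ C * ((1 + Q) * ‖x‖ + m) * ‖β‖ := by
    gcongr; linarith
  have h5 := (abs_le.1 hR).1
  rw [map_sub, map_smul, inner_sub_right, inner_smul_right, h1]
  nlinarith [sq_nonneg (‖x‖ - ‖x - B x‖), sq_nonneg (‖x‖ / 4 - 2 * (‖B‖ * ‖ρ‖)),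
    sq_nonneg (‖x‖ / 4 - 2 * (C * (1 + Q) * ‖β‖)), sq_nonneg (m - C / 2 * ‖β‖),
    mul_nonneg (sq_nonneg (C * (1 + Q))) (sq_nonneg ‖ρ‖), mul_nonneg (sq_nonneg C) (sq_nonneg ‖ρ‖),
    mul_nonneg (sq_nonneg ‖B‖) (sq_nonneg ‖β‖), mul_nonneg (sq_nonneg C) (sq_nonneg ‖β‖)]

end

end
end Kawahara

/-! ### Integrated observability. -/

namespace Kawahara
noncomputable section
open scoped InnerProductSpace

section
variable {L a₀ a₁ : ℝ} {k : ℕ} {g γ : ℝ → ℝ} {c : ℝ} {v₀ : L2 L} {η₀ u : ℝ → L2 L}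

theorem LgNormSq_nonneg (hg : IsKernel g γ c) (η : ℝ → L2 L) : 0 ≤ LgNormSq L k g η :=
  setIntegral_nonneg measurableSet_Ioi fun s (hs : 0 < s) => by
    have := (hg.pos s hs.le).le
    positivity

theorem MemLg.norm_memSource_sq_le (hg : IsKernel g γ c) {η : ℝ → L2 L} (hη : MemLg L k g η) :
    ‖memSource L k g η‖ ^ 2 ≤ (∫ s in Ioi 0, g s) * LgNormSq L k g η := by
  have := norm_integral_weight_sq_le hg hg.isWeight_self hη.measurable hη.integrable
  rwa [one_pow, one_mul] at this

variable [hL : Fact (0 < L)]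

/-- Integrated observability: for a finite rank operator `B` whose range consists of test
functions, the functional `⟪u, B β⟫`, `β` a weighted mean of the history, controls `‖u‖²` from
below up to `‖u - B u‖²` and the memory. -/
theorem exists_observability (a₀ a₁ : ℝ) (k : ℕ) {g γ : ℝ → ℝ} {c : ℝ} (hg : IsKernel g γ c)
    (S : ℝ) {d : ℕ} (e : Fin d → L2 L) (φ : Fin d → ℝ → ℝ) (hφ : ∀ i, IsTest L (φ i)) :
    ∃ K : ℝ, 0 ≤ K ∧ ∀ {v₀ : L2 L} {η₀ u : ℝ → L2 L}, IsSolution L a₀ a₁ k g v₀ η₀ u →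
      (∀ t, 0 ≤ t → ‖u t‖ ≤ S) → ∃ Ψ : ℝ → ℝ, ContinuousOn Ψ (Ici 1) ∧
      (∀ t, 1 ≤ t → |Ψ t| ≤ K * (‖u t‖ ^ 2 + LgNormSq L k g (history u η₀ t))) ∧
      ∀ a b, 1 ≤ a → a ≤ b → ∫ t in a..b, (1 / 8 * ‖u t‖ ^ 2
        - 1 / 4 * ‖u t - finiteRank e (fun i => derivClass L (hφ i).smooth 0) (u t)‖ ^ 2
        - K * LgNormSq L k g (history u η₀ t)) ≤ Ψ b - Ψ a := by
  choose C hC hCle using fun i => exists_abs_weakRHS_le a₀ a₁ k hg (hφ i)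
  set B := finiteRank e (fun i => derivClass L (hφ i).smooth 0) with hB
  set C' := ∑ i, C i * ‖e i‖ with hC'
  have hC'0 : 0 ≤ C' := Finset.sum_nonneg fun i _ => mul_nonneg (hC i) (norm_nonneg _)
  set Q := Real.sqrt L * S with hQ
  set G := ∫ s in Ioi 0, g s with hG
  set D := ‖(J ^ k : L2 L →L[ℝ] L2 L)‖ ^ 2 / g 1 with hD
  set K₁ := 4 * C' ^ 2 * (1 + Q) ^ 2 + C' ^ 2 + 4 * ‖B‖ ^ 2 with hK₁
  have g1 := hg.pos 1 zero_le_one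
  have hD0 : 0 ≤ D := by positivity
  have hG0 : 0 ≤ G := setIntegral_nonneg measurableSet_Ioi fun s (hs : 0 < s) => (hg.pos s hs.le).le
  have hK₁0 : 0 ≤ K₁ := by positivity
  refine ⟨G + 2 * K₁ * D + ‖B‖ * (1 + D), by positivity, fun {v₀ η₀ u} h hS => ?_⟩
  have hF := h.continuous_extend
  set F := fun t => u (max t 0) with hFdef
  have hFt : ∀ t, 0 ≤ t → F t = u t := fun t ht => eq_extend_Ici u ht
  have hβ : ∀ t, 1 ≤ t → ‖delayAvg F t‖ ^ 2 ≤ D * LgNormSq L k g (history u η₀ t) := fun t ht =>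
    (norm_delayAvg_sq_le hF t).trans (h.integral_delay_sq_le hg ht)
  have hρ : ∀ t, 1 ≤ t → ‖delayMean F t‖ ^ 2 ≤ D * LgNormSq L k g (history u η₀ t) := fun t ht =>
    (norm_delayMean_sq_le hF t).trans (h.integral_delay_sq_le hg ht)
  choose α r hrc hα hαr using fun i => h.exists_hasDerivAt_inner hg (hφ i)
  set R := fun t => ∑ i, r i t * ⟪e i, delayAvg F t⟫_ℝ with hR
  set Ψ := fun t => ∑ i, α i t * ⟪e i, delayAvg F t⟫_ℝ with hΨ
  set Ψ' := fun t => R t + ∑ i, α i t * ⟪e i, (1 / 2 : ℝ) • F t - delayMean F t⟫_ℝ with hΨ'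
  -- Ψ is built from the differentiable scalars α and equals ⟪u, Bβ⟫ for t ≥ 0; in its derivative, R
  -- collects the terms in which the time derivative falls on u.
  have inner_B : ∀ t, 0 ≤ t → ∀ z, ∑ i, α i t * ⟪e i, z⟫_ℝ = ⟪u t, B z⟫_ℝ := fun t ht z => by
    rw [hB, finiteRank_apply, inner_sum]
    refine Finset.sum_congr rfl fun i _ => ?_
    rw [inner_smul_right, (hαr i t ht).1, mul_comm]
  have hder : ∀ t, HasDerivAt Ψ (Ψ' t) t := fun t => by
    have h1 : ∀ i, HasDerivAt (fun t => ⟪e i, delayAvg F t⟫_ℝ)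
        ⟪e i, (1 / 2 : ℝ) • F t - delayMean F t⟫_ℝ t := fun i =>
      ((innerSL ℝ (e i)).hasFDerivAt.comp_hasDerivAt t (hasDerivAt_delayAvg hF t))
    have := HasDerivAt.fun_sum (u := Finset.univ) fun i _ => (hα i t).mul (h1 i)
    refine this.congr_deriv ?_
    rw [Finset.sum_add_distrib]
  have cβ : Continuous (delayAvg F) :=
    continuous_iff_continuousAt.2 fun t => (hasDerivAt_delayAvg hF t).continuousAt
  have cα : ∀ i, Continuous (α i) := fun i =>
    continuous_iff_continuousAt.2 fun t => (hα i t).continuousAt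
  have cρ := continuous_delayMean hF
  have cΨ' : Continuous Ψ' := by
    have cd : Continuous fun t => (1 / 2 : ℝ) • F t - delayMean F t :=
      Continuous.sub (Continuous.const_smul hF (1 / 2 : ℝ)) cρ
    refine (continuous_finsetSum _ fun i _ => (hrc i).mul (continuous_const.inner cβ)).add
      (continuous_finsetSum _ fun i _ => (cα i).mul (continuous_const.inner cd))
  refine ⟨Ψ, fun t _ => (hder t).continuousAt.continuousWithinAt, fun t ht => ?_,
    fun a b ha hab => ?_⟩
  · have ht0 : 0 ≤ t := zero_le_one.trans ht
    have h1 : |Ψ t| ≤ ‖u t‖ * (‖B‖ * ‖delayAvg F t‖) := by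
      rw [hΨ]
      simp only
      rw [inner_B t ht0]
      exact (abs_real_inner_le_norm _ _).trans
        (mul_le_mul_of_nonneg_left (B.le_opNorm _) (norm_nonneg _))
    have hM := LgNormSq_nonneg (k := k) hg (history u η₀ t)
    have h2 := hβ t ht
    have h3 : ‖u t‖ * ‖delayAvg F t‖ ≤ (1 + D) * (‖u t‖ ^ 2 + LgNormSq L k g (history u η₀ t)) := by
      nlinarith [sq_nonneg (‖u t‖ - ‖delayAvg F t‖), mul_nonneg hD0 (sq_nonneg ‖u t‖)]
    calc |Ψ t| ≤ ‖B‖ * (‖u t‖ * ‖delayAvg F t‖) := h1.trans_eq (by ring)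
      _ ≤ ‖B‖ * ((1 + D) * (‖u t‖ ^ 2 + LgNormSq L k g (history u η₀ t))) := by gcongr
      _ = (‖B‖ * (1 + D)) * (‖u t‖ ^ 2 + LgNormSq L k g (history u η₀ t)) := by ring
      _ ≤ _ := by
        refine mul_le_mul_of_nonneg_right ?_ (by positivity)
        have : 0 ≤ 2 * K₁ * D := by positivity
        linarith
  · have ha0 : 0 ≤ a := zero_le_one.trans ha
    rw [← intervalIntegral.integral_eq_sub_of_hasDerivAt (fun t _ => hder t)
      (cΨ'.intervalIntegrable _ _)]
    have cM := h.continuousOn_LgNormSq hg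
    refine intervalIntegral.integral_mono_on hab (intervalIntegrable_of_Ici (ContinuousOn.sub
      (ContinuousOn.sub ((h.cont.norm.pow 2).const_smul (1 / 8 : ℝ)) (((h.cont.sub
      (B.continuous.comp_continuousOn h.cont)).norm.pow 2).const_smul (1 / 4 : ℝ)))
      (cM.const_smul (G + 2 * K₁ * D + ‖B‖ * (1 + D)))) ha0 (ha0.trans hab))
      (cΨ'.intervalIntegrable _ _) fun t ht => ?_
    have ht1 := ha.trans ht.1
    have ht0 : 0 ≤ t := zero_le_one.trans ht1
    have hn : ‖quadSource (u t)‖ ≤ Q * ‖u t‖ := (norm_quadSource_le (u t)).trans (by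
      rw [hQ, sq, ← mul_assoc]
      exact mul_le_mul_of_nonneg_right
        (mul_le_mul_of_nonneg_left (hS t ht0) (Real.sqrt_nonneg _)) (norm_nonneg _))
    have hRle : |R t| ≤ C' * (‖u t‖ + ‖quadSource (u t)‖ + ‖memSource L k g (history u η₀ t)‖)
        * ‖delayAvg F t‖ := by
      rw [hC', Finset.sum_mul, Finset.sum_mul]
      refine (Finset.abs_sum_le_sum_abs _ _).trans (Finset.sum_le_sum fun i _ => ?_)
      rw [abs_mul, (hαr i t ht0).2]
      calc _ ≤ C i * (‖u t‖ + ‖quadSource (u t)‖ + ‖memSource L k g (history u η₀ t)‖)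
            * (‖e i‖ * ‖delayAvg F t‖) :=
            mul_le_mul (hCle i _ _ (h.memLg t ht0)) (abs_real_inner_le_norm _ _) (abs_nonneg _)
              (mul_nonneg (hC i) (by positivity))
        _ = _ := by ring
    have key := observability_pointwise B hC'0 (ρ := delayMean F t) hn hRle
    have hM := LgNormSq_nonneg (k := k) hg (history u η₀ t)
    have e1 : Ψ' t = R t + ⟪u t, B ((1 / 2 : ℝ) • u t - delayMean F t)⟫_ℝ := by
      simp only [hΨ']
      rw [inner_B t ht0, hFt t ht0]
    have h5 := (h.memLg t ht0).norm_memSource_sq_le hg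
    have h6 : K₁ * (‖delayAvg F t‖ ^ 2 + ‖delayMean F t‖ ^ 2)
        ≤ K₁ * (2 * D * LgNormSq L k g (history u η₀ t)) :=
      mul_le_mul_of_nonneg_left (by linarith [hβ t ht1, hρ t ht1]) hK₁0
    have h7 : 0 ≤ ‖B‖ * (1 + D) * LgNormSq L k g (history u η₀ t) := by positivity
    rw [e1]
    refine le_trans ?_ key
    change 1 / 8 * ‖u t‖ ^ 2 - 1 / 4 * ‖u t - B (u t)‖ ^ 2 - _ * _ ≤ _
    linarith

end

end
end Kawahara

/-! ### The Lyapunov functional. -/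

namespace Kawahara
noncomputable section
open scoped InnerProductSpace

section
variable {L a₀ a₁ : ℝ} {k : ℕ} {g γ : ℝ → ℝ} {c : ℝ} {v₀ : L2 L} {η₀ u : ℝ → L2 L}
variable [hL : Fact (0 < L)]

/-- The quadratic source obeys ‖N‖² ≤ L‖u‖⁴ ≤ LS²‖u‖²: with an a priori bound S it is a lower order
linear term. -/
theorem integral_sources_le (hg : IsKernel g γ c) (h : IsSolution L a₀ a₁ k g v₀ η₀ u) {S : ℝ}
    (hS : ∀ t, 0 ≤ t → ‖u t‖ ≤ S) {a b : ℝ} (ha : 0 ≤ a) (hab : a ≤ b) :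
    (∫ t in a..b, ‖u t‖ ^ 2) + (∫ t in a..b, ‖quadSource (u t)‖ ^ 2)
        + (∫ t in a..b, ‖memSource L k g (history u η₀ t)‖ ^ 2)
      ≤ (1 + L * S ^ 2) * (∫ t in a..b, ‖u t‖ ^ 2)
        + (∫ s in Ioi 0, g s) * ∫ t in a..b, LgNormSq L k g (history u η₀ t) := by
  have hb := ha.trans hab
  have iu := intervalIntegrable_norm_sq h.cont ha hb
  have iN := intervalIntegrable_norm_sq (continuous_quadSource.comp_continuousOn h.cont) ha hb
  have im := intervalIntegrable_norm_sq (h.continuousOn_memSource hg) ha hb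
  have iM := intervalIntegrable_of_Ici (h.continuousOn_LgNormSq hg) ha hb
  have h1 : ∫ t in a..b, ‖quadSource (u t)‖ ^ 2 ≤ ∫ t in a..b, L * S ^ 2 * ‖u t‖ ^ 2 := by
    refine intervalIntegral.integral_mono_on hab iN (iu.const_mul _) fun t ht => ?_
    have ht0 := ha.trans ht.1
    calc ‖quadSource (u t)‖ ^ 2 ≤ (Real.sqrt L * ‖u t‖ ^ 2) ^ 2 := by
          gcongr; exact norm_quadSource_le _
      _ = L * ‖u t‖ ^ 2 * ‖u t‖ ^ 2 := by
          rw [mul_pow, Real.sq_sqrt hL.out.le]; ring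
      _ ≤ L * S ^ 2 * ‖u t‖ ^ 2 := by
          have := hL.out
          gcongr
          exact hS t ht0
  have h2 : ∫ t in a..b, ‖memSource L k g (history u η₀ t)‖ ^ 2
      ≤ ∫ t in a..b, (∫ s in Ioi 0, g s) * LgNormSq L k g (history u η₀ t) :=
    intervalIntegral.integral_mono_on hab im (iM.const_mul _) fun t ht =>
      (h.memLg t (ha.trans ht.1)).norm_memSource_sq_le hg
  rw [intervalIntegral.integral_const_mul] at h1 h2
  linarith

theorem IsKernel.integral_nonneg (hg : IsKernel g γ c) : 0 ≤ ∫ s in Ioi 0, g s :=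
  setIntegral_nonneg measurableSet_Ioi fun s (hs : 0 < s) => (hg.pos s hs.le).le

theorem exists_pos_sq_le {a κ j : ℝ} (ha : 0 < a) (hκ : 0 < κ) (hj : 0 ≤ j) :
    ∃ ε, 0 < ε ∧ κ * (ε * j) ^ 2 ≤ a := by
  refine ⟨Real.sqrt (a / κ) / (j + 1), by positivity, ?_⟩
  have h1 : Real.sqrt (a / κ) / (j + 1) * j ≤ Real.sqrt (a / κ) := by
    rw [div_mul_eq_mul_div, div_le_iff₀ (by positivity)]
    nlinarith [Real.sqrt_nonneg (a / κ)]
  calc _ ≤ κ * Real.sqrt (a / κ) ^ 2 := by gcongr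
    _ = a := by rw [Real.sq_sqrt (by positivity)]; field_simp

/-- An Ehrling type inequality: the part of w not captured by finitely many test functions is small
relative to w'', however large κ is. -/
theorem exists_finiteRank_sub_le (L : ℝ) [Fact (0 < L)] {a κ : ℝ} (ha : 0 < a) (hκ : 0 < κ) :
    ∃ (d : ℕ) (e : Fin d → L2 L) (φ : Fin d → ℝ → ℝ) (hφ : ∀ i, IsTest L (φ i)), ∀ z : L2 L,
      κ * ‖J (J z) - finiteRank e (fun i => derivClass L (hφ i).smooth 0) (J (J z))‖ ^ 2
        ≤ a * ‖z‖ ^ 2 := by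
  obtain ⟨ε, hε, hεle⟩ := exists_pos_sq_le ha hκ (norm_nonneg (J : L2 L →L[ℝ] L2 L))
  obtain ⟨d, e, φ, hφ, happ⟩ := exists_finiteRank_approx L hε
  refine ⟨d, e, φ, hφ, fun z => ?_⟩
  have h1 := happ (J z)
  rw [finiteRank_apply]
  calc _ ≤ κ * (ε * (‖(J : L2 L →L[ℝ] L2 L)‖ * ‖z‖)) ^ 2 := by
        have := (J : L2 L →L[ℝ] L2 L).le_opNorm z
        gcongr
        exact h1.trans (by gcongr)
    _ = κ * (ε * ‖(J : L2 L →L[ℝ] L2 L)‖) ^ 2 * ‖z‖ ^ 2 := by ring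
    _ ≤ _ := by gcongr

/-- A functional, bounded by the energy, whose decrease controls `‖u‖²` up to the memory. -/
theorem exists_lyapunov (L : ℝ) [Fact (0 < L)] {a₀ : ℝ} (ha₀ : 0 < a₀) (a₁ : ℝ) {k : ℕ}
    (hk : k ≤ 2) {g γ : ℝ → ℝ} {c : ℝ} (hg : IsKernel g γ c) (S : ℝ) :
    ∃ K : ℝ, 0 ≤ K ∧ ∀ {v₀ : L2 L} {η₀ u : ℝ → L2 L}, IsSolution L a₀ a₁ k g v₀ η₀ u →
      (∀ t, 0 ≤ t → ‖u t‖ ≤ S) → ∃ F : ℝ → ℝ, ContinuousOn F (Ici 1) ∧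
      (∀ t, 1 ≤ t → |F t| ≤ K * (‖u t‖ ^ 2 + LgNormSq L k g (history u η₀ t))) ∧
      ∀ a b, 1 ≤ a → a ≤ b → F b - F a ≤ ∫ t in a..b,
        (-‖u t‖ ^ 2 + K * LgNormSq L k g (history u η₀ t)) := by
  have hL0 : 0 < L := Fact.out
  obtain ⟨C, hC, key⟩ := IsSolution.exists_integrated_smoothing L ha₀ a₁ hk hg
  -- T exceeds the coefficient of ‖u‖² in the smoothing estimate. After division by T that estimate
  -- produces at most ‖u‖², and with κ = 4T it still provides 4‖u - Bu‖².
  set T := C * (1 + L * S ^ 2) + 1 with hT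
  have hT1 : 0 < T := by positivity
  obtain ⟨d, e, φ, hφ, happ⟩ := exists_finiteRank_sub_le L ha₀ (κ := 4 * T) (by positivity)
  obtain ⟨K, hK, obs⟩ := exists_observability a₀ a₁ k hg S e φ hφ
  set B := finiteRank e (fun i => derivClass L (hφ i).smooth 0) with hB
  set G := ∫ s in Ioi 0, g s with hG
  have hG0 : 0 ≤ G := hg.integral_nonneg
  refine ⟨16 * K + C * G / T + L / T, by positivity, fun {v₀ η₀ u} h hS => ?_⟩
  obtain ⟨Ψ, cΨ, Ψle, obsΨ⟩ := obs h hS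
  -- The factor 16 turns observability into -2‖u‖² + 4‖u - Bu‖² up to the memory. The scaled
  -- smoothing estimate cancels the second term and adds at most ‖u‖², so -‖u‖² remains.
  refine ⟨fun t => T⁻¹ * (1 / 2 * ⟪u t, X (u t)⟫_ℝ) - 16 * Ψ t, ?_, fun t ht => ?_,
    fun a b ha hab => ?_⟩
  · refine ContinuousOn.sub (ContinuousOn.mono ?_ (Ici_subset_Ici.2 zero_le_one))
      (continuousOn_const.mul cΨ)
    exact continuousOn_const.mul (continuousOn_const.mul
      (h.cont.inner (𝕜 := ℝ) (X.continuous.comp_continuousOn h.cont)))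
  · have hM := LgNormSq_nonneg (k := k) hg (history u η₀ t)
    have h1 : |⟪u t, X (u t)⟫_ℝ| ≤ L * ‖u t‖ ^ 2 := by
      refine (abs_real_inner_le_norm _ _).trans ?_
      nlinarith [norm_X_le (u t), norm_nonneg (u t)]
    have h2 := Ψle t ht
    have h3 : |T⁻¹ * (1 / 2 * ⟪u t, X (u t)⟫_ℝ)| ≤ L / T * ‖u t‖ ^ 2 := by
      rw [abs_mul, abs_mul, abs_of_pos (inv_pos.2 hT1), abs_of_pos (by norm_num : (0 : ℝ) < 1 / 2)]
      calc _ ≤ T⁻¹ * (L * ‖u t‖ ^ 2) := mul_le_mul_of_nonneg_left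
            (by linarith [abs_nonneg ⟪u t, X (u t)⟫_ℝ]) (inv_pos.2 hT1).le
        _ = _ := by ring
    refine (abs_sub _ _).trans ?_
    rw [abs_mul 16, abs_of_pos (by norm_num : (0 : ℝ) < 16)]
    have h4 : 0 ≤ C * G / T * (‖u t‖ ^ 2 + LgNormSq L k g (history u η₀ t)) := by positivity
    have h5 : 0 ≤ L / T * LgNormSq L k g (history u η₀ t) := by positivity
    linarith
  · have ha0 : 0 ≤ a := zero_le_one.trans ha
    have hb0 := ha0.trans hab
    have iu := intervalIntegrable_norm_sq h.cont ha0 hb0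
    have iM := intervalIntegrable_of_Ici (h.continuousOn_LgNormSq hg) ha0 hb0
    have iD : IntervalIntegrable (fun t => ‖u t - B (u t)‖ ^ 2) volume a b :=
      intervalIntegrable_norm_sq (h.cont.sub (B.continuous.comp_continuousOn h.cont)) ha0 hb0
    have s1 := (key h ha0 hab).1 (ContinuousLinearMap.id ℝ (L2 L) - B) (4 * T) happ
    have s2 := mul_le_mul_of_nonneg_left (integral_sources_le hg h hS ha0 hab) hC
    have s3 := obsΨ a b ha hab
    have e1 : ∫ t in a..b, ‖(ContinuousLinearMap.id ℝ (L2 L) - B) (u t)‖ ^ 2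
      = ∫ t in a..b, ‖u t - B (u t)‖ ^ 2 := rfl
    rw [intervalIntegral.integral_sub ((iu.const_mul _).sub (iD.const_mul _)) (iM.const_mul _),
      intervalIntegral.integral_sub (iu.const_mul _) (iD.const_mul _),
      intervalIntegral.integral_const_mul, intervalIntegral.integral_const_mul,
      intervalIntegral.integral_const_mul] at s3
    have iu' : IntervalIntegrable (fun t => -‖u t‖ ^ 2) volume a b := iu.neg
    rw [intervalIntegral.integral_add iu' (iM.const_mul _), intervalIntegral.integral_const_mul,
      intervalIntegral.integral_neg]
    change T⁻¹ * (1 / 2 * ⟪u b, X (u b)⟫_ℝ) - 16 * Ψ b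
      - (T⁻¹ * (1 / 2 * ⟪u a, X (u a)⟫_ℝ) - 16 * Ψ a) ≤ _
    rw [e1] at s1
    have pu : 0 ≤ ∫ t in a..b, ‖u t‖ ^ 2 :=
      intervalIntegral.integral_nonneg hab fun t _ => by positivity
    have pM : 0 ≤ ∫ t in a..b, LgNormSq L k g (history u η₀ t) :=
      intervalIntegral.integral_nonneg hab fun t _ => LgNormSq_nonneg hg _
    generalize (∫ t in a..b, ‖u t‖ ^ 2) = Iu at *
    generalize (∫ t in a..b, LgNormSq L k g (history u η₀ t)) = IM at *
    generalize (∫ t in a..b, ‖u t - B (u t)‖ ^ 2) = ID at *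
    have s4 := mul_le_mul_of_nonneg_left (s1.trans s2) (inv_pos.2 hT1).le
    have e2 : T⁻¹ * (1 / 2 * ⟪u b, X (u b)⟫_ℝ - 1 / 2 * ⟪u a, X (u a)⟫_ℝ + 4 * T * ID)
      = T⁻¹ * (1 / 2 * ⟪u b, X (u b)⟫_ℝ) - T⁻¹ * (1 / 2 * ⟪u a, X (u a)⟫_ℝ) + 4 * ID := by
      field_simp
    have e3 : T⁻¹ * (C * ((1 + L * S ^ 2) * Iu + G * IM)) ≤ Iu + C * G / T * IM := by
      have : T⁻¹ * (C * ((1 + L * S ^ 2) * Iu + G * IM))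
        = Iu + C * G / T * IM - T⁻¹ * Iu := by
        rw [eq_sub_iff_add_eq]
        have : (C * (1 + L * S ^ 2) + 1) / T = 1 := div_self hT1.ne'
        linear_combination Iu * this
      have : 0 ≤ T⁻¹ * Iu := by positivity
      linarith
    rw [e2] at s4
    have : 0 ≤ L / T * IM := by positivity
    linarith

end

end
end Kawahara

/-! ### The part of the memory from before time 0, and the function h. -/

namespace Kawahara
noncomputable section
open scoped InnerProductSpace

section
variable {L a₀ a₁ : ℝ} {k : ℕ} {g γ : ℝ → ℝ} {c : ℝ} {v₀ : L2 L} {η₀ u : ℝ → L2 L}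

theorem integral_hHist_eq (L : ℝ) (k : ℕ) (g : ℝ → ℝ) (η₀ : ℝ → L2 L) (t : ℝ) :
    ∫ s in Ioi t, g s * hHist L k η₀ t s
      = ∫ s in Ioi 0, g (s + t) * (t ^ 2 + t + ‖wderiv L k (η₀ s)‖ ^ 2) := by
  rw [setIntegral_Ioi_shift]
  simp only [hHist, add_sub_cancel_right]

theorem IsKernel.integrableOn_shift (hg : IsKernel g γ c) {t : ℝ} (ht : 0 ≤ t) :
    IntegrableOn (fun s => g (s + t)) (Ioi 0) := by
  refine hg.integrable.mono' (hg.isWeight_shift ht).meas ?_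
  filter_upwards [ae_restrict_mem measurableSet_Ioi] with s hs
  rw [Real.norm_of_nonneg ((hg.isWeight_shift ht).nonneg s hs)]
  simpa using (hg.isWeight_shift ht).le s hs

theorem MemLg.integrableOn_shift (hg : IsKernel g γ c) {η : ℝ → L2 L} (hη : MemLg L k g η) {t : ℝ}
    (ht : 0 ≤ t) : IntegrableOn (fun s => g (s + t) * ‖wderiv L k (η s)‖ ^ 2) (Ioi 0) :=
  integrable_weight_sq (hg.isWeight_shift ht) hη.measurable hη.integrable

theorem MemLg.integral_hHist (hg : IsKernel g γ c) (hη : MemLg L k g η₀) {t : ℝ} (ht : 0 ≤ t) :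
    ∫ s in Ioi t, g s * hHist L k η₀ t s = (t ^ 2 + t) * (∫ s in Ioi 0, g (s + t))
      + ∫ s in Ioi 0, g (s + t) * ‖wderiv L k (η₀ s)‖ ^ 2 := by
  rw [integral_hHist_eq, ← integral_const_mul, ← integral_add
    ((hg.integrableOn_shift ht).const_mul _) (hη.integrableOn_shift hg ht)]
  refine integral_congr_ae (ae_of_all _ fun s => ?_)
  simp only
  ring

theorem IsKernel.continuousOn_integral_shift (hg : IsKernel g γ c) {q : ℝ → ℝ}
    (hq : AEStronglyMeasurable q (volume.restrict (Ioi 0)))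
    (hq2 : IntegrableOn (fun s => g s * q s) (Ioi 0)) :
    ContinuousOn (fun t => ∫ s in Ioi 0, g (s + t) * q s) (Ici 0) := by
  refine continuousOn_of_dominated (bound := fun s => ‖g s * q s‖)
    (fun t ht => (hg.isWeight_shift ht).meas.mul hq) (fun t (ht : 0 ≤ t) => ?_) hq2.norm ?_
  · filter_upwards [ae_restrict_mem measurableSet_Ioi] with s (hs : 0 < s)
    have h1 := (hg.isWeight_shift ht).nonneg s hs
    have h2 := (hg.isWeight_shift ht).le s hs
    rw [one_mul] at h2
    rw [norm_mul, norm_mul, Real.norm_of_nonneg h1, Real.norm_of_nonneg (h1.trans h2)]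
    gcongr
  · filter_upwards [ae_restrict_mem measurableSet_Ioi] with s (hs : 0 < s)
    refine ContinuousOn.mul (hg.cont.comp (by fun_prop) fun t ht => ?_) continuousOn_const
    exact add_nonneg hs.le (mem_Ici.1 ht)

theorem MemLg.continuousOn_integral_hHist (hg : IsKernel g γ c) (hη : MemLg L k g η₀) :
    ContinuousOn (fun t => ∫ s in Ioi t, g s * hHist L k η₀ t s) (Ici 0) := by
  have h1 := hg.continuousOn_integral_shift (q := fun _ => 1) aestronglyMeasurable_const
    (by simpa using hg.integrable)
  have h2 := hg.continuousOn_integral_shift (hη.measurable.norm.pow 2) hη.integrable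
  simp only [mul_one] at h1
  refine ContinuousOn.congr (f := fun t => (t ^ 2 + t) * (∫ s in Ioi 0, g (s + t))
    + ∫ s in Ioi 0, g (s + t) * ‖wderiv L k (η₀ s)‖ ^ 2) ?_ fun t ht => hη.integral_hHist hg ht
  exact ContinuousOn.add (ContinuousOn.mul (by fun_prop) h1) h2

theorem integral_hHist_nonneg (hg : IsKernel g γ c) {t : ℝ} (ht : 0 ≤ t) :
    0 ≤ ∫ s in Ioi t, g s * hHist L k η₀ t s :=
  setIntegral_nonneg measurableSet_Ioi fun s (hs : t < s) => by
    have := (hg.pos s (ht.trans hs.le)).le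
    unfold hHist
    positivity

/-- The weak derivative commutes with the time integral of the past, for almost every s; thus the
rate for a given past reduces to the one for η⁰. -/
theorem IsPastOf.integral_hPast_eq {u₀ : ℝ → L2 L} (h : IsPastOf L k u₀ η₀) (g : ℝ → ℝ) (t : ℝ) :
    ∫ s in Ioi t, g s * hPast L k u₀ t s = ∫ s in Ioi t, g s * hHist L k η₀ t s := by
  rw [integral_hHist_eq, setIntegral_Ioi_shift]
  simp only [hPast, add_sub_cancel_right]
  refine integral_congr_ae ?_
  filter_upwards [h.eq_integral, ae_restrict_mem measurableSet_Ioi] with s hs (hs0 : 0 < s)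
  have hint : ∀ j ≤ k, IntegrableOn (fun τ => wderiv L j (u₀ τ)) (Ioc 0 s) := fun j hj =>
    (integrableOn_Ioc_iff_integrableOn_Ioo (by simp)).2 (h.integrable s hs0 j hj)
  have hw : HasWeakDeriv L k (∫ τ in Ioc 0 s, u₀ τ) (∫ τ in Ioc 0 s, wderiv L k (u₀ τ)) := by
    refine HasWeakDeriv.integral ?_ ?_ (hint k le_rfl)
    · filter_upwards [ae_mono (Measure.restrict_mono (fun x hx => hx.1) le_rfl) h.memH0] with τ hτ
      exact hτ.hasWeakDeriv le_rfl
    · have := hint 0 (Nat.zero_le _)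
      simp only [wderiv_zero] at this
      exact this
  rw [hs, intervalIntegral.integral_of_le hs0.le, intervalIntegral.integral_of_le hs0.le,
    hw.wderiv_eq]

theorem IsPastOf.generalRate_eq {u₀ : ℝ → L2 L} (h : IsPastOf L k u₀ η₀) (g ξ : ℝ → ℝ) (c t : ℝ) :
    generalRate g ξ (hPast L k u₀) c t = generalRate g ξ (hHist L k η₀) c t := by
  simp only [generalRate, h.integral_hPast_eq]

variable [hL : Fact (0 < L)]

/-- The displacement `∫_0^t ∂_x^k u` grows at most linearly. -/
theorem exists_norm_integral_wderiv_sq_le (L : ℝ) [Fact (0 < L)] {a₀ : ℝ} (ha₀ : 0 < a₀) (a₁ : ℝ)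
    {k : ℕ} (hk : k ≤ 2) {g γ : ℝ → ℝ} {c : ℝ} (hg : IsKernel g γ c) (S : ℝ) :
    ∃ K : ℝ, 0 ≤ K ∧ ∀ {v₀ : L2 L} {η₀ u : ℝ → L2 L}, IsSolution L a₀ a₁ k g v₀ η₀ u →
      (∀ t, 0 ≤ t → ‖u t‖ ≤ S) → (∀ t, 0 ≤ t → LgNormSq L k g (history u η₀ t) ≤ S ^ 2) →
      ∀ t, 0 ≤ t → ‖∫ τ in (0 : ℝ)..t, wderiv L k (u τ)‖ ^ 2 ≤ K * (t ^ 2 + t) := by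
  have hL0 : 0 < L := Fact.out
  obtain ⟨C, hC, key⟩ := IsSolution.exists_integrated_smoothing L ha₀ a₁ hk hg
  set G := ∫ s in Ioi 0, g s with hG
  have hG0 : 0 ≤ G := hg.integral_nonneg
  set j := ‖(J ^ (2 - k) : L2 L →L[ℝ] L2 L)‖ with hj
  set K₁ := L * S ^ 2 + C * ((1 + L * S ^ 2) * S ^ 2 + G * S ^ 2) with hK₁
  have hK₁0 : 0 ≤ K₁ := by positivity
  refine ⟨j ^ 2 / a₀ * K₁, by positivity, fun {v₀ η₀ u} h hS hM t ht => ?_⟩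
  have hS0 : 0 ≤ S := (norm_nonneg _).trans (hS 0 le_rfl)
  have h1 := (integral_wderiv_mem h le_rfl ht).2.2 k (2 - k) (by omega)
  have h2 := (J ^ (2 - k) : L2 L →L[ℝ] L2 L).le_opNorm (∫ τ in (0 : ℝ)..t, wderiv L 2 (u τ))
  have h3 := (key h le_rfl ht).2
  have h4 := integral_sources_le hg h hS le_rfl ht
  have bd : ∀ {q : ℝ → ℝ}, ContinuousOn q (Ici 0) → (∀ t, 0 ≤ t → q t ≤ S ^ 2) →
      ∫ τ in (0 : ℝ)..t, q τ ≤ t * S ^ 2 := fun {q} hq hb => by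
    have := intervalIntegral.integral_mono_on ht (intervalIntegrable_of_Ici hq le_rfl ht)
      intervalIntegrable_const fun τ hτ => hb τ hτ.1
    simpa using this
  have h5 := bd (h.cont.norm.pow 2) fun t ht => pow_le_pow_left₀ (norm_nonneg _) (hS t ht) 2
  have h6 := bd (h.continuousOn_LgNormSq hg) hM
  have h7 : 1 / 2 * ⟪u 0, X (u 0)⟫_ℝ ≤ L * S ^ 2 := by
    have e1 := real_inner_le_norm (u 0) (X (u 0))
    have e2 := norm_X_le (u 0)
    have e3 := hS 0 le_rfl
    have e4 : ‖u 0‖ * ‖X (u 0)‖ ≤ S * (L * S) :=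
      mul_le_mul e3 (e2.trans (by gcongr)) (norm_nonneg _) hS0
    have e5 : 0 ≤ L * S ^ 2 := by positivity
    linarith
  -- The factor t comes from Cauchy-Schwarz in time; the smoothing bound it multiplies is the
  -- initial term plus sources that grow at most linearly.
  have h8 : a₀ * ‖∫ τ in (0 : ℝ)..t, wderiv L 2 (u τ)‖ ^ 2 ≤ K₁ * (t ^ 2 + t) := by
    refine h3.trans ?_
    rw [sub_zero]
    have e1 : (1 + L * S ^ 2) * (∫ τ in (0 : ℝ)..t, ‖u τ‖ ^ 2)
        + G * ∫ τ in (0 : ℝ)..t, LgNormSq L k g (history u η₀ τ)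
        ≤ (1 + L * S ^ 2) * (t * S ^ 2) + G * (t * S ^ 2) := by gcongr; exact h5
    have e2 := mul_le_mul_of_nonneg_left (h4.trans e1) hC
    calc _ ≤ t * (L * S ^ 2 + C * ((1 + L * S ^ 2) * (t * S ^ 2) + G * (t * S ^ 2))) := by gcongr
      _ = K₁ * (t ^ 2 + t) - (t ^ 2 * (L * S ^ 2)
          + t * (C * ((1 + L * S ^ 2) * S ^ 2 + G * S ^ 2))) := by rw [hK₁]; ring
      _ ≤ _ := sub_le_self _ (by positivity)
  rw [h1]
  calc _ ≤ (j * ‖∫ τ in (0 : ℝ)..t, wderiv L 2 (u τ)‖) ^ 2 := by gcongr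
    _ = j ^ 2 / a₀ * (a₀ * ‖∫ τ in (0 : ℝ)..t, wderiv L 2 (u τ)‖ ^ 2) := by field_simp
    _ ≤ j ^ 2 / a₀ * (K₁ * (t ^ 2 + t)) := by gcongr
    _ = _ := by ring

/-- The part of the memory norm that stems from the time before `0`. -/
theorem IsSolution.integral_old_history_le (h : IsSolution L a₀ a₁ k g v₀ η₀ u) (hk : k ≤ 2)
    (hg : IsKernel g γ c) (hη : MemLg L k g η₀) {K t : ℝ} (hK : 0 ≤ K) (ht : 0 ≤ t)
    (hd : ‖∫ τ in (0 : ℝ)..t, wderiv L k (u τ)‖ ^ 2 ≤ K * (t ^ 2 + t)) :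
    ∫ s in Ioi t, g s * ‖wderiv L k (history u η₀ t s)‖ ^ 2
      ≤ 2 * (K + 1) * ∫ s in Ioi t, g s * hHist L k η₀ t s := by
  rw [integral_hHist_eq, setIntegral_Ioi_shift, ← integral_const_mul]
  have hi : IntegrableOn (fun s => 2 * (K + 1) * (g (s + t) *
      (t ^ 2 + t + ‖wderiv L k (η₀ s)‖ ^ 2))) (Ioi 0) := by
    refine Integrable.const_mul ?_ _
    simp only [mul_add (g _)]
    exact ((hg.integrableOn_shift ht).mul_const _ |>.add ((hg.integrableOn_shift ht).mul_const _)).add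
      (hη.integrableOn_shift hg ht)
  refine integral_mono_of_nonneg ?_ hi ?_
  · filter_upwards [ae_restrict_mem measurableSet_Ioi] with s (hs : 0 < s)
    have := (hg.pos (s + t) (by linarith)).le
    positivity
  · filter_upwards [h.wderiv_history_add hk le_rfl ht, ae_restrict_mem measurableSet_Ioi]
      with s hs (hs0 : 0 < s)
    rw [zero_add] at hs
    have e : history u η₀ 0 s = η₀ s := by simp [history, not_le.2 hs0]
    rw [hs, e]
    have hgs := (hg.pos (s + t) (by linarith)).le
    set x := wderiv L k (η₀ s)
    set y := ∫ τ in (0 : ℝ)..t, wderiv L k (u τ)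
    have h1 : ‖x + y‖ ^ 2 ≤ 2 * ‖x‖ ^ 2 + 2 * ‖y‖ ^ 2 := by
      have := pow_le_pow_left₀ (norm_nonneg _) (norm_add_le x y) 2
      nlinarith [sq_nonneg (‖x‖ - ‖y‖)]
    have h2 : ‖x + y‖ ^ 2 ≤ 2 * (K + 1) * (t ^ 2 + t + ‖x‖ ^ 2) := by
      have : 0 ≤ K * ‖x‖ ^ 2 := by positivity
      nlinarith
    calc _ ≤ g (s + t) * (2 * (K + 1) * (t ^ 2 + t + ‖x‖ ^ 2)) := by gcongr
      _ = _ := by ring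

theorem setIntegral_Ioi_eq_add {q : ℝ → ℝ} (hq : IntegrableOn q (Ioi 0)) {t : ℝ} (ht : 0 ≤ t) :
    ∫ s in Ioi 0, q s = (∫ s in Ioc 0 t, q s) + ∫ s in Ioi t, q s := by
  rw [← Ioc_union_Ioi_eq_Ioi ht]
  exact setIntegral_union (Ioc_disjoint_Ioi le_rfl) measurableSet_Ioi
    (hq.mono_set fun s hs => hs.1) (hq.mono_set (Ioi_subset_Ioi ht))

theorem IsSolution.mul_integral_le_memDissipation (h : IsSolution L a₀ a₁ k g v₀ η₀ u)
    (hg : IsKernel g γ c) {t r : ℝ} (ht : 0 ≤ t) {A : Set ℝ} (hA : MeasurableSet A)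
    (hA0 : A ⊆ Ioi 0) (hr : ∀ s ∈ A, r * g s ≤ γ s) :
    r * (∫ s in A, g s * ‖wderiv L k (history u η₀ t s)‖ ^ 2)
      ≤ memDissipation L k γ (history u η₀ t) := by
  have hη := h.memLg t ht
  have hi := integrable_weight_sq hg.isWeight_deriv hη.measurable hη.integrable
  rw [← integral_const_mul]
  calc _ ≤ ∫ s in A, γ s * ‖wderiv L k (history u η₀ t s)‖ ^ 2 := by
        refine setIntegral_mono_on ((hη.integrable.mono_set hA0).const_mul r) (hi.mono_set hA0) hA
          fun s hs => ?_
        rw [← mul_assoc]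
        exact mul_le_mul_of_nonneg_right (hr s hs) (sq_nonneg _)
    _ ≤ _ := by
        refine setIntegral_mono_set hi ?_ (Filter.Eventually.of_forall hA0)
        filter_upwards [ae_restrict_mem measurableSet_Ioi] with s (hs : 0 < s)
        exact mul_nonneg (hg.nonneg s hs.le) (sq_nonneg _)

/-- Split the history at s = t. For s ≤ t monotonicity of ξ gives ξ(t)g(s) ≤ ξ(s)g(s) ≤ γ(s), so the
dissipation dominates; for s > t this comparison fails and the growth bound for the displacement
takes over. -/
theorem IsSolution.mul_LgNormSq_le (h : IsSolution L a₀ a₁ k g v₀ η₀ u) (hk : k ≤ 2)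
    (hg : IsKernel g γ c) (hη : MemLg L k g η₀) {ξ : ℝ → ℝ} (hξ : ∀ s, 0 ≤ s → 0 ≤ ξ s)
    (hξa : AntitoneOn ξ (Ici 0)) (hξγ : ∀ s, 0 ≤ s → ξ s * g s ≤ γ s) {K t : ℝ} (hK : 0 ≤ K)
    (ht : 0 ≤ t) (hd : ‖∫ τ in (0 : ℝ)..t, wderiv L k (u τ)‖ ^ 2 ≤ K * (t ^ 2 + t)) :
    ξ t * LgNormSq L k g (history u η₀ t) ≤ memDissipation L k γ (history u η₀ t)
      + 2 * (K + 1) * (ξ t * ∫ s in Ioi t, g s * hHist L k η₀ t s) := by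
  rw [LgNormSq, setIntegral_Ioi_eq_add (h.memLg t ht).integrable ht, mul_add]
  have h1 := h.mul_integral_le_memDissipation hg ht (A := Ioc 0 t) measurableSet_Ioc
    (fun s hs => hs.1) (r := ξ t) fun s hs => by
      refine le_trans ?_ (hξγ s hs.1.le)
      exact mul_le_mul_of_nonneg_right (hξa hs.1.le ht hs.2) (hg.pos s hs.1.le).le
  have h2 := mul_le_mul_of_nonneg_left (h.integral_old_history_le hk hg hη hK ht hd) (hξ t ht)
  linarith

end

end
end Kawahara

/-! ### Integral inequalities with weights, and Grönwall's argument. -/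

namespace Kawahara
noncomputable section

section

theorem antitoneOn_sub_integral {F r : ℝ → ℝ} {a b : ℝ} (hr : ContinuousOn r (Icc a b))
    (hFr : ∀ x y, a ≤ x → x ≤ y → y ≤ b → F y - F x ≤ ∫ t in x..y, r t) :
    AntitoneOn (fun t => F t - F a - ∫ τ in a..t, r τ) (Icc a b) := by
  intro x hx y hy hxy
  have hi : ∀ z ∈ Icc a b, IntervalIntegrable r volume a z := fun z hz =>
    (hr.mono (Icc_subset_Icc le_rfl hz.2)).intervalIntegrable_of_Icc hz.1
  have h1 := hFr x y hx.1 hxy hy.2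
  rw [← intervalIntegral.integral_interval_sub_left (hi y hy) (hi x hx)] at h1
  simp only
  linarith

/-- Multiplication of an integrated differential inequality by a monotone or antitone weight. -/
theorem mul_sub_le_integral {F r m m' : ℝ → ℝ} {a b : ℝ} (hab : a ≤ b)
    (hF : ContinuousOn F (Icc a b)) (hr : ContinuousOn r (Icc a b))
    (hFr : ∀ x y, a ≤ x → x ≤ y → y ≤ b → F y - F x ≤ ∫ t in x..y, r t)
    (hm : ∀ t ∈ Icc a b, HasDerivAt m (m' t) t) (hm' : ContinuousOn m' (Icc a b))
    (hm0 : ∀ t ∈ Icc a b, 0 ≤ m t)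
    (hsign : (∀ t ∈ Icc a b, 0 ≤ m' t) ∨ ∀ t ∈ Icc a b, m' t ≤ 0) :
    m b * F b - m a * F a ≤ ∫ t in a..b, (m' t * F t + m t * r t) := by
  have hmc : ContinuousOn m (Icc a b) := fun t ht => (hm t ht).continuousAt.continuousWithinAt
  have ha := left_mem_Icc.2 hab
  have hb := right_mem_Icc.2 hab
  set R := fun t => F a + ∫ τ in a..t, r τ with hR
  have hRc : ContinuousOn R (Icc a b) := by
    refine continuousOn_const.add ?_
    have := intervalIntegral.continuousOn_primitive_interval (μ := volume) (f := r) (a := a) (b := b)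
      (by rw [uIcc_of_le hab]; exact hr.integrableOn_Icc)
    rwa [uIcc_of_le hab] at this
  have hRd : ∀ t ∈ Ioo a b, HasDerivAt R (r t) t := fun t ht => by
    refine HasDerivAt.const_add _ (intervalIntegral.integral_hasDerivAt_right ?_ ?_ ?_)
    · exact (hr.mono (Icc_subset_Icc le_rfl ht.2.le)).intervalIntegrable_of_Icc ht.1.le
    · exact (hr.mono Ioo_subset_Icc_self).stronglyMeasurableAtFilter isOpen_Ioo t ht
    · exact hr.continuousAt (Icc_mem_nhds ht.1 ht.2)
  have parts : ∫ t in a..b, m t * r t = m b * R b - m a * R a - ∫ t in a..b, m' t * R t := by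
    refine intervalIntegral.integral_mul_deriv_eq_deriv_mul_of_hasDeriv_right
      (by rwa [uIcc_of_le hab]) (by rwa [uIcc_of_le hab]) (fun t ht => ?_) (fun t ht => ?_)
      (hm'.intervalIntegrable_of_Icc hab) (hr.intervalIntegrable_of_Icc hab)
    · rw [min_eq_left hab, max_eq_right hab] at ht
      exact (hm t (Ioo_subset_Icc_self ht)).hasDerivWithinAt
    · rw [min_eq_left hab, max_eq_right hab] at ht
      exact (hRd t ht).hasDerivWithinAt
  have hD := antitoneOn_sub_integral hr hFr
  set D := fun t => F t - F a - ∫ τ in a..t, r τ with hDdef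
  have hDa : D a = 0 := by simp [hDdef]
  have hFD : ∀ t, F t = R t + D t := fun t => by simp only [hR, hDdef]; ring
  have hDc : ContinuousOn D (Icc a b) := by
    refine (hF.sub hRc).congr fun t _ => ?_
    simp only [hR, hDdef, Pi.sub_apply]; ring
  have i1 : IntervalIntegrable (fun t => m' t * R t) volume a b :=
    (hm'.mul hRc).intervalIntegrable_of_Icc hab
  have i2 : IntervalIntegrable (fun t => m' t * D t) volume a b :=
    (hm'.mul hDc).intervalIntegrable_of_Icc hab
  have i3 : IntervalIntegrable (fun t => m t * r t) volume a b :=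
    (hmc.mul hr).intervalIntegrable_of_Icc hab
  have hsplit : ∫ t in a..b, (m' t * F t + m t * r t)
      = (∫ t in a..b, m' t * R t) + (∫ t in a..b, m' t * D t) + ∫ t in a..b, m t * r t := by
    rw [← intervalIntegral.integral_add i1 i2, ← intervalIntegral.integral_add (i1.add i2) i3]
    congr 1
    funext t
    rw [hFD t]; ring
  have hDb : D b ≤ 0 := hDa ▸ hD ha hb hab
  -- F is an absolutely continuous part R plus a nonincreasing D ≤ 0, and only D needs an
  -- inequality. If m increases, bound D below by D(b) and use m(a) ≥ 0; if m decreases, the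
  -- integrand is nonnegative while the left side is nonpositive.
  have main : m b * D b ≤ ∫ t in a..b, m' t * D t := by
    rcases hsign with hs | hs
    · have h1 : ∫ t in a..b, m' t = m b - m a :=
        intervalIntegral.integral_eq_sub_of_hasDerivAt
          (fun t ht => hm t (by rwa [uIcc_of_le hab] at ht)) (hm'.intervalIntegrable_of_Icc hab)
      have h2 : ∫ t in a..b, m' t * D b ≤ ∫ t in a..b, m' t * D t :=
        intervalIntegral.integral_mono_on hab
          ((hm'.mul continuousOn_const).intervalIntegrable_of_Icc hab) i2 fun t ht =>
          mul_le_mul_of_nonneg_left (hD ht hb ht.2) (hs t ht)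
      rw [intervalIntegral.integral_mul_const, h1] at h2
      nlinarith [hm0 a ha]
    · have h2 : 0 ≤ ∫ t in a..b, m' t * D t :=
        intervalIntegral.integral_nonneg hab fun t ht => by
          have := hD ha ht ht.1
          rw [hDa] at this
          nlinarith [hs t ht]
      nlinarith [hm0 b hb]
  rw [hsplit, parts, hFD b, hFD a, hDa]
  linarith

/-- A Grönwall inequality with weight `ξ` for functionals that are comparable to `E`. -/
theorem decay_of_lyapunov {E M D H F ξ ξ' : ℝ → ℝ} {K C : ℝ} (hK : 0 ≤ K) (hC : 0 ≤ C)
    (hξc : ContinuousOn ξ (Ici 0)) (hξ'c : ContinuousOn ξ' (Ici 0))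
    (hξd : ∀ t, 0 < t → HasDerivAt ξ (ξ' t) t) (hξ0 : ∀ t, 0 ≤ t → 0 ≤ ξ t)
    (hξ' : ∀ t, 0 ≤ t → ξ' t ≤ 0) (hEc : ContinuousOn E (Ici 0)) (hMc : ContinuousOn M (Ici 0))
    (hDc : ContinuousOn D (Ici 0)) (hHc : ContinuousOn H (Ici 0)) (hFc : ContinuousOn F (Ici 1))
    (hE0 : ∀ t, 0 ≤ t → 0 ≤ E t) (hD0 : ∀ t, 0 ≤ t → 0 ≤ D t) (hH0 : ∀ t, 0 ≤ t → 0 ≤ H t)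
    (hE : ∀ a b, 0 ≤ a → a ≤ b → E b + 1 / 2 * (∫ t in a..b, D t) ≤ E a)
    (hF : ∀ a b, 1 ≤ a → a ≤ b → F b - F a ≤ ∫ t in a..b, (-2 * E t + (K + 1) * M t))
    (hFE : ∀ t, 1 ≤ t → |F t| ≤ 2 * K * E t)
    (hM : ∀ t, 0 ≤ t → ξ t * M t ≤ D t + C * (ξ t * H t)) {t : ℝ} (ht : 0 ≤ t) :
    E t ≤ (Real.exp (2 / (4 * K * ξ 0 + 2 * K + 3) * ∫ s in (0 : ℝ)..1, ξ s)
        * (4 * K * ξ 0 + 2 * K + 3) * E 0 + (K + 1) * C + 1) *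
      (Real.exp (-(2 / (4 * K * ξ 0 + 2 * K + 3)) * ∫ s in (0 : ℝ)..t, ξ s) *
        (1 + ∫ σ in (0 : ℝ)..t, Real.exp (2 / (4 * K * ξ 0 + 2 * K + 3)
          * ∫ s in (0 : ℝ)..σ, ξ s) * ξ σ * H σ)) := by
  have hξ00 := hξ0 0 le_rfl
  -- N bounds the Lyapunov functional Q below by multiples of E: Q ≤ NE, and so the decay term -2ξE
  -- is at most -(2/N)ξQ.
  set N := 4 * K * ξ 0 + 2 * K + 3 with hN
  have hN3 : 3 ≤ N := by have : 0 ≤ 4 * K * ξ 0 := by positivity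
                         linarith
  set c := 2 / N with hc
  have hc0 : 0 ≤ c := by positivity
  set Θ := fun t => ∫ s in (0 : ℝ)..t, ξ s with hΘ
  have hξi : ∀ {a b}, 0 ≤ a → 0 ≤ b → IntervalIntegrable ξ volume a b :=
    fun ha hb => intervalIntegrable_of_Ici hξc ha hb
  have hΘd : ∀ t, 0 < t → HasDerivAt Θ (ξ t) t := fun t ht =>
    intervalIntegral.integral_hasDerivAt_right (hξi le_rfl ht.le)
      ((hξc.mono Ioi_subset_Ici_self).stronglyMeasurableAtFilter isOpen_Ioi t ht)
      (hξc.continuousAt (Ici_mem_nhds ht))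
  have hΘc : ContinuousOn Θ (Ici 0) := LocInt.continuousOn_primitive fun a b ha hb => hξi ha hb
  have hΘmono : ∀ {a b}, 0 ≤ a → a ≤ b → Θ a ≤ Θ b := fun {a b} ha hab => by
    have e := intervalIntegral.integral_interval_sub_left (hξi le_rfl (ha.trans hab)) (hξi le_rfl ha)
    have := intervalIntegral.integral_nonneg hab (μ := volume) fun s hs => hξ0 s (ha.trans hs.1)
    simp only [hΘ]
    linarith
  have hξanti : ∀ t, 0 ≤ t → ξ t ≤ ξ 0 := fun t ht => by
    refine antitoneOn_of_deriv_nonpos (convex_Ici 0) hξc ?_ ?_ (mem_Ici.2 le_rfl) ht ht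
    · rw [interior_Ici]
      exact fun s hs => (hξd s hs).differentiableAt.differentiableWithinAt
    · rw [interior_Ici]
      intro s hs
      rw [(hξd s hs).deriv]
      exact hξ' s (le_of_lt hs)
  have hEanti : ∀ {a b}, 0 ≤ a → a ≤ b → E b ≤ E a := fun {a b} ha hab => by
    have h1 := hE a b ha hab
    have h2 : 0 ≤ ∫ t in a..b, D t :=
      intervalIntegral.integral_nonneg hab fun s hs => hD0 s (ha.trans hs.1)
    linarith
  set W := fun σ => Real.exp (c * Θ σ) * ξ σ * H σ with hW
  have hWc : ContinuousOn W (Ici 0) :=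
    (((continuousOn_const.mul hΘc).rexp).mul hξc).mul hHc
  have hW0 : ∀ s, 0 ≤ s → 0 ≤ W s := fun s hs =>
    mul_nonneg (mul_nonneg (Real.exp_pos _).le (hξ0 s hs)) (hH0 s hs)
  have hIW : ∀ {a b}, 0 ≤ a → a ≤ b → 0 ≤ ∫ s in a..b, W s := fun ha hab =>
    intervalIntegral.integral_nonneg hab fun s hs => hW0 s (ha.trans hs.1)
  have hE00 := hE0 0 le_rfl
  have hKC : 0 ≤ (K + 1) * C := by positivity
  have hexp : 0 ≤ Real.exp (c * Θ 1) * N * E 0 := by positivity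
  change E t ≤ (Real.exp (c * Θ 1) * N * E 0 + (K + 1) * C + 1) *
    (Real.exp (-c * Θ t) * (1 + ∫ σ in (0 : ℝ)..t, W σ))
  -- F exists only from time 1 on. Up to time 1 monotonicity of E suffices, at the price of the
  -- factor exp(c∫_0^1 ξ).
  rcases le_total t 1 with ht1 | ht1
  · have h1 : 1 ≤ Real.exp (c * Θ 1) * Real.exp (-c * Θ t) := by
      rw [← Real.exp_add]
      refine Real.one_le_exp ?_
      have := mul_le_mul_of_nonneg_left (hΘmono ht ht1) hc0
      linarith
    have h2 := hEanti le_rfl ht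
    have h3 := hIW le_rfl ht
    calc E t ≤ E 0 := h2
      _ ≤ (Real.exp (c * Θ 1) * Real.exp (-c * Θ t)) * (N * E 0) := by
        refine (le_mul_of_one_le_left hE00 (by linarith : 1 ≤ N)).trans
          (le_mul_of_one_le_left (by positivity) h1)
      _ = (Real.exp (c * Θ 1) * N * E 0) * (Real.exp (-c * Θ t) * 1) := by ring
      _ ≤ _ := by gcongr <;> linarith
  · have hsub : ∀ {b}, Icc 1 b ⊆ Ici (0 : ℝ) := fun {b} s hs => zero_le_one.trans hs.1
    have sub1 : Ici (1 : ℝ) ⊆ Ici 0 := Ici_subset_Ici.2 zero_le_one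
    -- Adding 2KE makes the functional nonnegative, so the term ξ'P has a favourable sign.
    set P := fun t => F t + 2 * K * E t with hP
    have hPc : ContinuousOn P (Ici 1) := hFc.add (continuousOn_const.mul (hEc.mono sub1))
    have hP0 : ∀ t, 1 ≤ t → 0 ≤ P t := fun t ht => by
      have := (abs_le.1 (hFE t ht)).1
      simp only [hP]; linarith
    have hPle : ∀ t, 1 ≤ t → P t ≤ 4 * K * E t := fun t ht => by
      have := (abs_le.1 (hFE t ht)).2
      simp only [hP]; linarith
    set r := fun t => -2 * E t + (K + 1) * M t with hr
    have hrc : ContinuousOn r (Ici 0) :=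
      (continuousOn_const.mul hEc).add (continuousOn_const.mul hMc)
    have hPr : ∀ a b, 1 ≤ a → a ≤ b → P b - P a ≤ ∫ t in a..b, r t := fun a b ha hab => by
      have h1 := hF a b ha hab
      have h2 := mul_le_mul_of_nonneg_left (hEanti (zero_le_one.trans ha) hab) hK
      simp only [hP]; linarith
    -- The term ξ(K + 1)M in the derivative of ξP costs (K + 1)D plus the source; the energy
    -- inequality repays (K + 3/2)D. The added energy also gives Q ≥ E.
    set Q := fun t => ξ t * P t + (2 * K + 3) * E t with hQ
    have hQc : ContinuousOn Q (Ici 1) :=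
      ((hξc.mono sub1).mul hPc).add (continuousOn_const.mul (hEc.mono sub1))
    have hEQ : ∀ t, 1 ≤ t → E t ≤ Q t := fun t ht => by
      have h1 := mul_nonneg (hξ0 t (zero_le_one.trans ht)) (hP0 t ht)
      have h2 := hE0 t (zero_le_one.trans ht)
      simp only [hQ]; nlinarith
    have hQle : ∀ t, 1 ≤ t → Q t ≤ N * E t := fun t ht => by
      have ht0 := zero_le_one.trans ht
      have h1 : ξ t * P t ≤ ξ 0 * (4 * K * E t) :=
        mul_le_mul (hξanti t ht0) (hPle t ht) (hP0 t ht) hξ00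
      simp only [hQ, hN]; linarith
    set q := fun t => -c * ξ t * Q t + (K + 1) * C * (ξ t * H t) with hq
    have hqc : ContinuousOn q (Ici 1) :=
      ((continuousOn_const.mul (hξc.mono sub1)).mul hQc).add
        (continuousOn_const.mul ((hξc.mono sub1).mul (hHc.mono sub1)))
    have hQq : ∀ a b, 1 ≤ a → a ≤ b → Q b - Q a ≤ ∫ t in a..b, q t := fun a b ha hab => by
      have ha0 := zero_le_one.trans ha
      have hb0 := ha0.trans hab
      have sI : Icc a b ⊆ Ici 1 := fun s hs => ha.trans hs.1
      have h1 : ξ b * P b - ξ a * P a ≤ ∫ t in a..b, (ξ' t * P t + ξ t * r t) :=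
        mul_sub_le_integral hab (hPc.mono sI) (hrc.mono (sI.trans sub1))
          (fun x y hx hxy _ => hPr x y (ha.trans hx) hxy)
          (fun s hs => hξd s (zero_lt_one.trans_le (ha.trans hs.1))) (hξ'c.mono (sI.trans sub1))
          (fun s hs => hξ0 s (ha0.trans hs.1)) (Or.inr fun s hs => hξ' s (ha0.trans hs.1))
      have h2 := mul_le_mul_of_nonneg_left (hE a b ha0 hab) (by linarith : 0 ≤ 2 * K + 3)
      have iD : IntervalIntegrable D volume a b := intervalIntegrable_of_Ici hDc ha0 hb0
      have h3 : (∫ t in a..b, (ξ' t * P t + ξ t * r t))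
          ≤ ∫ t in a..b, (q t + (K + 1) * D t) := by
        refine intervalIntegral.integral_mono_on hab
          ((((hξ'c.mono (sI.trans sub1)).mul (hPc.mono sI)).add ((hξc.mono (sI.trans sub1)).mul
            (hrc.mono (sI.trans sub1)))).intervalIntegrable_of_Icc hab)
          (((hqc.mono sI).intervalIntegrable_of_Icc hab).add (iD.const_mul _)) fun s hs => ?_
        have hs1 := ha.trans hs.1
        have hs0 := zero_le_one.trans hs1
        have e1 := mul_nonpos_of_nonpos_of_nonneg (hξ' s hs0) (hP0 s hs1)
        have e2 := mul_le_mul_of_nonneg_left (hM s hs0) (by linarith : 0 ≤ K + 1)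
        have e3 : c * ξ s * Q s ≤ 2 * (ξ s * E s) := by
          calc c * ξ s * Q s ≤ c * ξ s * (N * E s) :=
                mul_le_mul_of_nonneg_left (hQle s hs1) (mul_nonneg hc0 (hξ0 s hs0))
            _ = 2 * (ξ s * E s) := by
                have : c * N = 2 := div_mul_cancel₀ _ (by linarith)
                linear_combination ξ s * E s * this
        simp only [hq, hr]
        linarith
      rw [intervalIntegral.integral_add ((hqc.mono sI).intervalIntegrable_of_Icc hab)
        (iD.const_mul _), intervalIntegral.integral_const_mul] at h3
      have h4 : 0 ≤ ∫ t in a..b, D t :=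
        intervalIntegral.integral_nonneg hab fun s hs => hD0 s (ha0.trans hs.1)
      simp only [hQ]
      linarith
    -- Integrating factor: its derivative cancels the term -cξQ of q, and only the source survives.
    have hfin : Real.exp (c * Θ t) * Q t - Real.exp (c * Θ 1) * Q 1
        ≤ ∫ s in (1 : ℝ)..t, (Real.exp (c * Θ s) * (c * ξ s) * Q s + Real.exp (c * Θ s) * q s) :=
      mul_sub_le_integral ht1 (hQc.mono Icc_subset_Ici_self) (hqc.mono Icc_subset_Ici_self)
        (fun x y hx hxy _ => hQq x y hx hxy)
        (fun s hs => ((hΘd s (zero_lt_one.trans_le hs.1)).const_mul c).exp)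
        (((continuousOn_const.mul hΘc).rexp.mul (continuousOn_const.mul hξc)).mono hsub)
        (fun s _ => (Real.exp_pos _).le)
        (Or.inl fun s hs => mul_nonneg (Real.exp_pos _).le (mul_nonneg hc0 (hξ0 s (hsub hs))))
    have e1 : ∫ s in (1 : ℝ)..t, (Real.exp (c * Θ s) * (c * ξ s) * Q s + Real.exp (c * Θ s) * q s)
        = (K + 1) * C * ∫ s in (1 : ℝ)..t, W s := by
      rw [← intervalIntegral.integral_const_mul]
      congr 1
      funext s
      simp only [hq, hW]; ring
    have e2 : (∫ s in (0 : ℝ)..t, W s) = (∫ s in (0 : ℝ)..1, W s) + ∫ s in (1 : ℝ)..t, W s :=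
      (intervalIntegral.integral_add_adjacent_intervals
        (intervalIntegrable_of_Ici hWc le_rfl zero_le_one)
        (intervalIntegrable_of_Ici hWc zero_le_one ht)).symm
    have h1 := hIW le_rfl zero_le_one
    have h2 := hIW zero_le_one ht1
    have h3 : Q 1 ≤ N * E 0 :=
      (hQle 1 le_rfl).trans (mul_le_mul_of_nonneg_left (hEanti le_rfl zero_le_one) (by linarith))
    have h4 := mul_le_mul_of_nonneg_left h3 (Real.exp_pos (c * Θ 1)).le
    have h5 : Real.exp (c * Θ t) * Q t ≤ (Real.exp (c * Θ 1) * N * E 0 + (K + 1) * C + 1) *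
        (1 + ∫ σ in (0 : ℝ)..t, W σ) := by
      rw [e1] at hfin
      have h6 : (K + 1) * C * (∫ s in (1 : ℝ)..t, W s) ≤ (K + 1) * C * ∫ s in (0 : ℝ)..t, W s :=
        mul_le_mul_of_nonneg_left (by linarith) hKC
      have h7 : 0 ≤ ∫ s in (0 : ℝ)..t, W s := by linarith
      have h8 : 0 ≤ (Real.exp (c * Θ 1) * N * E 0) * ∫ s in (0 : ℝ)..t, W s :=
        mul_nonneg hexp h7
      linarith
    calc E t ≤ Q t := hEQ t ht1
      _ = Real.exp (-c * Θ t) * (Real.exp (c * Θ t) * Q t) := by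
        rw [← mul_assoc, ← Real.exp_add]
        simp
      _ ≤ Real.exp (-c * Θ t) * ((Real.exp (c * Θ 1) * N * E 0 + (K + 1) * C + 1) *
        (1 + ∫ σ in (0 : ℝ)..t, W σ)) := by gcongr
      _ = _ := by ring

end

end
end Kawahara

/-! ### Decay of the energy, and the theorem. -/

namespace Kawahara
noncomputable section

section
variable {g ξ : ℝ → ℝ}

theorem IsRate.hasDerivAt (h : IsRate g ξ) {t : ℝ} (ht : 0 < t) :
    HasDerivAt ξ (derivWithin ξ (Ici 0) t) t :=
  ((h.contDiff.differentiableOn one_ne_zero t ht.le).hasDerivWithinAt).hasDerivAt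
    (Ici_mem_nhds ht)

theorem IsRate.continuousOn_derivWithin (h : IsRate g ξ) :
    ContinuousOn (derivWithin ξ (Ici 0)) (Ici 0) :=
  h.contDiff.continuousOn_derivWithin (uniqueDiffOn_Ici 0) le_rfl

theorem IsRate.antitoneOn (h : IsRate g ξ) : AntitoneOn ξ (Ici 0) := by
  refine antitoneOn_of_deriv_nonpos (convex_Ici 0) h.contDiff.continuousOn ?_ ?_
  · rw [interior_Ici]
    exact fun s hs => (h.hasDerivAt hs).differentiableAt.differentiableWithinAt
  · rw [interior_Ici]
    intro s hs
    rw [(h.hasDerivAt hs).deriv]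
    exact h.deriv_nonpos s (le_of_lt hs)

/-- Only the divergence of ∫ξ excludes the value 0; positivity is needed for an exponential rate. -/
theorem IsRate.pos_of_const (h : IsRate g ξ) {ξ₀ : ℝ} (hc : ∀ t, 0 ≤ t → ξ t = ξ₀) : 0 < ξ₀ := by
  by_contra! hneg
  obtain ⟨t, ht, ht0⟩ := ((h.integral_eq_top.eventually_gt_atTop 0).and (eventually_ge_atTop 0)).exists
  have : ∫ s in (0 : ℝ)..t, ξ s = ∫ _ in (0 : ℝ)..t, ξ₀ :=
    intervalIntegral.integral_congr fun s hs => hc s (by rw [uIcc_of_le ht0] at hs; exact hs.1)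
  rw [this, intervalIntegral.integral_const, smul_eq_mul, sub_zero] at ht
  nlinarith

end

section
variable {L a₀ a₁ : ℝ} {k : ℕ} {g γ : ℝ → ℝ} {c : ℝ} {v₀ : L2 L} {η₀ u : ℝ → L2 L}

theorem IsSolution.energy_zero (h : IsSolution L a₀ a₁ k g v₀ η₀ u) :
    energy L k g η₀ u 0 = 1 / 2 * (‖v₀‖ ^ 2 + LgNormSq L k g η₀) := by
  have : LgNormSq L k g (history u η₀ 0) = LgNormSq L k g η₀ :=
    setIntegral_congr_fun measurableSet_Ioi fun s (hs : 0 < s) => by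
      simp [history, not_le.2 hs]
  rw [energy, this, h.initial]

theorem memDissipation_nonneg (hg : IsKernel g γ c) (η : ℝ → L2 L) :
    0 ≤ memDissipation L k γ η :=
  setIntegral_nonneg measurableSet_Ioi fun s (hs : 0 < s) =>
    mul_nonneg (hg.nonneg s hs.le) (sq_nonneg _)

theorem energy_nonneg (hg : IsKernel g γ c) (t : ℝ) : 0 ≤ energy L k g η₀ u t := by
  have := LgNormSq_nonneg (k := k) hg (history u η₀ t)
  unfold energy
  positivity

variable [hL : Fact (0 < L)]

theorem IsSolution.energy_le_zero (h : IsSolution L a₀ a₁ k g v₀ η₀ u) (ha₀ : 0 < a₀)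
    (hk : k ≤ 2) (hg : IsKernel g γ c) {t : ℝ} (ht : 0 ≤ t) :
    energy L k g η₀ u t ≤ energy L k g η₀ u 0 := by
  have h1 := h.energy_add_le ha₀ hk hg le_rfl ht
  have h2 : 0 ≤ ∫ s in (0 : ℝ)..t, memDissipation L k γ (history u η₀ s) :=
    intervalIntegral.integral_nonneg ht fun s _ => memDissipation_nonneg hg _
  linarith

theorem IsSolution.norm_sq_add_LgNormSq_le (h : IsSolution L a₀ a₁ k g v₀ η₀ u) (ha₀ : 0 < a₀)
    (hk : k ≤ 2) (hg : IsKernel g γ c) {t : ℝ} (ht : 0 ≤ t) :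
    ‖u t‖ ^ 2 + LgNormSq L k g (history u η₀ t) ≤ energyNorm L k g v₀ η₀ ^ 2 := by
  have h1 := h.energy_le_zero ha₀ hk hg ht
  have h2 := LgNormSq_nonneg (k := k) hg η₀
  rw [h.energy_zero, energy] at h1
  rw [energyNorm, Real.sq_sqrt (by positivity)]
  linarith

/-- Decay of the energy of all solutions with the same initial datum, from a bound of the memory
by its dissipation. No smallness of the datum is needed: lower order terms and the nonlinearity are
absorbed by `exists_observability`, up to a part of `u` that is small relative to `∂_x²u`. -/
theorem exists_energy_decay (ha₀ : 0 < a₀) (a₁ : ℝ) (hk : k ≤ 2) (hg : IsKernel g γ c) {ξ : ℝ → ℝ}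
    (hξ : IsRate g ξ) (v₀ : L2 L) (η₀ : ℝ → L2 L) {C : ℝ} (hC : 0 ≤ C) :
    ∃ c c' : ℝ, 0 < c ∧ 0 < c' ∧ ∀ u H : ℝ → _, IsSolution L a₀ a₁ k g v₀ η₀ u →
      ContinuousOn H (Ici 0) → (∀ t, 0 ≤ t → 0 ≤ H t) →
      (∀ t, 0 ≤ t → ξ t * LgNormSq L k g (history u η₀ t)
        ≤ memDissipation L k γ (history u η₀ t) + C * (ξ t * H t)) →
      ∀ t, 0 ≤ t → energy L k g η₀ u t ≤ c' * (Real.exp (-c * ∫ τ in (0 : ℝ)..t, ξ τ) *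
        (1 + ∫ σ in (0 : ℝ)..t, Real.exp (c * ∫ τ in (0 : ℝ)..σ, ξ τ) * ξ σ * H σ)) := by
  -- The norm of the datum is an a priori bound for ‖u(t)‖, so K, and with it the final constants,
  -- depends on the datum and not on the solution.
  obtain ⟨K, hK, lyap⟩ := exists_lyapunov L ha₀ a₁ hk hg (energyNorm L k g v₀ η₀)
  have hE0 : 0 ≤ 1 / 2 * (‖v₀‖ ^ 2 + LgNormSq L k g η₀) := by
    have := LgNormSq_nonneg (k := k) hg η₀
    positivity
  have hξ0 := hξ.nonneg 0 le_rfl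
  refine ⟨2 / (4 * K * ξ 0 + 2 * K + 3), Real.exp (2 / (4 * K * ξ 0 + 2 * K + 3)
      * ∫ s in (0 : ℝ)..1, ξ s) * (4 * K * ξ 0 + 2 * K + 3)
      * (1 / 2 * (‖v₀‖ ^ 2 + LgNormSq L k g η₀)) + (K + 1) * C + 1, by positivity, by positivity,
    fun u H h hHc hH0 hM t ht => ?_⟩
  have bound : ∀ t, 0 ≤ t → ‖u t‖ ≤ energyNorm L k g v₀ η₀ := fun t ht => by
    refine le_of_sq_le_sq ?_ (Real.sqrt_nonneg _)
    have h1 := h.norm_sq_add_LgNormSq_le ha₀ hk hg ht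
    have h2 := LgNormSq_nonneg (k := k) hg (history u η₀ t)
    linarith
  obtain ⟨F, hFc, hFle, hFd⟩ := lyap h bound
  have hMc := h.continuousOn_LgNormSq hg
  rw [← h.energy_zero]
  refine decay_of_lyapunov (E := energy L k g η₀ u)
    (M := fun t => LgNormSq L k g (history u η₀ t))
    (D := fun t => memDissipation L k γ (history u η₀ t)) (F := F)
    hK hC hξ.contDiff.continuousOn hξ.continuousOn_derivWithin (fun t ht => hξ.hasDerivAt ht)
    hξ.nonneg hξ.deriv_nonpos ?_ hMc (h.continuousOn_memDissipation hg) hHc hFc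
    (fun t _ => energy_nonneg hg t) (fun t _ => memDissipation_nonneg hg _) hH0
    (fun a b ha hab => h.energy_add_le ha₀ hk hg ha hab) (fun a b ha hab => ?_) (fun t ht => ?_)
    hM ht
  · exact continuousOn_const.mul ((h.cont.norm.pow 2).add hMc)
  · refine (hFd a b ha hab).trans_eq (intervalIntegral.integral_congr fun t _ => ?_)
    simp only [energy]
    ring
  · refine (hFle t ht).trans_eq ?_
    rw [energy]
    ring

end

end
end Kawahara

theorem theorem1p1
    (L a₀ a₁ : ℝ) (hL : 0 < L) (ha₀ : 0 < a₀) (k : ℕ) (hk : k ≤ 2)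
    (M_P M_S : ℝ) (hM_P : Kawahara.IsPoincareConstant L M_P)
    (hM_S : Kawahara.IsSobolevConstant L M_S)
    (f ξ : ℝ → ℝ) (hf : Kawahara.IsMemoryKernel f)
    (hξ : Kawahara.IsRate (Kawahara.gker f) ξ)
    (v₀ : Kawahara.L2 L) (η₀ : ℝ → Kawahara.L2 L)
    (hη₀ : Kawahara.MemLg L k (Kawahara.gker f) η₀)
    (hsmall : a₁ * M_P ^ 2 + 2 / 3 * M_P * (M_P + 1) * Real.sqrt L * M_S *
      Kawahara.energyNorm L k (Kawahara.gker f) v₀ η₀ < 5 * a₀) :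
    ∃ c c' : ℝ, 0 < c ∧ 0 < c' ∧
      ∀ u : ℝ → Kawahara.L2 L,
        Kawahara.IsSolution L a₀ a₁ k (Kawahara.gker f) v₀ η₀ u →
        ((∃ ξ₀ : ℝ, ∀ t, 0 ≤ t → ξ t = ξ₀) →
          ∀ t, 0 ≤ t →
            Kawahara.energy L k (Kawahara.gker f) η₀ u t ≤ c' * Real.exp (-c * t)) ∧
        ((¬ ∃ ξ₀ : ℝ, ∀ t, 0 ≤ t → ξ t = ξ₀) →
          (∀ t, 0 ≤ t →
            Kawahara.energy L k (Kawahara.gker f) η₀ u t ≤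
              c' * Kawahara.generalRate (Kawahara.gker f) ξ (Kawahara.hHist L k η₀) c t) ∧
          (∀ u₀ : ℝ → Kawahara.L2 L, Kawahara.IsPastOf L k u₀ η₀ →
            ∀ t, 0 ≤ t →
              Kawahara.energy L k (Kawahara.gker f) η₀ u t ≤
                c' * Kawahara.generalRate (Kawahara.gker f) ξ (Kawahara.hPast L k u₀) c t)) := by
  have : Fact (0 < L) := ⟨hL⟩
  obtain ⟨c₁, hg⟩ := hf.exists_isKernel
  have hξγ : ∀ s, 0 ≤ s →
      ξ s * Kawahara.gker f s ≤ -derivWithin (Kawahara.gker f) (Ici 0) s := fun s hs => by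
    linarith [hξ.deriv_le s hs]
  by_cases hconst : ∃ ξ₀ : ℝ, ∀ t, 0 ≤ t → ξ t = ξ₀
  · obtain ⟨ξ₀, hξ₀⟩ := hconst
    have hpos := hξ.pos_of_const hξ₀
    obtain ⟨c, c', hc, hc', decay⟩ :=
      Kawahara.exists_energy_decay ha₀ a₁ hk hg hξ v₀ η₀ (le_refl (0 : ℝ))
    refine ⟨c * ξ₀, c', mul_pos hc hpos, hc', fun u h => ⟨fun _ t ht => ?_, fun hn =>
      absurd ⟨ξ₀, hξ₀⟩ hn⟩⟩
    -- For constant ξ the comparison ξ(t)g(s) ≤ γ(s) holds for all s > 0, so the source is zero and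
    -- the rate is exp(-cξ₀t).
    have h1 := decay u (fun _ => 0) h continuousOn_const (fun _ _ => le_rfl) (fun t ht => by
      have := h.mul_integral_le_memDissipation hg ht (r := ξ t) measurableSet_Ioi subset_rfl
        fun s hs => by
          rw [hξ₀ t ht, ← hξ₀ s (le_of_lt hs)]
          exact hξγ s (le_of_lt hs)
      rwa [zero_mul, add_zero]) t ht
    have h2 : ∫ s in (0 : ℝ)..t, ξ s = ξ₀ * t := by
      have : ∫ s in (0 : ℝ)..t, ξ s = ∫ _ in (0 : ℝ)..t, ξ₀ :=
        intervalIntegral.integral_congr fun s hs => hξ₀ s (by rw [uIcc_of_le ht] at hs; exact hs.1)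
      rw [this, intervalIntegral.integral_const, smul_eq_mul, sub_zero, mul_comm]
    simp only [mul_zero, intervalIntegral.integral_zero, add_zero, mul_one, h2] at h1
    rwa [show -(c * ξ₀) * t = -c * (ξ₀ * t) by ring]
  · obtain ⟨K, hK, hd⟩ := Kawahara.exists_norm_integral_wderiv_sq_le L ha₀ a₁ hk hg
      (Kawahara.energyNorm L k (Kawahara.gker f) v₀ η₀)
    obtain ⟨c, c', hc, hc', decay⟩ := Kawahara.exists_energy_decay ha₀ a₁ hk hg hξ v₀ η₀
      (by positivity : 0 ≤ 2 * (K + 1))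
    refine ⟨c, c', hc, hc', fun u h => ⟨fun hc => absurd hc hconst, fun _ => ?_⟩⟩
    have main : ∀ t, 0 ≤ t → Kawahara.energy L k (Kawahara.gker f) η₀ u t ≤
        c' * Kawahara.generalRate (Kawahara.gker f) ξ (Kawahara.hHist L k η₀) c t := by
      have hb := fun t ht => h.norm_sq_add_LgNormSq_le ha₀ hk hg (t := t) ht
      refine decay u (fun t => ∫ s in Ioi t, Kawahara.gker f s * Kawahara.hHist L k η₀ t s) h
        (hη₀.continuousOn_integral_hHist hg) (fun t ht => Kawahara.integral_hHist_nonneg hg ht)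
        fun t ht => h.mul_LgNormSq_le hk hg hη₀ hξ.nonneg hξ.antitoneOn hξγ hK ht
          (hd h (fun t ht => ?_) (fun t ht => ?_) t ht)
      · refine le_of_sq_le_sq ?_ (Real.sqrt_nonneg _)
        linarith [hb t ht, Kawahara.LgNormSq_nonneg (k := k) hg (Kawahara.history u η₀ t)]
      · linarith [hb t ht, sq_nonneg ‖u t‖]
    exact ⟨main, fun u₀ hu₀ t ht => (hu₀.generalRate_eq _ _ _ _).symm ▸ main t ht⟩
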